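/- Let $l$ be a prime, $K$ a field with $\operatorname{char} K \nmid l$, $E$ an elliptic curve over $K$ given by a Weierstrass equation with coordinate functions $x,y$, and $P \in E(K)$. Let $\psi_l$ be the $l$-th division polynomial of $E$; then $\psi_l^2$ is represented by a polynomial in $K[x]$, and there is a unique polynomial $\theta_l \in K[x]$ with $x\circ[l] = \theta_l/\psi_l^2$. Define $\delta_l^P \in K[x]$ by $\delta_l^P = \theta_l - x(P)\,\psi_l^2$ if $P \neq O$, and $\delta_l^P = \psi_l^2$ if $P = O$. Then at least one of the following holds: (i) $\delta_l^P$ is irreducible over $K$; (ii) $E$ has a $K$-rational $l$-isogeny, that is, there exist an elliptic curve $E'$ over $K$ and an isogeny $E \to E'$ of degree $l$ defined over $K$; (iii) $[l]^{-1}P$ contains a $K$-rational point, that is, there is $R \in E(K)$ with $lR = P$. -/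

import Mathlib

open Polynomial

noncomputable section

namespace EllipticPreimage

variable {K : Type*} [Field K]

/-- The polynomial `δ_m^P ∈ K[x]` attached to an integer `m` and a `K`-rational point `P` of the
Weierstrass curve `W`: it is `θ_m - x(P) ψ_m²` if `P ≠ O`, and `ψ_m²` if `P = O`. Here
`W.Φ m = θ_m` and `W.ΨSq m = ψ_m²`, as univariate polynomials in `x`, are the numerator and the
denominator of the multiplication-by-`m` map on `x`-coordinates. -/
def delta (W : WeierstrassCurve K) (m : ℤ) : W.toAffine.Point → K[X]
  | .zero => W.ΨSq m
  | .some x _ _ => W.Φ m - C x * W.ΨSq m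

/-- The function `f ∈ K(W)` has a pole at the point `O` at infinity.

For a nonzero element `a = p(x) + q(x) y` of the coordinate ring, the pole order of `a` at `O` is
`max (2 deg p) (2 deg q + 3)`, which is the degree in `x` of the norm of `a` from `K[W]` to `K[x]`.
So a quotient `a / b` has a pole at `O` exactly when the norm of `a` has larger degree than the
norm of `b`. -/
def HasPoleAtInfinity (W : WeierstrassCurve K) (f : W.toAffine.FunctionField) : Prop :=
  ∃ a b : W.toAffine.CoordinateRing, b ≠ 0 ∧
    f = algebraMap W.toAffine.CoordinateRing W.toAffine.FunctionField a /
      algebraMap W.toAffine.CoordinateRing W.toAffine.FunctionField b ∧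
    (Algebra.norm K[X] b).natDegree < (Algebra.norm K[X] a).natDegree

/-- The coordinate function `x` in the function field `K(W)`. -/
def xFunction (W : WeierstrassCurve K) : W.toAffine.FunctionField :=
  algebraMap W.toAffine.CoordinateRing W.toAffine.FunctionField
    (algebraMap K[X] W.toAffine.CoordinateRing X)

/-- A (nonzero) isogeny `φ : E → E'` of elliptic curves, defined over `K`: a nonconstant morphism
over `K` with `φ(O) = O'`. By the anti-equivalence between smooth projective curves over `K` with
nonconstant `K`-morphisms and their function fields, such a morphism is given by the embedding
`φ^* : K(E') → K(E)` of extensions of `K`. As `O'` is the only pole of `x' ∈ K(E')`, the condition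
`φ(O) = O'` says that `φ^* x' = x' ∘ φ` has a pole at `O`. -/
structure Isogeny (E E' : WeierstrassCurve K) [E.IsElliptic] [E'.IsElliptic] where
  /-- The pullback of functions along the isogeny. -/
  pullback : E'.toAffine.FunctionField →ₐ[K] E.toAffine.FunctionField
  /-- The isogeny maps `O` to `O'`. -/
  map_zero : HasPoleAtInfinity E (pullback (xFunction E'))

/-- The degree of an isogeny `φ : E → E'`, that is, `[K(E) : φ^* K(E')]`. -/
def Isogeny.degree {E E' : WeierstrassCurve K} [E.IsElliptic] [E'.IsElliptic]
    (φ : Isogeny E E') : ℕ :=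
  Module.finrank φ.pullback.fieldRange E.toAffine.FunctionField

/-- The elliptic curve `E` over `K` admits a `K`-rational `n`-isogeny: there are an elliptic curve
`E'` over `K` and an isogeny `E → E'` of degree `n` defined over `K`. -/
def HasRationalIsogeny (E : WeierstrassCurve K) [E.IsElliptic] (n : ℕ) : Prop :=
  ∃ (E' : WeierstrassCurve K) (_ : E'.IsElliptic) (φ : Isogeny E E'), φ.degree = n

end EllipticPreimage

end

/-! Let `L` be a separable closure of `K`. If `P = O`, then `O` is a preimage of `P`. If `P` has
order two, then either `l` is odd and `lP = P`, or `l = 2` and the subgroup generated by `P` is the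
kernel of a rational 2-isogeny. Otherwise let `T` be the set of `R ∈ E(L)` with `lR = P`. No two
points of `T` are opposite, so `x` is injective on `T`; moreover `δ` is separable of degree `l²`
with root set `x(T)`, so `T` has `l²` points. If Galois is transitive on `T`, then `δ` is the
minimal polynomial of any `x(R)`, hence irreducible. It remains to see that a non-transitive Galois
action fixes a point of `T` or stabilizes a subgroup of order `l`, and that such a subgroup is the
kernel of a rational `l`-isogeny.

The group theory is `fixed_or_transitive_or_stable`. The set `T` is a torsor under `V = E[l]`. An
orbit of size prime to `l` yields a fixed point by averaging. The elements acting trivially on `V`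
translate `T` by a stable subgroup `M` of `V`. If `M = V` the action is transitive, and if `M` has
order `l` it is the stable line. If `M = 0` and the orbit size is divisible by `l`, then so is the
order of the image of Galois in `GL(V)`. For `l` odd this gives a transvection: either its axis is
stable, or it and a conjugate generate `-1` (`exists_stable_addSubgroup_or_neg`), and an element
acting as `-1` on `V` has a unique fixed point in `T`, which is fixed by everything. For `l = 2` the
orbit is all of `T`, or has two points whose difference generates a stable line.

The facts about `δ` rest on `isXRep_nsmul` (multiplication by `n` is `Φ / ΨSq` on `x`-coordinates)
and on `wronskian`, which expresses that multiplication by `n` multiplies the invariant differential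
by `n`, so that `δ` has no repeated root. They come from polynomial identities verified at the
generic point of the universal curve in characteristic zero and then specialized.

The quotient by a stable subgroup `G` is built in function fields (`hasRationalIsogeny_of_stable`).
The order of a function at `Q` is its order at infinity after translation by `Q`. The key fact is
that an invariant function, regular outside `G` and with at most simple poles, is constant when the
order of `G` is invertible. The traces of `x` and `y` have poles of order two and three, hence
generate a Weierstrass equation; the key fact also shows that this equation is nonsingular and that
the extension has degree `|G|`. Galois descent brings everything down to `K`. -/

namespace WeierstrassCurve

/-! ### The `x`-coordinates of sums and differences of points -/

section XMaps
variable {R : Type*} [CommRing R] (W : WeierstrassCurve R)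

/-- The homogeneous form `(x₁ z₂ - x₂ z₁)² (x(P + Q) + x(P - Q))`. -/
def sumForm (x₁ z₁ x₂ z₂ : R) : R :=
  (2 * x₁ * x₂ + W.b₄ * z₁ * z₂) * (x₁ * z₂ + x₂ * z₁) + W.b₂ * x₁ * x₂ * z₁ * z₂ +
    W.b₆ * z₁ ^ 2 * z₂ ^ 2

/-- The homogeneous form `(x₁ z₂ - x₂ z₁)² x(P + Q) x(P - Q)`. -/
def prodForm (x₁ z₁ x₂ z₂ : R) : R :=
  x₁ ^ 2 * x₂ ^ 2 - W.b₄ * x₁ * x₂ * z₁ * z₂ - W.b₆ * (x₁ * z₂ + x₂ * z₁) * z₁ * z₂ -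
    W.b₈ * z₁ ^ 2 * z₂ ^ 2

end XMaps

namespace Affine.Point
variable {F : Type*} [Field F] {W : Affine F}

/-- The `x`-coordinate of a point, with value `0` at infinity. -/
def xCoord : W.Point → F
  | zero => 0
  | some x _ _ => x

/-- The `y`-coordinate of a point, with value `0` at infinity. -/
def yCoord : W.Point → F
  | zero => 0
  | some _ y _ => y

@[simp] lemma xCoord_some {x y : F} (h : W.Nonsingular x y) : (some x y h).xCoord = x := rfl

@[simp] lemma yCoord_some {x y : F} (h : W.Nonsingular x y) : (some x y h).yCoord = y := rfl

lemma nonsingular_coord {P : W.Point} (hP : P ≠ 0) : W.Nonsingular P.xCoord P.yCoord := by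
  rcases P with _ | ⟨x, y, h⟩
  · exact (hP rfl).elim
  · exact h

lemma equation_coord {P : W.Point} (hP : P ≠ 0) : W.Equation P.xCoord P.yCoord :=
  (nonsingular_coord hP).1

@[simp] lemma xCoord_neg (P : W.Point) : (-P).xCoord = P.xCoord := by
  rcases P with _ | ⟨x, y, h⟩ <;> rfl

lemma yCoord_neg {P : W.Point} (hP : P ≠ 0) : (-P).yCoord = W.negY P.xCoord P.yCoord := by
  rcases P with _ | ⟨x, y, h⟩
  · exact (hP rfl).elim
  · rfl

lemma xCoord_eq_iff {P Q : W.Point} (hP : P ≠ 0) (hQ : Q ≠ 0) :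
    P.xCoord = Q.xCoord ↔ P = Q ∨ P = -Q := by
  rcases P with _ | ⟨x, y, h⟩
  · exact (hP rfl).elim
  rcases Q with _ | ⟨x', y', h'⟩
  · exact (hQ rfl).elim
  exact X_eq_iff

lemma ext_coord {P Q : W.Point} (hP : P ≠ 0) (hQ : Q ≠ 0) (hx : P.xCoord = Q.xCoord)
    (hy : P.yCoord = Q.yCoord) : P = Q := by
  rcases P with _ | ⟨x, y, h⟩
  · exact (hP rfl).elim
  rcases Q with _ | ⟨x', y', h'⟩
  · exact (hQ rfl).elim
  simp only [xCoord_some, yCoord_some] at hx hy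
  subst hx hy
  rfl

/-- The value of the second division polynomial at a point. -/
def psiTwo (P : W.Point) : F := 2 * P.yCoord + W.a₁ * P.xCoord + W.a₃

lemma psiTwo_sq {P : W.Point} (hP : P ≠ 0) :
    P.psiTwo ^ 2 = 4 * P.xCoord ^ 3 + W.b₂ * P.xCoord ^ 2 + 2 * W.b₄ * P.xCoord + W.b₆ := by
  have h := (equation_iff ..).mp (equation_coord hP)
  rw [psiTwo, b₂, b₄, b₆]
  linear_combination 4 * h

variable [DecidableEq F]

lemma add_ne_zero_of_xCoord_ne {P Q : W.Point} (h : P.xCoord ≠ Q.xCoord) : P + Q ≠ 0 := by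
  intro h0
  rw [eq_neg_of_add_eq_zero_left h0, xCoord_neg] at h
  exact h rfl

/-- The chord formula for the `x`-coordinate. -/
lemma xCoord_add {P Q : W.Point} (hP : P ≠ 0) (hQ : Q ≠ 0) (h : P.xCoord ≠ Q.xCoord) :
    (P + Q).xCoord = W.addX P.xCoord Q.xCoord
      ((P.yCoord - Q.yCoord) / (P.xCoord - Q.xCoord)) := by
  rcases P with _ | ⟨x, y, hp⟩
  · exact (hP rfl).elim
  rcases Q with _ | ⟨x', y', hq⟩
  · exact (hQ rfl).elim
  simp only [xCoord_some, yCoord_some] at h ⊢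
  rw [add_of_X_ne h, xCoord_some, slope_of_X_ne h]

lemma yCoord_add {P Q : W.Point} (hP : P ≠ 0) (hQ : Q ≠ 0) (h : P.xCoord ≠ Q.xCoord) :
    (P + Q).yCoord = W.addY P.xCoord Q.xCoord P.yCoord
      ((P.yCoord - Q.yCoord) / (P.xCoord - Q.xCoord)) := by
  rcases P with _ | ⟨x, y, hp⟩
  · exact (hP rfl).elim
  rcases Q with _ | ⟨x', y', hq⟩
  · exact (hQ rfl).elim
  simp only [xCoord_some, yCoord_some] at h ⊢
  rw [add_of_X_ne h, yCoord_some, slope_of_X_ne h]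

lemma xCoord_sub {P Q : W.Point} (hP : P ≠ 0) (hQ : Q ≠ 0) (h : P.xCoord ≠ Q.xCoord) :
    (P - Q).xCoord = W.addX P.xCoord Q.xCoord
      ((P.yCoord - W.negY Q.xCoord Q.yCoord) / (P.xCoord - Q.xCoord)) := by
  rw [sub_eq_add_neg, xCoord_add hP (neg_ne_zero.mpr hQ) (by rwa [xCoord_neg]), yCoord_neg hQ,
    xCoord_neg]

/-- The sum and the product of `x(P + Q)` and `x(P - Q)` are unchanged when the sign of `P` or `Q`
changes, so they are rational in the two `x`-coordinates alone. This allows inductions on multiples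
that never mention `y`. -/
lemma xCoord_add_add_xCoord_sub {P Q : W.Point} (hP : P ≠ 0) (hQ : Q ≠ 0)
    (h : P.xCoord ≠ Q.xCoord) :
    ((P + Q).xCoord + (P - Q).xCoord) * (P.xCoord - Q.xCoord) ^ 2 =
      W.sumForm P.xCoord 1 Q.xCoord 1 := by
  have h₁ := (equation_iff ..).mp (equation_coord hP)
  have h₂ := (equation_iff ..).mp (equation_coord hQ)
  have h₀ := sub_ne_zero.mpr h
  rw [xCoord_add hP hQ h, xCoord_sub hP hQ h, addX, addX, negY, sumForm, b₂, b₄, b₆]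
  field_simp
  linear_combination 2 * h₁ + 2 * h₂

lemma xCoord_add_mul_xCoord_sub {P Q : W.Point} (hP : P ≠ 0) (hQ : Q ≠ 0)
    (h : P.xCoord ≠ Q.xCoord) :
    ((P + Q).xCoord * (P - Q).xCoord) * (P.xCoord - Q.xCoord) ^ 2 =
      W.prodForm P.xCoord 1 Q.xCoord 1 := by
  have h₁ := (equation_iff ..).mp (equation_coord hP)
  have h₂ := (equation_iff ..).mp (equation_coord hQ)
  have h₀ := sub_ne_zero.mpr h
  have ha := xCoord_add hP hQ h
  have hs := xCoord_sub hP hQ h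
  generalize (P + Q).xCoord = u at *
  generalize (P - Q).xCoord = v at *
  generalize P.xCoord = x₁ at *
  generalize Q.xCoord = x₂ at *
  generalize P.yCoord = y₁ at *
  generalize Q.yCoord = y₂ at *
  have hu : u * (x₁ - x₂) ^ 2 = (y₁ - y₂) ^ 2 + W.a₁ * (y₁ - y₂) * (x₁ - x₂) -
      (W.a₂ + x₁ + x₂) * (x₁ - x₂) ^ 2 := by
    rw [ha, addX]
    field_simp
    ring
  have hv : v * (x₁ - x₂) ^ 2 = (y₁ - W.negY x₂ y₂) ^ 2 +
      W.a₁ * (y₁ - W.negY x₂ y₂) * (x₁ - x₂) - (W.a₂ + x₁ + x₂) * (x₁ - x₂) ^ 2 := by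
    rw [hs, addX]
    field_simp
    ring
  apply mul_right_cancel₀ (pow_ne_zero 2 h₀)
  calc u * v * (x₁ - x₂) ^ 2 * (x₁ - x₂) ^ 2 = (u * (x₁ - x₂) ^ 2) * (v * (x₁ - x₂) ^ 2) := by ring
    _ = _ := by
      rw [hu, hv, negY, prodForm, b₄, b₆, b₈]
      linear_combination
        ((y₁ ^ 2 + W.a₁ * x₁ * y₁ + W.a₃ * y₁ + (x₁ ^ 3 + W.a₂ * x₁ ^ 2 + W.a₄ * x₁ + W.a₆)) -
          2 * (y₂ ^ 2 + W.a₁ * x₂ * y₂ + W.a₃ * y₂) - 2 * (W.a₂ + x₁ + x₂) * (x₁ - x₂) ^ 2 +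
          (W.a₁ * x₁ + W.a₃) * (W.a₁ * x₂ + W.a₃) - (W.a₁ * x₂ + W.a₃) ^ 2) * h₁ +
        ((y₂ ^ 2 + W.a₁ * x₂ * y₂ + W.a₃ * y₂ + (x₂ ^ 3 + W.a₂ * x₂ ^ 2 + W.a₄ * x₂ + W.a₆)) -
          2 * (x₁ ^ 3 + W.a₂ * x₁ ^ 2 + W.a₄ * x₁ + W.a₆) -
          2 * (W.a₂ + x₁ + x₂) * (x₁ - x₂) ^ 2 +
          (W.a₁ * x₁ + W.a₃) * (W.a₁ * x₂ + W.a₃) - (W.a₁ * x₁ + W.a₃) ^ 2) * h₂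

/-- If `λ` and `μ` are the slopes for `P + Q` and `P - Q`, the difference is `(λ - μ)(λ + μ + a₁)`,
and the two factors are `-ψ₂(Q)` and `ψ₂(P)` divided by `x(P) - x(Q)`. -/
lemma xCoord_add_sub_xCoord_sub {P Q : W.Point} (hP : P ≠ 0) (hQ : Q ≠ 0)
    (h : P.xCoord ≠ Q.xCoord) :
    ((P + Q).xCoord - (P - Q).xCoord) * (P.xCoord - Q.xCoord) ^ 2 = - (P.psiTwo * Q.psiTwo) := by
  have h₀ := sub_ne_zero.mpr h
  rw [xCoord_add hP hQ h, xCoord_sub hP hQ h, addX, addX, negY, psiTwo, psiTwo]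
  field_simp
  ring

/-- The function `ψ₂ = 2y + a₁x + a₃` is affine linear and odd, and `P`, `Q`, `-(P + Q)` are
collinear: this is linear interpolation along that line. -/
lemma psiTwo_add {P Q : W.Point} (hP : P ≠ 0) (hQ : Q ≠ 0) (h : P.xCoord ≠ Q.xCoord) :
    (P + Q).psiTwo * (P.xCoord - Q.xCoord) =
      P.psiTwo * (Q.xCoord - (P + Q).xCoord) - Q.psiTwo * (P.xCoord - (P + Q).xCoord) := by
  have h₀ := sub_ne_zero.mpr h
  rw [psiTwo, yCoord_add hP hQ h, xCoord_add hP hQ h, addY, negY, negAddY, addX, psiTwo, psiTwo]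
  field_simp
  ring

lemma psiTwo_eq_zero_iff {P : W.Point} (hP : P ≠ 0) : P.psiTwo = 0 ↔ P + P = 0 := by
  rw [add_eq_zero_iff_eq_neg]
  constructor
  · intro h
    refine ext_coord hP (neg_ne_zero.mpr hP) (xCoord_neg P).symm ?_
    rw [yCoord_neg hP, negY]
    rw [psiTwo] at h
    linear_combination h
  · intro h
    have := congrArg yCoord h
    rw [yCoord_neg hP, negY] at this
    rw [psiTwo]
    linear_combination this

lemma xCoord_add_self {P : W.Point} (hP : P ≠ 0) (h : P + P ≠ 0) :
    (P + P).xCoord * P.psiTwo ^ 2 = W.prodForm P.xCoord 1 P.xCoord 1 := by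
  have h₁ := (equation_iff ..).mp (equation_coord hP)
  have h₂ := (psiTwo_eq_zero_iff hP).not.mpr h
  rcases P with _ | ⟨x, y, hp⟩
  · exact (hP rfl).elim
  simp only [psiTwo, xCoord_some, yCoord_some] at h₁ h₂ ⊢
  have hy : y ≠ W.negY x y := by
    intro h
    rw [negY] at h
    exact h₂ (by linear_combination h)
  rw [add_self_of_Y_ne hy, xCoord_some, slope_of_Y_ne rfl hy, addX, prodForm, b₄, b₆, b₈]
  have h₃ : y - W.negY x y = 2 * y + W.a₁ * x + W.a₃ := by rw [negY]; ring
  rw [h₃]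
  obtain ⟨p, hp'⟩ : ∃ p, 2 * y + W.a₁ * x + W.a₃ = p := ⟨_, rfl⟩
  rw [hp'] at h₂ ⊢
  replace h₂ : p ≠ 0 := h₂
  field_simp
  subst hp'
  linear_combination -(W.a₁ ^ 2 + 4 * W.a₂ + 8 * x) * h₁

end Affine.Point
end WeierstrassCurve

/-! ### Division polynomials at a point and its multiples -/

namespace WeierstrassCurve.Affine.Point
variable {F : Type*} [Field F] {W : Affine F}

/-- The value of the `n`-th division polynomial at a point. -/
noncomputable def psiVal (P : W.Point) (n : ℤ) : F :=
  normEDS P.psiTwo (W.Ψ₃.eval P.xCoord) (W.preΨ₄.eval P.xCoord) n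

lemma eval_Ψ₂Sq {P : W.Point} (hP : P ≠ 0) : W.Ψ₂Sq.eval P.xCoord = P.psiTwo ^ 2 := by
  rw [psiTwo_sq hP, Ψ₂Sq]
  simp

lemma psiVal_eq {P : W.Point} (hP : P ≠ 0) (n : ℤ) :
    P.psiVal n = (W.preΨ n).eval P.xCoord * if Even n then P.psiTwo else 1 := by
  rw [psiVal, normEDS, preΨ]
  congr 1
  rw [← coe_evalRingHom, map_preNormEDS]
  simp only [coe_evalRingHom, eval_pow, eval_Ψ₂Sq hP]
  congr 1
  ring

lemma psiVal_sq {P : W.Point} (hP : P ≠ 0) (n : ℤ) :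
    P.psiVal n ^ 2 = (W.ΨSq n).eval P.xCoord := by
  rw [psiVal_eq hP, ΨSq]
  split_ifs <;> simp [eval_Ψ₂Sq hP, mul_pow]

lemma eval_Φ {P : W.Point} (hP : P ≠ 0) (n : ℤ) :
    (W.Φ n).eval P.xCoord =
      P.xCoord * P.psiVal n ^ 2 - P.psiVal (n + 1) * P.psiVal (n - 1) := by
  rw [psiVal_sq hP, psiVal_eq hP, psiVal_eq hP, WeierstrassCurve.Φ]
  by_cases h : Even n
  · have h₁ : ¬ Even (n + 1) := by simpa [parity_simps] using h
    have h₂ : ¬ Even (n - 1) := by simpa [parity_simps] using h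
    simp [h, h₁, h₂]
  · have h₁ : Even (n + 1) := by simpa [parity_simps] using h
    have h₂ : Even (n - 1) := by simpa [parity_simps] using h
    simp [h, h₁, h₂, eval_Ψ₂Sq hP]
    ring

/-- The cancellation in the general step of `psiVal_rel`. There `M, M₁, M₂` are the values of `ψ` at
`k + 1, k, k - 1` and `N, N₁, N₂` those at `n, n + 1, n - 1`. The hypothesis `h` is `xCoord_symm`
for `kQ`, `nQ`, `Q`, and `ha` to `he` are relations already known. -/
lemma psi_step_algebra {a b c d e t M M₁ M₂ N N₁ N₂ Z p q s : F}
    (hM₂ : M₂ ≠ 0) (hN₁ : N₁ ≠ 0) (hN₂ : N₂ ≠ 0) (hp : p ≠ 0) (hq : q ≠ 0)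
    (ha : a * (M₁ ^ 2 * N₁ ^ 2) = Z * p) (hb : b * (M₁ ^ 2 * N₂ ^ 2) = q * s)
    (hc : c * N ^ 2 = N₁ * N₂) (hd : d * (M₂ ^ 2 * N ^ 2) = q * p) (he : e * M₁ ^ 2 = M * M₂)
    (h : a * b * c ^ 2 = t * d * e ^ 2) : t * (M ^ 2 * N ^ 2) = Z * s := by
  have hD : N₁ ^ 2 * N₂ ^ 2 * M₂ ^ 2 * q * p ≠ 0 := by simp [*]
  apply mul_right_cancel₀ hD
  have e₁ : a * b * c ^ 2 * (M₁ ^ 4 * N₁ ^ 2 * N₂ ^ 2 * N ^ 4 * M₂ ^ 2) =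
      (Z * p) * (q * s) * (N₁ * N₂) ^ 2 * M₂ ^ 2 := by
    rw [← ha, ← hb, ← hc]; ring
  have e₂ : t * d * e ^ 2 * (M₁ ^ 4 * N₁ ^ 2 * N₂ ^ 2 * N ^ 4 * M₂ ^ 2) =
      t * (q * p) * (M * M₂) ^ 2 * (N ^ 2 * N₁ ^ 2 * N₂ ^ 2) := by
    rw [← hd, ← he]; ring
  linear_combination e₁ - e₂ - (M₁ ^ 4 * N₁ ^ 2 * N₂ ^ 2 * N ^ 4 * M₂ ^ 2) * h

variable [DecidableEq F]

/-- Each side expands to `x_A²(x_B - x_C)² - x_A · sumForm + prodForm` up to renaming the points,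
and this form is symmetric in the three `x`-coordinates. -/
lemma xCoord_symm {A B C : W.Point} (hA : A ≠ 0) (hB : B ≠ 0) (hC : C ≠ 0)
    (hAC : A.xCoord ≠ C.xCoord) (hBC : B.xCoord ≠ C.xCoord) :
    (A.xCoord - (B + C).xCoord) * (A.xCoord - (B - C).xCoord) * (B.xCoord - C.xCoord) ^ 2 =
      (B.xCoord - (A + C).xCoord) * (B.xCoord - (A - C).xCoord) *
        (A.xCoord - C.xCoord) ^ 2 := by
  have h₁ := xCoord_add_add_xCoord_sub hB hC hBC
  have h₂ := xCoord_add_mul_xCoord_sub hB hC hBC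
  have h₃ := xCoord_add_add_xCoord_sub hA hC hAC
  have h₄ := xCoord_add_mul_xCoord_sub hA hC hAC
  rw [sumForm] at h₁ h₃
  rw [prodForm] at h₂ h₄
  linear_combination -A.xCoord * h₁ + h₂ + B.xCoord * h₃ - h₄

/-- The case of `xCoord_symm` in which two arguments coincide: the quadratic term of the symmetric
form disappears, and the rest is given by the duplication formula. -/
lemma xCoord_symm_self {A C : W.Point} (hA : A ≠ 0) (hC : C ≠ 0) (h2C : C + C ≠ 0)
    (hAC : A.xCoord ≠ C.xCoord) :
    (C.xCoord - (A + C).xCoord) * (C.xCoord - (A - C).xCoord) * (A.xCoord - C.xCoord) ^ 2 =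
      C.psiTwo ^ 2 * ((C + C).xCoord - A.xCoord) := by
  have h₃ := xCoord_add_add_xCoord_sub hA hC hAC
  have h₄ := xCoord_add_mul_xCoord_sub hA hC hAC
  have h₁ := xCoord_add_self hC h2C
  have h₂ := psiTwo_sq hC
  rw [sumForm] at h₃
  rw [prodForm] at h₄ h₁
  linear_combination -C.xCoord * h₃ + h₄ - h₁ + A.xCoord * h₂

variable {Q : W.Point}

lemma xCoord_sub_two (hQ : Q ≠ 0) (h2 : Q.psiVal 2 ≠ 0) :
    2 • Q ≠ 0 ∧
      (Q.xCoord - (2 • Q).xCoord) * Q.psiVal 2 ^ 2 = Q.psiVal 3 := by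
  have hb : Q.psiVal 2 = Q.psiTwo := normEDS_two ..
  have hc : Q.psiVal 3 = W.Ψ₃.eval Q.xCoord := normEDS_three ..
  rw [hb] at h2 ⊢
  rw [hc, two_smul]
  have h := (psiTwo_eq_zero_iff hQ).not.mp h2
  refine ⟨h, ?_⟩
  have h₁ := xCoord_add_self hQ h
  have h₂ := psiTwo_sq hQ
  rw [sub_mul, h₁, h₂, prodForm, Ψ₃]
  simp
  ring

/-- Apply the sum formula to `2Q` and `Q`, whose difference is `Q` itself, so that only `x(3Q)` is
unknown. -/
lemma xCoord_sub_three (hQ : Q ≠ 0) (h2 : Q.psiVal 2 ≠ 0) (h3 : Q.psiVal 3 ≠ 0) :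
    (Q.xCoord - (3 • Q).xCoord) * Q.psiVal 3 ^ 2 = Q.psiVal 4 * Q.psiVal 2 := by
  obtain ⟨h₂, h⟩ := xCoord_sub_two hQ h2
  have hb : Q.psiVal 2 = Q.psiTwo := normEDS_two ..
  have hc : Q.psiVal 3 = W.Ψ₃.eval Q.xCoord := normEDS_three ..
  have hd : Q.psiVal 4 = W.preΨ₄.eval Q.xCoord * Q.psiTwo := normEDS_four ..
  have hx : (2 • Q).xCoord ≠ Q.xCoord := by
    intro h0
    rw [h0, sub_self, zero_mul] at h
    exact h3 h.symm
  have hs := xCoord_add_add_xCoord_sub h₂ hQ hx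
  have e₁ : 2 • Q + Q = 3 • Q := by abel
  have e₂ : 2 • Q - Q = Q := by abel
  rw [e₁, e₂, sumForm] at hs
  have hB := psiTwo_sq hQ
  have hd2 := xCoord_add_self hQ (by rwa [← two_smul ℕ])
  rw [← two_smul ℕ, prodForm] at hd2
  rw [hd]
  rw [hb] at h2 h ⊢
  have hcB : Q.psiVal 3 ^ 2 = (2 • Q).xCoord ^ 2 * Q.psiTwo ^ 4 -
      2 * (2 • Q).xCoord * Q.xCoord * Q.psiTwo ^ 4 + Q.xCoord ^ 2 * Q.psiTwo ^ 4 := by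
    rw [← h]; ring
  have hc' : Q.psiVal 3 ^ 2 = (W.Ψ₃.eval Q.xCoord) ^ 2 := by rw [hc]
  have key : (Q.xCoord + (3 • Q).xCoord) * Q.psiVal 3 ^ 2 =
      (2 * ((2 • Q).xCoord * Q.psiTwo ^ 2) * Q.xCoord + W.b₄ * Q.psiTwo ^ 2) *
        ((2 • Q).xCoord * Q.psiTwo ^ 2 + Q.xCoord * Q.psiTwo ^ 2) +
        W.b₂ * ((2 • Q).xCoord * Q.psiTwo ^ 2) * Q.xCoord * Q.psiTwo ^ 2 +
        W.b₆ * (Q.psiTwo ^ 2) ^ 2 := by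
    rw [hcB]
    linear_combination Q.psiTwo ^ 4 * hs
  have : (Q.xCoord - (3 • Q).xCoord) * Q.psiVal 3 ^ 2 =
      2 * Q.xCoord * (W.Ψ₃.eval Q.xCoord) ^ 2 -
        (Q.xCoord + (3 • Q).xCoord) * Q.psiVal 3 ^ 2 := by
    rw [← hc']; ring
  have hBd : W.preΨ₄.eval Q.xCoord * Q.psiTwo * Q.psiTwo =
      W.preΨ₄.eval Q.xCoord * (4 * Q.xCoord ^ 3 + W.b₂ * Q.xCoord ^ 2 + 2 * W.b₄ * Q.xCoord +
        W.b₆) := by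
    rw [← hB]; ring
  rw [this, key, hd2, hBd, hB]
  simp only [Ψ₃, preΨ₄, b₂, b₄, b₆, b₈, eval_add, eval_mul, eval_pow, eval_C, eval_X, eval_ofNat]
  ring

/-- The elliptic relations for the division polynomials evaluated at a point, in terms of its
multiples. -/
lemma psiVal_rel (hQ : Q ≠ 0) (hw : ∀ n : ℕ, 1 ≤ n → Q.psiVal n ≠ 0) (S : ℕ) (m n : ℕ)
    (hn : 1 ≤ n) (hmn : n < m) (hS : m + n ≤ S) :
    m • Q ≠ 0 ∧ ((n • Q).xCoord - (m • Q).xCoord) * (Q.psiVal m ^ 2 * Q.psiVal n ^ 2) =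
      Q.psiVal (m + n) * Q.psiVal (m - n) := by
  have w1 : Q.psiVal 1 = 1 := normEDS_one ..
  have w2 : Q.psiVal 2 = Q.psiTwo := normEDS_two ..
  have hodd (k : ℤ) : Q.psiVal (2 * k + 1) = Q.psiVal (k + 2) * Q.psiVal k ^ 3 -
    Q.psiVal (k - 1) * Q.psiVal (k + 1) ^ 3 := normEDS_odd ..
  have heven (k : ℤ) : Q.psiVal (2 * k) * Q.psiVal 2 =
      Q.psiVal (k - 1) ^ 2 * Q.psiVal k * Q.psiVal (k + 2) -
      Q.psiVal (k - 2) * Q.psiVal k * Q.psiVal (k + 1) ^ 2 := by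
    rw [w2]; exact normEDS_even ..
  have hw2 := hw 2 (by omega)
  have hw3 := hw 3 (by omega)
  obtain ⟨h2Q, hx2⟩ := xCoord_sub_two hQ (by exact_mod_cast hw2)
  have hx3 := xCoord_sub_three hQ (by exact_mod_cast hw2) (by exact_mod_cast hw3)
  -- The outer induction is on a bound for `m + n`; inside it a second induction, on `m - n`, moves
  -- between pairs with the same sum.
  induction S using Nat.strong_induction_on generalizing m n with
  | _ S ih =>
  have T (m n : ℕ) (hn : 1 ≤ n) (hmn : n < m) (hS : m + n < S) := ih (m + n) hS m n hn hmn le_rfl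
  -- the multiples are nonzero
  have Tx1 (k : ℕ) (hk : 2 ≤ k) (hkS : k + 1 < S) : (k • Q).xCoord ≠ Q.xCoord := by
    intro h0
    have := (T k 1 le_rfl hk hkS).2
    rw [one_smul, h0, sub_self, zero_mul] at this
    have h1 := hw (k + 1) (by omega)
    have h2 := hw (k - 1) (by omega)
    rw [Nat.cast_sub (by omega)] at h2
    push_cast at h1 h2
    exact mul_ne_zero h1 h2 this.symm
  have Tnz (k : ℕ) (hk : 1 ≤ k) (hkS : k < S) : k • Q ≠ 0 := by
    rcases (show k = 1 ∨ k = 2 ∨ 3 ≤ k by omega) with rfl | rfl | h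
    · rwa [one_smul]
    · exact h2Q
    · have h1 := Tx1 (k - 1) (by omega) (by omega)
      have h2 := add_ne_zero_of_xCoord_ne h1
      rwa [← succ_nsmul, Nat.sub_add_cancel (by omega)] at h2
  refine ⟨Tnz m (by omega) (by omega), ?_⟩
  rcases hS.lt_or_eq with hlt | hS
  · exact (T m n hn hmn hlt).2
  generalize hr : m - n = r
  induction r using Nat.strong_induction_on generalizing m n with
  | _ r ihr =>
  have wnz (k : ℕ) (i : ℤ) (hk : 1 ≤ k) (hi : i = k) : Q.psiVal i ≠ 0 := hi ▸ hw k hk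
  -- Differences one and two are the odd and even recurrences of the division polynomials. Larger
  -- differences follow from the symmetric identity for `kQ`, `nQ`, `Q`, where `m = k + 1`: the pair
  -- `(k, n + 1)` has the same sum and a smaller difference, and the other pairs have a smaller sum.
  rcases (show r = 1 ∨ r = 2 ∨ 3 ≤ r by omega) with rfl | rfl | hr3
  · obtain rfl : m = n + 1 := by omega
    rcases (show n = 1 ∨ 2 ≤ n by omega) with rfl | hn2
    · simpa [w1] using hx2
    have h1 := (T n 1 le_rfl (by omega) (by omega)).2
    have h2 := (T (n + 1) 1 le_rfl (by omega) (by omega)).2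
    have h3 := hodd n
    push_cast at h1 h2 ⊢
    rw [w1] at h1 h2
    rw [show (n : ℤ) + 1 + n = 2 * n + 1 by ring, show (n : ℤ) + 1 - n = 1 by ring, w1, h3]
    rw [show (n : ℤ) + 1 - 1 = n by ring, show (n : ℤ) + 1 + 1 = n + 2 by ring] at h2
    linear_combination Q.psiVal n ^ 2 * h2 - Q.psiVal (n + 1) ^ 2 * h1
  · obtain rfl : m = n + 2 := by omega
    rcases (show n = 1 ∨ 2 ≤ n by omega) with rfl | hn2
    · simpa [w1] using hx3
    have h1 := (T n 1 le_rfl (by omega) (by omega)).2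
    have h2 := (T (n + 2) 1 le_rfl (by omega) (by omega)).2
    have h3 := heven (n + 1)
    push_cast at h1 h2 ⊢
    rw [w1] at h1 h2
    rw [show (n : ℤ) + 2 + n = 2 * (n + 1) by ring, show (n : ℤ) + 2 - n = 2 by ring, h3]
    rw [show (n : ℤ) + 2 - 1 = n + 1 by ring, show (n : ℤ) + 2 + 1 = n + 3 by ring] at h2
    rw [show (n : ℤ) + 1 - 1 = n by ring, show (n : ℤ) + 1 + 2 = n + 3 by ring,
      show (n : ℤ) + 1 - 2 = n - 1 by ring, show (n : ℤ) + 1 + 1 = n + 2 by ring]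
    linear_combination Q.psiVal n ^ 2 * h2 - Q.psiVal (n + 2) ^ 2 * h1
  · obtain ⟨k, rfl⟩ : ∃ k, m = k + 1 := ⟨m - 1, by omega⟩
    have h1 := ihr (r - 2) (by omega) k (n + 1) (by omega) (by omega) (by omega) (by omega)
      (by omega)
    have hk1 := (T k 1 le_rfl (by omega) (by omega)).2
    have hk1' := Tx1 k (by omega) (by omega)
    have hk0 := Tnz k (by omega) (by omega)
    have ek : k • Q - Q = (k - 1) • Q := by rw [sub_nsmul _ (by omega), one_smul]; abel
    have ck : ((k - 1 : ℕ) : ℤ) = k - 1 := by rw [Nat.cast_sub (by omega)]; simp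
    -- For `n = 1` the pair `(k, n - 1)` would involve the point at infinity, so the degenerate
    -- identity `xCoord_symm_self` replaces the general one.
    rcases (show n = 1 ∨ 2 ≤ n by omega) with rfl | hn2
    · have h2 := (T (k - 1) 1 le_rfl (by omega) (by omega)).2
      have hsym := xCoord_symm_self hk0 hQ (by rwa [← two_smul ℕ]) hk1'
      rw [← succ_nsmul, ← two_smul ℕ, ek, ← w2] at hsym
      push_cast [ck] at h1 hk1 h2 ⊢
      rw [w1] at hk1 h2
      rw [one_smul] at hk1 h2 ⊢
      rw [w1]
      have z1 := wnz k k (by omega) rfl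
      have z2 := wnz (k - 1) (k - 1) (by omega) (by omega)
      have z3 := wnz (k - 2) (k - 2) (by omega) (by omega)
      rw [show (k : ℤ) - 1 - 1 = k - 2 by ring, show (k : ℤ) - 1 + 1 = k by ring] at h2
      rw [show (k : ℤ) + 1 + 1 = k + 2 by ring, show (k : ℤ) + 1 - 1 = k by ring]
      have hD : Q.psiVal k * Q.psiVal (k - 2) * Q.psiVal (k - 1) ^ 2 ≠ 0 := by simp [z1, z2, z3]
      apply mul_right_cancel₀ hD
      have e₁ : (Q.xCoord - ((k + 1) • Q).xCoord) * (Q.xCoord - ((k - 1) • Q).xCoord) *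
          ((k • Q).xCoord - Q.xCoord) ^ 2 * (Q.psiVal k ^ 4 * Q.psiVal (k - 1) ^ 2) =
          (Q.xCoord - ((k + 1) • Q).xCoord) * (Q.psiVal k * Q.psiVal (k - 2)) *
            (Q.psiVal (k + 1) * Q.psiVal (k - 1)) ^ 2 := by
        rw [← h2, ← hk1]; ring
      have e₂ : Q.psiVal 2 ^ 2 * ((2 • Q).xCoord - (k • Q).xCoord) *
          (Q.psiVal k ^ 4 * Q.psiVal (k - 1) ^ 2) =
          Q.psiVal (k + 2) * Q.psiVal (k - 2) * (Q.psiVal k ^ 2 * Q.psiVal (k - 1) ^ 2) := by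
        rw [← h1]; ring
      linear_combination Q.psiVal k ^ 4 * Q.psiVal (k - 1) ^ 2 * hsym - e₁ + e₂
    · have hd := (T (k - 1) n hn (by omega) (by omega)).2
      have hb := (T k (n - 1) (by omega) (by omega) (by omega)).2
      have hc := (T n 1 (by omega) (by omega) (by omega)).2
      have hc' := Tx1 n (by omega) (by omega)
      have hn0 := Tnz n (by omega) (by omega)
      have en : n • Q - Q = (n - 1) • Q := by rw [sub_nsmul _ (by omega), one_smul]; abel
      have cn : ((n - 1 : ℕ) : ℤ) = n - 1 := by rw [Nat.cast_sub (by omega)]; simp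
      have hsym := xCoord_symm hk0 hn0 hQ hk1' hc'
      rw [← succ_nsmul, ← succ_nsmul, ek, en] at hsym
      push_cast [ck, cn] at h1 hk1 hd hb hc ⊢
      rw [w1] at hk1 hc
      rw [one_smul] at hk1 hc
      rw [show (k : ℤ) - 1 - n = k - (n + 1) by ring] at hd
      rw [show (k : ℤ) + (n - 1) = k - 1 + n by ring,
        show (k : ℤ) - (n - 1) = k + 1 - n by ring] at hb
      rw [show (k : ℤ) + (n + 1) = k + 1 + n by ring] at h1
      refine psi_step_algebra (wnz (k - 1) (k - 1) (by omega) (by omega))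
        (wnz (n + 1) (n + 1) (by omega) (by omega)) (wnz (n - 1) (n - 1) (by omega) (by omega))
        (wnz (k - (n + 1)) (k - (n + 1)) (by omega) (by omega))
        (wnz (k - 1 + n) (k - 1 + n) (by omega) (by omega)) h1 hb (by simpa using hc) hd (by simpa using hk1) ?_
      linear_combination hsym

end WeierstrassCurve.Affine.Point

/-! ### The function field and its invariant derivation -/

section
open scoped Polynomial.Bivariate

namespace WeierstrassCurve.Affine

section Lift
variable {R S T : Type*} [CommRing R] [CommRing S] [CommRing T] (W : Affine R)

namespace CoordinateRing

/-- The coordinate function `x` in the coordinate ring. -/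
noncomputable def x : W.CoordinateRing := mk W (C X)

/-- The coordinate function `y` in the coordinate ring. -/
noncomputable def y : W.CoordinateRing := mk W Y

lemma algebraMap_polynomial (p : R[X]) :
    algebraMap R[X] W.CoordinateRing p = aeval (x W) p := by
  induction p using Polynomial.induction_on' with
  | add p q hp hq => rw [map_add, map_add, hp, hq]
  | monomial n r =>
    rw [aeval_monomial, ← C_mul_X_pow_eq_monomial, map_mul, map_pow]
    rfl

lemma exists_eq (a : W.CoordinateRing) :
    ∃ p q : R[X], a = aeval (x W) p + aeval (x W) q * y W := by
  obtain ⟨p, q, rfl⟩ := exists_smul_basis_eq a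
  refine ⟨p, q, ?_⟩
  simp only [Algebra.smul_def, algebraMap_polynomial, mul_one]
  rfl

lemma equation_xy :
    (W.map (algebraMap R W.CoordinateRing)).toAffine.Equation (x W) (y W) := by
  rw [equation_iff', WeierstrassCurve.map_a₁, WeierstrassCurve.map_a₂, WeierstrassCurve.map_a₃,
    WeierstrassCurve.map_a₄, WeierstrassCurve.map_a₆]
  have h : mk W (Y ^ 2 + C (C W.a₁ * X + C W.a₃) * Y -
    C (X ^ 3 + C W.a₂ * X ^ 2 + C W.a₄ * X + C W.a₆)) = 0 := AdjoinRoot.mk_self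
  have hC (r : R) : mk W (C (C r)) = algebraMap R W.CoordinateRing r := rfl
  simp only [map_sub, map_add, map_mul, map_pow, hC] at h
  rw [← h, x, y]
  ring

variable {W}

/-- The homomorphism from the coordinate ring given by a point over an extension. -/
noncomputable def lift (f : R →+* S) (s t : S) (h : (W.map f).toAffine.Equation s t) :
    W.CoordinateRing →+* S :=
  AdjoinRoot.lift (eval₂RingHom f s) t <| by
    rw [equation_iff'] at h
    simp only [WeierstrassCurve.map_a₁, WeierstrassCurve.map_a₂, WeierstrassCurve.map_a₃,
      WeierstrassCurve.map_a₄, WeierstrassCurve.map_a₆] at h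
    rw [← h, Affine.polynomial]
    simp only [eval₂_sub, eval₂_add, eval₂_mul, eval₂_pow, eval₂_X, eval₂_C, coe_eval₂RingHom]
    ring

variable (f : R →+* S) {s t : S} (h : (W.map f).toAffine.Equation s t)

@[simp] lemma lift_x : lift f s t h (x W) = s := by
  simp [lift, x]

@[simp] lemma lift_y : lift f s t h (y W) = t := by
  simp [lift, y]

@[simp] lemma lift_algebraMap (r : R) :
    lift f s t h (algebraMap R W.CoordinateRing r) = f r := by
  have : algebraMap R W.CoordinateRing r = mk W (C (C r)) := rfl
  simp [lift, this]

lemma lift_aeval (p : R[X]) : lift f s t h (aeval (x W) p) = p.eval₂ f s := by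
  rw [aeval_def, hom_eval₂, lift_x]
  congr 1
  ext r
  simp

lemma hom_ext {φ ψ : W.CoordinateRing →+* S}
    (hC : ∀ r, φ (algebraMap R W.CoordinateRing r) = ψ (algebraMap R W.CoordinateRing r))
    (hx : φ (x W) = ψ (x W)) (hy : φ (y W) = ψ (y W)) : φ = ψ := by
  refine RingHom.ext fun a ↦ ?_
  obtain ⟨p, q, rfl⟩ := exists_eq W a
  have key (p : R[X]) : φ (aeval (x W) p) = ψ (aeval (x W) p) := by
    rw [aeval_def, hom_eval₂, hom_eval₂, hx]
    congr 1
    ext r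
    exact hC r
  rw [map_add, map_mul, key, key, hy, map_add, map_mul]

end CoordinateRing
end Lift

namespace FunctionField

variable {R : Type*} [CommRing R] (W : Affine R)

/-- The coordinate function `x` in the function field. -/
noncomputable def x : W.FunctionField :=
  algebraMap W.CoordinateRing W.FunctionField (CoordinateRing.x W)

/-- The coordinate function `y` in the function field. -/
noncomputable def y : W.FunctionField :=
  algebraMap W.CoordinateRing W.FunctionField (CoordinateRing.y W)

lemma equation_xy :
    (W.map (algebraMap R W.FunctionField)).toAffine.Equation (x W) (y W) := by
  have h := (CoordinateRing.equation_xy W).map (algebraMap W.CoordinateRing W.FunctionField)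
  have e : (W.map (algebraMap R W.CoordinateRing)).map
      (algebraMap W.CoordinateRing W.FunctionField) = W.map (algebraMap R W.FunctionField) := by
    ext <;> simp [← IsScalarTower.algebraMap_apply]
  exact e ▸ h

lemma algebraMap_aeval (p : R[X]) :
    algebraMap W.CoordinateRing W.FunctionField (aeval (CoordinateRing.x W) p) =
      aeval (x W) p := by
  rw [x, aeval_algebraMap_apply]

lemma aeval_x_injective [IsDomain R] : Function.Injective (aeval (R := R) (x W)) := by
  intro p q h
  rw [← algebraMap_aeval, ← algebraMap_aeval, ← CoordinateRing.algebraMap_polynomial,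
    ← CoordinateRing.algebraMap_polynomial] at h
  exact FaithfulSMul.algebraMap_injective R[X] W.CoordinateRing
    (IsFractionRing.injective W.CoordinateRing W.FunctionField h)

/-- The value of the second division polynomial in the function field. -/
noncomputable def psiTwo : W.FunctionField :=
  2 * y W + algebraMap R _ W.a₁ * x W + algebraMap R _ W.a₃

/-- The image of `y` under the invariant derivation. -/
noncomputable def derivY : W.FunctionField :=
  3 * x W ^ 2 + 2 * algebraMap R _ W.a₂ * x W + algebraMap R _ W.a₄ - algebraMap R _ W.a₁ * y W

/-- The tangent vector `(ψ₂, derivY)` consists of the partial derivative of the Weierstrass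
polynomial in `y` and minus the one in `x`, so it is tangent to the curve. A point over dual numbers
encodes a derivation, here the one dual to `dx / ψ₂`. -/
lemma equation_dual :
    (W.map ((TrivSqZeroExt.inlHom W.FunctionField W.FunctionField).comp
      (algebraMap R W.FunctionField))).toAffine.Equation
      (TrivSqZeroExt.inl (x W) + TrivSqZeroExt.inr (psiTwo W))
      (TrivSqZeroExt.inl (y W) + TrivSqZeroExt.inr (derivY W)) := by
  have h := equation_xy W
  rw [equation_iff'] at h ⊢
  simp only [WeierstrassCurve.map_a₁, WeierstrassCurve.map_a₂, WeierstrassCurve.map_a₃,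
    WeierstrassCurve.map_a₄, WeierstrassCurve.map_a₆] at h ⊢
  ext
  · simp only [RingHom.comp_apply, TrivSqZeroExt.inlHom_apply, TrivSqZeroExt.fst_sub,
      TrivSqZeroExt.fst_add, TrivSqZeroExt.fst_mul, TrivSqZeroExt.fst_pow,
      TrivSqZeroExt.fst_inl, TrivSqZeroExt.fst_inr, TrivSqZeroExt.fst_zero, add_zero]
    exact h
  · simp [pow_succ, psiTwo, derivY]
    ring

/-- The homomorphism from the coordinate ring to dual numbers describing the invariant
derivation. -/
noncomputable def coordToDual : W.CoordinateRing →+* DualNumber W.FunctionField :=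
  CoordinateRing.lift _ _ _ (equation_dual W)

lemma fst_coordToDual (a : W.CoordinateRing) :
    (coordToDual W a).fst = algebraMap W.CoordinateRing W.FunctionField a := by
  have : (TrivSqZeroExt.fstHom W.FunctionField W.FunctionField W.FunctionField : _ →+*
      W.FunctionField).comp (coordToDual W) = algebraMap W.CoordinateRing W.FunctionField := by
    refine CoordinateRing.hom_ext (fun r ↦ ?_) ?_ ?_
    · simp [coordToDual, ← IsScalarTower.algebraMap_apply]
    · simp [coordToDual, x]
    · simp [coordToDual, y]
  exact congrArg (fun g ↦ g a) this

variable [IsDomain R]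

/-- The homomorphism from the function field to dual numbers describing the invariant
derivation. -/
noncomputable def toDual : W.FunctionField →+* DualNumber W.FunctionField :=
  IsLocalization.lift (M := nonZeroDivisors W.CoordinateRing) (g := coordToDual W) <| by
    rintro ⟨a, ha⟩
    rw [TrivSqZeroExt.isUnit_iff_isUnit_fst, fst_coordToDual, isUnit_iff_ne_zero]
    exact IsFractionRing.to_map_ne_zero_of_mem_nonZeroDivisors ha

lemma toDual_algebraMap (a : W.CoordinateRing) :
    toDual W (algebraMap W.CoordinateRing W.FunctionField a) = coordToDual W a :=
  IsLocalization.lift_eq _ a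

lemma fst_toDual (a : W.FunctionField) : (toDual W a).fst = a := by
  have : (TrivSqZeroExt.fstHom W.FunctionField W.FunctionField W.FunctionField : _ →+*
      W.FunctionField).comp (toDual W) = RingHom.id _ := by
    refine IsLocalization.ringHom_ext (nonZeroDivisors W.CoordinateRing) (RingHom.ext fun a ↦ ?_)
    simp [toDual_algebraMap, fst_coordToDual]
  exact congrArg (fun g ↦ g a) this

/-- The invariant derivation of the function field. -/
noncomputable def deriv : Derivation R W.FunctionField W.FunctionField :=
  Derivation.mk'
    { toFun := fun a ↦ (toDual W a).snd
      map_add' := by simp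
      map_smul' := fun r a ↦ by
        rw [Algebra.smul_def, map_mul, IsScalarTower.algebraMap_apply R W.CoordinateRing,
          toDual_algebraMap]
        simp [coordToDual, fst_toDual, Algebra.smul_def] }
    fun a b ↦ by
      simp [fst_toDual, mul_comm]

lemma deriv_apply (a : W.FunctionField) : deriv W a = (toDual W a).snd := rfl

lemma deriv_x : deriv W (x W) = psiTwo W := by
  rw [deriv_apply, x, toDual_algebraMap]
  simp [coordToDual]

end FunctionField
end WeierstrassCurve.Affine

end

/-! ### Duplication and addition formulas for the multiples of a point -/

namespace WeierstrassCurve.Affine.Point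

section Multiples
variable {F : Type*} [Field F] {W : Affine F} [DecidableEq F] {Q : W.Point}

lemma nsmul_ne_zero_of_psiVal (hQ : Q ≠ 0) (hw : ∀ n : ℕ, 1 ≤ n → Q.psiVal n ≠ 0) {n : ℕ}
    (hn : 1 ≤ n) : n • Q ≠ 0 := by
  rcases hn.lt_or_eq with h | rfl
  · exact (psiVal_rel hQ hw _ n 1 le_rfl h le_rfl).1
  · rwa [one_smul]

lemma xCoord_nsmul (hQ : Q ≠ 0) (hw : ∀ n : ℕ, 1 ≤ n → Q.psiVal n ≠ 0) {n : ℕ} (hn : 1 ≤ n) :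
    (Q.xCoord - (n • Q).xCoord) * Q.psiVal n ^ 2 = Q.psiVal (n + 1) * Q.psiVal (n - 1) := by
  have w1 : Q.psiVal 1 = 1 := normEDS_one ..
  have w0 : Q.psiVal 0 = 0 := normEDS_zero ..
  rcases hn.lt_or_eq with h | rfl
  · have := (psiVal_rel hQ hw _ n 1 le_rfl h le_rfl).2
    simpa [w1] using this
  · simp [w0]

lemma xCoord_nsmul_ne (hQ : Q ≠ 0) (hw : ∀ n : ℕ, 1 ≤ n → Q.psiVal n ≠ 0) {m n : ℕ} (hn : 1 ≤ n)
    (hmn : n < m) : (m • Q).xCoord ≠ (n • Q).xCoord := by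
  intro h
  have h₁ := (psiVal_rel hQ hw _ m n hn hmn le_rfl).2
  have h₂ := hw (m + n) (by omega)
  have h₃ := hw (m - n) (by omega)
  rw [Nat.cast_sub hmn.le] at h₃
  push_cast at h₂ h₃
  rw [h, sub_self, zero_mul] at h₁
  exact mul_ne_zero h₂ h₃ h₁.symm

/-- The difference `x((n + 1)Q) - x((n - 1)Q)` is computed in two ways: by the chord formula for `nQ
± Q`, and by the elliptic relation for the pair `(n + 1, n - 1)`, which produces `ψ(2n) ψ(2)`. -/
lemma psiTwo_nsmul (hQ : Q ≠ 0) (hw : ∀ n : ℕ, 1 ≤ n → Q.psiVal n ≠ 0) {n : ℕ} (hn : 1 ≤ n) :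
    (n • Q).psiTwo * Q.psiVal n ^ 4 = Q.psiVal (2 * n) := by
  have w1 : Q.psiVal 1 = 1 := normEDS_one ..
  have w2 : Q.psiVal 2 = Q.psiTwo := normEDS_two ..
  rcases hn.lt_or_eq with h | rfl
  · have hx := xCoord_nsmul_ne hQ hw le_rfl h
    rw [one_smul] at hx
    have h₁ := xCoord_add_sub_xCoord_sub (nsmul_ne_zero_of_psiVal hQ hw hn) hQ hx
    have e : n • Q - Q = (n - 1) • Q := by rw [sub_nsmul _ hn, one_smul]; abel
    have c : ((n - 1 : ℕ) : ℤ) = n - 1 := by rw [Nat.cast_sub hn]; simp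
    rw [← succ_nsmul, e] at h₁
    have h₂ := (psiVal_rel hQ hw _ (n + 1) (n - 1) (by omega) (by omega) le_rfl).2
    have h₃ := xCoord_nsmul hQ hw hn
    push_cast [c] at h₂
    rw [show (n : ℤ) + 1 + (n - 1) = 2 * n by ring, show (n : ℤ) + 1 - (n - 1) = 2 by ring] at h₂
    have hb : Q.psiVal 2 ≠ 0 := by exact_mod_cast hw 2 (by omega)
    apply mul_right_cancel₀ hb
    rw [← h₂]
    rw [w2]
    linear_combination Q.psiVal n ^ 4 * h₁ - (((n + 1) • Q).xCoord - ((n - 1) • Q).xCoord) *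
      ((Q.xCoord - (n • Q).xCoord) * Q.psiVal n ^ 2 + Q.psiVal (n + 1) * Q.psiVal (n - 1)) * h₃
  · simp [w1, w2]

lemma xCoord_nsmul_mul (hQ : Q ≠ 0) (hw : ∀ n : ℕ, 1 ≤ n → Q.psiVal n ≠ 0) {n : ℕ} (hn : 1 ≤ n) :
    (n • Q).xCoord * (W.ΨSq n).eval Q.xCoord = (W.Φ n).eval Q.xCoord := by
  rw [eval_Φ hQ, ← psiVal_sq hQ]
  linear_combination -xCoord_nsmul hQ hw hn

section
variable (hQ : Q ≠ 0) (hw : ∀ n : ℕ, 1 ≤ n → Q.psiVal n ≠ 0) {n : ℕ} (hn : 1 ≤ n)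
include hQ hw hn

lemma eval_ΨSq_two_mul : (W.ΨSq (2 * n : ℕ)).eval Q.xCoord =
    4 * (W.Φ n).eval Q.xCoord ^ 3 * (W.ΨSq n).eval Q.xCoord +
      W.b₂ * (W.Φ n).eval Q.xCoord ^ 2 * (W.ΨSq n).eval Q.xCoord ^ 2 +
      2 * W.b₄ * (W.Φ n).eval Q.xCoord * (W.ΨSq n).eval Q.xCoord ^ 3 +
      W.b₆ * (W.ΨSq n).eval Q.xCoord ^ 4 := by
  have h₁ := psiTwo_sq (nsmul_ne_zero_of_psiVal hQ hw hn)
  rw [← xCoord_nsmul_mul hQ hw hn, ← psiVal_sq hQ, ← psiVal_sq hQ]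
  push_cast
  rw [← psiTwo_nsmul hQ hw hn]
  linear_combination Q.psiVal n ^ 8 * h₁

lemma eval_Φ_two_mul : (W.Φ (2 * n : ℕ)).eval Q.xCoord =
    W.prodForm ((W.Φ n).eval Q.xCoord) ((W.ΨSq n).eval Q.xCoord)
      ((W.Φ n).eval Q.xCoord) ((W.ΨSq n).eval Q.xCoord) := by
  have h0 := nsmul_ne_zero_of_psiVal hQ hw hn
  have h2 := nsmul_ne_zero_of_psiVal hQ hw (n := 2 * n) (by omega)
  have e : (2 * n) • Q = n • Q + n • Q := by rw [two_mul, add_nsmul]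
  have h₁ := xCoord_add_self h0 (by rwa [← e])
  rw [← e] at h₁
  rw [← xCoord_nsmul_mul hQ hw (by omega), ← xCoord_nsmul_mul hQ hw hn, ← psiVal_sq hQ,
    ← psiVal_sq hQ]
  push_cast
  rw [← psiTwo_nsmul hQ hw hn]
  rw [prodForm] at h₁ ⊢
  linear_combination Q.psiVal n ^ 8 * h₁

lemma eval_ΨSq_two_mul_add_one : (W.ΨSq (2 * n + 1 : ℕ)).eval Q.xCoord =
    ((W.Φ n).eval Q.xCoord * (W.ΨSq (n + 1 : ℕ)).eval Q.xCoord -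
      (W.Φ (n + 1 : ℕ)).eval Q.xCoord * (W.ΨSq n).eval Q.xCoord) ^ 2 := by
  have h₁ := (psiVal_rel hQ hw _ (n + 1) n hn (by omega) le_rfl).2
  have w1 : Q.psiVal 1 = 1 := normEDS_one ..
  rw [← xCoord_nsmul_mul hQ hw hn, ← xCoord_nsmul_mul hQ hw (by omega), ← psiVal_sq hQ,
    ← psiVal_sq hQ, ← psiVal_sq hQ]
  push_cast at h₁ ⊢
  rw [show (n : ℤ) + 1 + n = 2 * n + 1 by ring, show (n : ℤ) + 1 - n = 1 by ring, w1,
    mul_one] at h₁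
  rw [← h₁]
  ring

/-- The sum formula for `(n + 1)Q` and `nQ`, whose difference is `Q`; this is the source of the
extra term on the left. -/
lemma eval_Φ_two_mul_add_one : (W.Φ (2 * n + 1 : ℕ)).eval Q.xCoord +
      Q.xCoord * (W.ΨSq (2 * n + 1 : ℕ)).eval Q.xCoord =
    W.sumForm ((W.Φ n).eval Q.xCoord) ((W.ΨSq n).eval Q.xCoord)
      ((W.Φ (n + 1 : ℕ)).eval Q.xCoord) ((W.ΨSq (n + 1 : ℕ)).eval Q.xCoord) := by
  have h₁ := xCoord_add_add_xCoord_sub (nsmul_ne_zero_of_psiVal hQ hw (n := n + 1) (by omega))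
    (nsmul_ne_zero_of_psiVal hQ hw hn) (xCoord_nsmul_ne hQ hw hn (by omega))
  rw [show (n + 1) • Q + n • Q = (2 * n + 1) • Q by rw [← add_nsmul]; congr 1; ring,
    show (n + 1) • Q - n • Q = Q by rw [succ_nsmul]; abel] at h₁
  rw [← xCoord_nsmul_mul hQ hw (by omega), eval_ΨSq_two_mul_add_one hQ hw hn,
    ← xCoord_nsmul_mul hQ hw hn, ← xCoord_nsmul_mul hQ hw (n := n + 1) (by omega)]
  rw [sumForm] at h₁ ⊢
  linear_combination (W.ΨSq n).eval Q.xCoord ^ 2 * (W.ΨSq (n + 1 : ℕ)).eval Q.xCoord ^ 2 * h₁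

end

end Multiples
end WeierstrassCurve.Affine.Point

/-! ### Differentiation along the multiples of a point -/

section
open scoped Polynomial.Bivariate

namespace WeierstrassCurve.Affine.Point

section Derivation
variable {F : Type*} [Field F] {W : Affine F} [DecidableEq F] {Q : W.Point}
  {A : Type*} [CommRing A] [Algebra A F] (D : Derivation A F F)

omit [DecidableEq F] in
lemma derivation_psiTwo (h2 : (2 : F) ≠ 0) (h₂ : D W.b₂ = 0) (h₄ : D W.b₄ = 0) (h₆ : D W.b₆ = 0)
    {P : W.Point} (hP : P ≠ 0) (hp : P.psiTwo ≠ 0) {c : F} (h : D P.xCoord = c * P.psiTwo) :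
    D P.psiTwo = c * (6 * P.xCoord ^ 2 + W.b₂ * P.xCoord + W.b₄) := by
  have e := congrArg D (psiTwo_sq hP)
  have dn (n : ℕ) [n.AtLeastTwo] : D (OfNat.ofNat n : F) = 0 := D.map_natCast n
  simp only [D.leibniz_pow, map_add, D.leibniz, h₂, h₄, h₆, h, smul_eq_mul, dn] at e
  apply mul_left_cancel₀ (mul_ne_zero h2 hp)
  simp only [nsmul_eq_mul] at e
  push_cast at e
  linear_combination e

/-- This is the invariance of `dx / ψ₂`: multiplication by `n` pulls it back to `n` times itself.
The proof adds one copy of `Q` at a time and differentiates the addition formula. -/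
lemma derivation_nsmul (hQ : Q ≠ 0) (hw : ∀ n : ℕ, 1 ≤ n → Q.psiVal n ≠ 0) (h2 : (2 : F) ≠ 0)
    (h₂ : D W.b₂ = 0) (h₄ : D W.b₄ = 0) (h₆ : D W.b₆ = 0) (h₈ : D W.b₈ = 0)
    (h : D Q.xCoord = Q.psiTwo) {n : ℕ} (hn : 1 ≤ n) :
    D (n • Q).xCoord = n * (n • Q).psiTwo := by
  have dn (n : ℕ) [n.AtLeastTwo] : D (OfNat.ofNat n : F) = 0 := D.map_natCast n
  have hp (n : ℕ) (hn : 1 ≤ n) : (n • Q).psiTwo ≠ 0 := fun h0 ↦ by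
    have := psiTwo_nsmul hQ hw hn
    rw [h0, zero_mul] at this
    exact hw (2 * n) (by omega) (by rw [this]; norm_num)
  have hp1 : Q.psiTwo ≠ 0 := by simpa using hp 1 le_rfl
  have hD1 := derivation_psiTwo D h2 h₂ h₄ h₆ hQ hp1 (c := 1) (by rw [h, one_mul])
  induction n, hn using Nat.le_induction with
  | base => simp [h]
  | succ n hn ih =>
    have hn0 := nsmul_ne_zero_of_psiVal hQ hw hn
    -- The chord formula does not apply to `Q + Q`, so for `n = 1` the duplication formula is
    -- differentiated instead.
    rcases hn.lt_or_eq with h1 | rfl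
    · have hx : (n • Q).xCoord ≠ Q.xCoord := by simpa using xCoord_nsmul_ne hQ hw le_rfl h1
      have hDn := derivation_psiTwo D h2 h₂ h₄ h₆ hn0 (hp n hn) ih
      have e₁ := xCoord_add_add_xCoord_sub hn0 hQ hx
      have e₂ := xCoord_add_sub_xCoord_sub hn0 hQ hx
      have e₃ := psiTwo_add hn0 hQ hx
      rw [succ_nsmul]
      have hn2 := psiTwo_sq hn0
      have hQ2 := psiTwo_sq hQ
      generalize (n • Q + Q).xCoord = s at *
      generalize (n • Q - Q).xCoord = t at *
      generalize (n • Q).xCoord = x' at *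
      generalize (n • Q).psiTwo = p' at *
      -- Adding the formulas for the sum and the difference of `x(nQ ± Q)` expresses `2x((n + 1)Q)`
      -- through `x` and `ψ₂` only, whose derivatives are known.
      have e₄ : 2 * s * (x' - Q.xCoord) ^ 2 =
          W.sumForm x' 1 Q.xCoord 1 - p' * Q.psiTwo := by
        linear_combination e₁ + e₂
      have e₅ := congrArg D e₄
      rw [sumForm] at e₄ e₅
      simp only [D.leibniz_pow, map_add, map_sub, D.leibniz, h₂, h₄, h₆, h, smul_eq_mul, dn, ih,
        hDn, hD1, nsmul_eq_mul, D.map_one_eq_zero] at e₅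
      push_cast at e₅ ⊢
      have hd : x' - Q.xCoord ≠ 0 := sub_ne_zero.2 hx
      apply mul_left_cancel₀ (mul_ne_zero h2 (pow_ne_zero 3 hd))
      linear_combination (x' - Q.xCoord) * e₅ - (n + 1) * 2 * (x' - Q.xCoord) ^ 2 * e₃
        - 2 * (n * p' - Q.psiTwo) * e₄ + (n + 1) * (p' - Q.psiTwo) * e₄
        + (n - 1) * Q.psiTwo * hn2 + (n - 1) * p' * hQ2
    · have h20 := nsmul_ne_zero_of_psiVal hQ hw (n := 2) (by omega)
      rw [two_nsmul] at h20
      have e₁ := xCoord_add_self hQ h20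
      have e₂ := psiTwo_nsmul hQ hw (n := 2) (by omega)
      have w4 : Q.psiVal 4 = W.preΨ₄.eval Q.xCoord * Q.psiTwo := normEDS_four ..
      have w2 : Q.psiVal 2 = Q.psiTwo := normEDS_two ..
      push_cast at e₂
      rw [w4, w2] at e₂
      rw [one_add_one_eq_two]
      rw [← two_nsmul] at e₁
      generalize (2 • Q).xCoord = s at *
      generalize (2 • Q).psiTwo = p' at *
      have hQ2 := psiTwo_sq hQ
      have e₃ := congrArg D e₁
      rw [prodForm] at e₁ e₃
      simp only [D.leibniz_pow, map_add, map_sub, D.leibniz, h₄, h₆, h₈, h, smul_eq_mul,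
        hD1, nsmul_eq_mul, D.map_one_eq_zero] at e₃
      push_cast at e₃ ⊢
      apply mul_left_cancel₀ (pow_ne_zero 4 hp1)
      simp only [preΨ₄, eval_add, eval_mul, eval_pow, eval_X, eval_C, eval_ofNat] at e₂
      have b8 := W.b_relation
      linear_combination Q.psiTwo ^ 2 * e₃ -
        2 * Q.psiTwo * (6 * Q.xCoord ^ 2 + W.b₂ * Q.xCoord + W.b₄) * e₁ - 2 * e₂ +
        Q.psiTwo * (4 * Q.xCoord ^ 3 - 2 * W.b₄ * Q.xCoord - 2 * W.b₆) * hQ2 -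
        2 * Q.psiTwo * Q.xCoord ^ 2 * b8

end Derivation
end WeierstrassCurve.Affine.Point

/-! ### Polynomial identities from the generic point in characteristic zero -/

namespace WeierstrassCurve.Affine.FunctionField

variable {R : Type*} [CommRing R] [IsDomain R] (W : Affine R)

omit [IsDomain R] in
lemma psiTwo_eq : psiTwo W = algebraMap W.CoordinateRing W.FunctionField
    ((C W.a₁ * X + C W.a₃ : R[X]) • (1 : W.CoordinateRing) + (2 : R[X]) • CoordinateRing.mk W Y) := by
  rw [psiTwo, Algebra.smul_def, Algebra.smul_def, map_ofNat, CoordinateRing.algebraMap_polynomial]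
  change _ = algebraMap W.CoordinateRing W.FunctionField (_ + 2 * CoordinateRing.y W)
  rw [mul_one, map_add, algebraMap_aeval, map_mul, map_ofNat, ← y]
  simp only [map_add, map_mul, aeval_C, aeval_X]
  ring

omit [IsDomain R] in
lemma psiTwo_ne_zero (h2 : (2 : R) ≠ 0) : psiTwo W ≠ 0 := by
  rw [psiTwo_eq]
  intro h
  have := (CoordinateRing.smul_basis_eq_zero
    (IsFractionRing.injective W.CoordinateRing W.FunctionField (h.trans (map_zero _).symm))).2
  refine h2 (C_injective ?_)
  rw [map_zero, ← this, map_ofNat]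

lemma aeval_x_ne_zero {p : R[X]} (hp : p ≠ 0) : aeval (x W) p ≠ 0 := fun h ↦
  hp (aeval_x_injective W (by rw [h, map_zero]))

variable [CharZero R]

omit [IsDomain R] in
lemma nonsingular_xy : (W.map (algebraMap R W.FunctionField)).toAffine.Nonsingular (x W) (y W) := by
  rw [nonsingular_iff]
  refine ⟨equation_xy W, Or.inr fun h ↦ psiTwo_ne_zero W two_ne_zero ?_⟩
  rw [psiTwo]
  simp only [WeierstrassCurve.map_a₁, WeierstrassCurve.map_a₃] at h
  linear_combination h

/-- The generic point of a Weierstrass curve in characteristic zero. -/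
noncomputable def generic : (W.map (algebraMap R W.FunctionField)).toAffine.Point :=
  .some _ _ (nonsingular_xy W)

omit [IsDomain R] in
lemma generic_ne_zero : generic W ≠ 0 := Point.some_ne_zero _

@[simp] lemma xCoord_generic : (generic W).xCoord = x W := rfl

@[simp] lemma psiTwo_generic : (generic W).psiTwo = psiTwo W := rfl

/-- Characteristic zero enters here: no division polynomial vanishes identically, so the generic
point satisfies the nonvanishing hypothesis of all the formulas above. -/
lemma psiVal_generic {n : ℕ} (hn : 1 ≤ n) : (generic W).psiVal n ≠ 0 := by
  rw [Point.psiVal_eq (generic_ne_zero W), map_preΨ, eval_map_algebraMap]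
  refine mul_ne_zero (aeval_x_ne_zero W (preΨ_ne_zero W (by norm_cast; omega))) ?_
  split_ifs
  · exact psiTwo_ne_zero W two_ne_zero
  · exact one_ne_zero

end WeierstrassCurve.Affine.FunctionField

namespace WeierstrassCurve

section Map
variable {R S : Type*} [CommRing R] [CommRing S] (W : WeierstrassCurve R) (f : R →+* S)

lemma map_sumForm (a b c d : R) :
    f (W.sumForm a b c d) = (W.map f).sumForm (f a) (f b) (f c) (f d) := by
  simp only [sumForm, map_add, map_mul, map_pow, map_ofNat, map_b₂, map_b₄, map_b₆]

lemma map_prodForm (a b c d : R) :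
    f (W.prodForm a b c d) = (W.map f).prodForm (f a) (f b) (f c) (f d) := by
  simp only [prodForm, map_add, map_sub, map_mul, map_pow, map_b₄, map_b₆, map_b₈]

lemma map_C_map_mapRingHom :
    (W.map (C : R →+* R[X])).map (mapRingHom f) = (W.map f).map C := by
  ext <;> simp

end Map

namespace Affine.FunctionField
open Point

section CharZero
open scoped Classical
variable {R : Type*} [CommRing R] [IsDomain R] [CharZero R] (W : Affine R)

omit [IsDomain R] [CharZero R] in
lemma map_C_map_aeval :
    (W.map (C : R →+* R[X])).map (aeval (x W) : R[X] →ₐ[R] W.FunctionField).toRingHom =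
      W.map (algebraMap R W.FunctionField) := by
  ext <;> simp

lemma eval_Φ_generic (n : ℤ) : aeval (x W) (W.Φ n) =
    ((W.map (algebraMap R W.FunctionField)).Φ n).eval (generic W).xCoord := by
  rw [map_Φ, eval_map_algebraMap, xCoord_generic]

lemma eval_ΨSq_generic (n : ℤ) : aeval (x W) (W.ΨSq n) =
    ((W.map (algebraMap R W.FunctionField)).ΨSq n).eval (generic W).xCoord := by
  rw [map_ΨSq, eval_map_algebraMap, xCoord_generic]

omit [IsDomain R] [CharZero R] in
lemma aeval_prodForm (a b c d : R[X]) : aeval (x W) ((W.map C).prodForm a b c d) =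
    (W.map (algebraMap R W.FunctionField)).prodForm (aeval (x W) a) (aeval (x W) b)
      (aeval (x W) c) (aeval (x W) d) := by
  rw [← map_C_map_aeval W]
  exact map_prodForm _ (aeval (x W) : R[X] →ₐ[R] W.FunctionField).toRingHom a b c d

omit [IsDomain R] [CharZero R] in
lemma aeval_sumForm (a b c d : R[X]) : aeval (x W) ((W.map C).sumForm a b c d) =
    (W.map (algebraMap R W.FunctionField)).sumForm (aeval (x W) a) (aeval (x W) b)
      (aeval (x W) c) (aeval (x W) d) := by
  rw [← map_C_map_aeval W]
  exact map_sumForm _ (aeval (x W) : R[X] →ₐ[R] W.FunctionField).toRingHom a b c d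

variable {n : ℕ} (hn : 1 ≤ n)
include hn

lemma ΨSq_two_mul : W.ΨSq (2 * n : ℕ) =
    4 * W.Φ n ^ 3 * W.ΨSq n + C W.b₂ * W.Φ n ^ 2 * W.ΨSq n ^ 2 +
      2 * C W.b₄ * W.Φ n * W.ΨSq n ^ 3 + C W.b₆ * W.ΨSq n ^ 4 := by
  apply aeval_x_injective W
  simp only [map_add, map_mul, map_pow, map_ofNat, aeval_C, eval_Φ_generic, eval_ΨSq_generic]
  rw [eval_ΨSq_two_mul (generic_ne_zero W) (fun n ↦ psiVal_generic W) hn]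
  simp only [map_b₂, map_b₄, map_b₆]

lemma Φ_two_mul : W.Φ (2 * n : ℕ) =
    (W.map C).prodForm (W.Φ n) (W.ΨSq n) (W.Φ n) (W.ΨSq n) := by
  apply aeval_x_injective W
  simp only [aeval_prodForm, eval_Φ_generic, eval_ΨSq_generic]
  rw [eval_Φ_two_mul (generic_ne_zero W) (fun n ↦ psiVal_generic W) hn]

lemma ΨSq_two_mul_add_one : W.ΨSq (2 * n + 1 : ℕ) =
    (W.Φ n * W.ΨSq (n + 1 : ℕ) - W.Φ (n + 1 : ℕ) * W.ΨSq n) ^ 2 := by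
  apply aeval_x_injective W
  simp only [map_sub, map_mul, map_pow, eval_Φ_generic, eval_ΨSq_generic]
  rw [eval_ΨSq_two_mul_add_one (generic_ne_zero W) (fun n ↦ psiVal_generic W) hn]

lemma Φ_two_mul_add_one : W.Φ (2 * n + 1 : ℕ) + X * W.ΨSq (2 * n + 1 : ℕ) =
    (W.map C).sumForm (W.Φ n) (W.ΨSq n) (W.Φ (n + 1 : ℕ)) (W.ΨSq (n + 1 : ℕ)) := by
  apply aeval_x_injective W
  simp only [aeval_sumForm, map_add, map_mul, aeval_X, eval_Φ_generic, eval_ΨSq_generic]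
  have := eval_Φ_two_mul_add_one (generic_ne_zero W) (fun n ↦ psiVal_generic W) hn
  rwa [xCoord_generic] at this ⊢

/-- Apply the invariant derivation to `x(nQ) · ΨSq = Φ` at the generic point and use `ψ₂(nQ) ψ_n⁴ =
ψ_{2n}`. Squaring leaves only polynomials in `x`. -/
lemma wronskian : W.Ψ₂Sq * (derivative (W.Φ n) * W.ΨSq n - W.Φ n * derivative (W.ΨSq n)) ^ 2 =
    (n : R[X]) ^ 2 * W.ΨSq (2 * n : ℕ) := by
  apply aeval_x_injective W
  have hQ := generic_ne_zero W
  have hw := fun n ↦ psiVal_generic W (n := n)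
  let D := deriv W
  have hD : ∀ r : R, D (algebraMap R W.FunctionField r) = 0 := (deriv W).map_algebraMap
  have h2 : (2 : W.FunctionField) ≠ 0 := by
    rw [← map_ofNat (algebraMap R W.FunctionField)]
    simp
  have hb₂ : D (W.map (algebraMap R W.FunctionField)).b₂ = 0 := by rw [map_b₂, hD]
  have hb₄ : D (W.map (algebraMap R W.FunctionField)).b₄ = 0 := by rw [map_b₄, hD]
  have hb₆ : D (W.map (algebraMap R W.FunctionField)).b₆ = 0 := by rw [map_b₆, hD]
  have hb₈ : D (W.map (algebraMap R W.FunctionField)).b₈ = 0 := by rw [map_b₈, hD]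
  have h₁ := derivation_nsmul D hQ hw h2 hb₂ hb₄ hb₆ hb₈ (deriv_x W) hn
  have h₂ := xCoord_nsmul_mul hQ hw hn
  have h₃ := psiTwo_nsmul hQ hw hn
  have h₄ := eval_Ψ₂Sq hQ
  rw [map_Ψ₂Sq, eval_map_algebraMap, xCoord_generic, psiTwo_generic] at h₄
  have h₅ := psiVal_sq hQ n
  have h₆ := psiVal_sq hQ (2 * n : ℕ)
  push_cast at h₆
  have h₈ (p : R[X]) : D (aeval (x W) p) = aeval (x W) (derivative p) * psiTwo W := by
    rw [← deriv_x W, ← smul_eq_mul]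
    exact (deriv W).map_aeval p (x W)
  rw [← eval_ΨSq_generic] at h₅ h₆
  rw [← eval_ΨSq_generic, ← eval_Φ_generic] at h₂
  have h₇ := congrArg D h₂
  rw [D.leibniz, h₁, h₈, h₈, smul_eq_mul, smul_eq_mul] at h₇
  push_cast
  simp only [map_mul, map_sub, map_pow, map_natCast]
  rw [← h₆, h₄, ← h₃, ← mul_pow, ← mul_pow]
  congr 1
  rw [← h₂]
  linear_combination -aeval (x W) (W.ΨSq n) * h₇ -
    (n : W.FunctionField) * (n • generic W).psiTwo * ((generic W).psiVal n ^ 2 +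
      aeval (x W) (W.ΨSq n)) * h₅

end CharZero
end Affine.FunctionField
end WeierstrassCurve

end

/-! ### Specialization from the universal curve -/

namespace WeierstrassCurve

section Universal
variable {R : Type*} [CommRing R] (W : WeierstrassCurve R)

/-- The universal Weierstrass curve. -/
noncomputable def universal : WeierstrassCurve (MvPolynomial (Fin 5) ℤ) :=
  ⟨.X 0, .X 1, .X 2, .X 3, .X 4⟩

/-- The specialization of the universal Weierstrass curve. -/
noncomputable def specialize : MvPolynomial (Fin 5) ℤ →+* R :=
  MvPolynomial.eval₂Hom (Int.castRingHom R) ![W.a₁, W.a₂, W.a₃, W.a₄, W.a₆]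

lemma map_specialize : universal.map W.specialize = W := by
  ext <;> simp [universal, specialize]

variable {n : ℕ} (hn : 1 ≤ n)
include hn

/-- The coefficient ring of the universal curve is a domain of characteristic zero, so the identity
holds there, and every Weierstrass curve is a specialization of the universal one. The next
identities are transported in the same way. -/
theorem ΨSq_two_mul : W.ΨSq (2 * n : ℕ) =
    4 * W.Φ n ^ 3 * W.ΨSq n + C W.b₂ * W.Φ n ^ 2 * W.ΨSq n ^ 2 +
      2 * C W.b₄ * W.Φ n * W.ΨSq n ^ 3 + C W.b₆ * W.ΨSq n ^ 4 := by
  have h := congrArg (mapRingHom W.specialize) (Affine.FunctionField.ΨSq_two_mul universal hn)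
  simp only [map_add, map_mul, map_pow, map_ofNat, coe_mapRingHom, map_C] at h
  rwa [← map_ΨSq, ← map_ΨSq, ← map_Φ, ← map_b₂, ← map_b₄, ← map_b₆, map_specialize] at h

theorem Φ_two_mul : W.Φ (2 * n : ℕ) =
    (W.map C).prodForm (W.Φ n) (W.ΨSq n) (W.Φ n) (W.ΨSq n) := by
  have h := congrArg (mapRingHom W.specialize) (Affine.FunctionField.Φ_two_mul universal hn)
  rw [map_prodForm, map_C_map_mapRingHom, map_specialize] at h
  simp only [coe_mapRingHom] at h
  rwa [← map_ΨSq, ← map_Φ, ← map_Φ, map_specialize] at h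

theorem ΨSq_two_mul_add_one : W.ΨSq (2 * n + 1 : ℕ) =
    (W.Φ n * W.ΨSq (n + 1 : ℕ) - W.Φ (n + 1 : ℕ) * W.ΨSq n) ^ 2 := by
  have h := congrArg (mapRingHom W.specialize)
    (Affine.FunctionField.ΨSq_two_mul_add_one universal hn)
  simp only [map_sub, map_mul, map_pow, coe_mapRingHom] at h
  rwa [← map_ΨSq, ← map_ΨSq, ← map_ΨSq, ← map_Φ, ← map_Φ, map_specialize] at h

theorem Φ_two_mul_add_one : W.Φ (2 * n + 1 : ℕ) + X * W.ΨSq (2 * n + 1 : ℕ) =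
    (W.map C).sumForm (W.Φ n) (W.ΨSq n) (W.Φ (n + 1 : ℕ)) (W.ΨSq (n + 1 : ℕ)) := by
  have h := congrArg (mapRingHom W.specialize)
    (Affine.FunctionField.Φ_two_mul_add_one universal hn)
  rw [map_sumForm, map_C_map_mapRingHom, map_specialize] at h
  simp only [map_add, map_mul, coe_mapRingHom, map_X] at h
  rwa [← map_ΨSq, ← map_ΨSq, ← map_ΨSq, ← map_Φ, ← map_Φ, ← map_Φ, map_specialize] at h

/-- The Wronskian of the numerator and the denominator of the multiplication map. -/
theorem wronskian :
    W.Ψ₂Sq * (derivative (W.Φ n) * W.ΨSq n - W.Φ n * derivative (W.ΨSq n)) ^ 2 =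
      (n : R[X]) ^ 2 * W.ΨSq (2 * n : ℕ) := by
  have h := congrArg (mapRingHom W.specialize) (Affine.FunctionField.wronskian universal hn)
  simp only [map_sub, map_mul, map_pow, map_natCast, coe_mapRingHom, ← derivative_map] at h
  rwa [← map_ΨSq, ← map_ΨSq, ← map_Φ, ← map_Ψ₂Sq, map_specialize] at h

end Universal

/-! ### Multiplication by `n` on projective `x`-coordinates -/

namespace Affine.Point

variable {F : Type*} [Field F] {W : Affine F} [DecidableEq F]

omit [DecidableEq F] in
lemma eval_prodForm (a b c d : F[X]) (x : F) : ((W.map C).prodForm a b c d).eval x =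
    W.prodForm (a.eval x) (b.eval x) (c.eval x) (d.eval x) := by
  simp [prodForm]

omit [DecidableEq F] in
lemma eval_sumForm (a b c d : F[X]) (x : F) : ((W.map C).sumForm a b c d).eval x =
    W.sumForm (a.eval x) (b.eval x) (c.eval x) (d.eval x) := by
  simp [sumForm]

/-- The projective point `(a : b)` of the line is the image of `P` under the coordinate `x`. -/
def IsXRep (P : W.Point) (a b : F) : Prop :=
  (P = 0 → b = 0 ∧ a ≠ 0) ∧ (P ≠ 0 → a = P.xCoord * b ∧ b ≠ 0)

/-- Beyond the duplication formula, the point is that the two forms have no common zero on the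
curve; this is where nonsingularity is used. -/
lemma isXRep_double {P : W.Point} {a b : F} (h : P.IsXRep a b) :
    (P + P).IsXRep (W.prodForm a b a b)
      (4 * a ^ 3 * b + W.b₂ * a ^ 2 * b ^ 2 + 2 * W.b₄ * a * b ^ 3 + W.b₆ * b ^ 4) := by
  by_cases hP : P = 0
  · obtain ⟨rfl, ha⟩ := h.1 hP
    subst hP
    refine ⟨fun _ ↦ ⟨by ring, ?_⟩, fun h ↦ (h (add_zero 0)).elim⟩
    simpa [prodForm] using ha
  · obtain ⟨rfl, hb⟩ := h.2 hP
    have h2 := psiTwo_sq hP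
    refine ⟨fun h0 ↦ ?_, fun h0 ↦ ?_⟩
    · have h3 := (psiTwo_eq_zero_iff hP).2 h0
      rw [h3] at h2
      refine ⟨by linear_combination -b ^ 4 * h2, fun h4 ↦ ?_⟩
      have h₁ := (equation_iff ..).mp (equation_coord hP)
      have h₅ := (nonsingular_iff ..).mp (nonsingular_coord hP)
      rw [psiTwo] at h3
      -- At a 2-torsion point the form `prodForm` is the square of the partial derivative in `x`,
      -- modulo the curve equation and `ψ₂ = 0`.
      have h₆ : (3 * P.xCoord ^ 2 + 2 * W.a₂ * P.xCoord + W.a₄ - W.a₁ * P.yCoord) ^ 2 * b ^ 4 = 0 := by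
        rw [prodForm, b₄, b₆, b₈] at h4
        linear_combination h4 - b ^ 4 * (W.a₁ ^ 2 + 4 * W.a₂ + 8 * P.xCoord) * h₁ -
          b ^ 4 * (W.a₁ * (3 * P.xCoord ^ 2 + 2 * W.a₂ * P.xCoord + W.a₄ - W.a₁ * P.yCoord) -
            (W.a₂ + 2 * P.xCoord) * (2 * P.yCoord + W.a₁ * P.xCoord + W.a₃)) * h3
      have h₇ : 3 * P.xCoord ^ 2 + 2 * W.a₂ * P.xCoord + W.a₄ - W.a₁ * P.yCoord = 0 := by
        simpa [hb] using h₆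
      rcases h₅.2 with h | h
      · exact h (by linear_combination -h₇)
      · exact h (by linear_combination h3)
    · have h3 := xCoord_add_self hP h0
      refine ⟨?_, fun h4 ↦ h0 ((psiTwo_eq_zero_iff hP).1 ?_)⟩
      · rw [prodForm] at h3 ⊢
        linear_combination -b ^ 4 * h3 + (P + P).xCoord * b ^ 4 * h2
      · have : P.psiTwo ^ 2 * b ^ 4 = 0 := by linear_combination h4 + b ^ 4 * h2
        simpa [hb] using this

/-- The other root `x(Q - P)` is subtracted from the sum formula. If `Q = -P` the denominator
vanishes and the numerator becomes a nonzero multiple of `ψ₂(Q)²`, which is nonzero because `2Q = Q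
- P ≠ 0`. -/
lemma isXRep_add {P Q : W.Point} (hD : Q - P ≠ 0) {a b c d : F} (hP : P.IsXRep a b)
    (hQ : Q.IsXRep c d) :
    (P + Q).IsXRep (W.sumForm a b c d - (Q - P).xCoord * (a * d - c * b) ^ 2)
      ((a * d - c * b) ^ 2) := by
  by_cases hP0 : P = 0
  · obtain ⟨rfl, ha⟩ := hP.1 hP0
    subst hP0
    rw [sub_zero] at hD ⊢
    obtain ⟨rfl, hd⟩ := hQ.2 hD
    rw [zero_add]
    exact ⟨fun h ↦ (hD h).elim, fun _ ↦ ⟨by rw [sumForm]; ring, by simp [ha, hd]⟩⟩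
  by_cases hQ0 : Q = 0
  · obtain ⟨rfl, hc⟩ := hQ.1 hQ0
    subst hQ0
    obtain ⟨rfl, hb⟩ := hP.2 hP0
    rw [zero_sub, xCoord_neg, add_zero]
    exact ⟨fun h ↦ (hP0 h).elim, fun _ ↦ ⟨by rw [sumForm]; ring, by simp [hb, hc]⟩⟩
  obtain ⟨rfl, hb⟩ := hP.2 hP0
  obtain ⟨rfl, hd⟩ := hQ.2 hQ0
  by_cases hx : P.xCoord = Q.xCoord
  · have hPQ := ((xCoord_eq_iff hP0 hQ0).1 hx).resolve_left fun h ↦ hD (by rw [h, sub_self])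
    have h2 : Q.psiTwo ≠ 0 := fun h ↦ hD (by
      rw [hPQ, sub_neg_eq_add, (psiTwo_eq_zero_iff hQ0).1 h])
    have h2' := psiTwo_sq hQ0
    refine ⟨fun _ ↦ ⟨by rw [hx]; ring, ?_⟩, fun h ↦ (h (by rw [hPQ, neg_add_cancel])).elim⟩
    have e : W.sumForm (P.xCoord * b) b (Q.xCoord * d) d - (Q - P).xCoord *
        (P.xCoord * b * d - Q.xCoord * d * b) ^ 2 = Q.psiTwo ^ 2 * b ^ 2 * d ^ 2 := by
      rw [h2', hx, sumForm]
      ring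
    rw [e]
    simp [h2, hb, hd]
  · have h₁ := xCoord_add_add_xCoord_sub hP0 hQ0 hx
    refine ⟨fun h ↦ (add_ne_zero_of_xCoord_ne hx h).elim, fun _ ↦ ⟨?_, ?_⟩⟩
    · rw [← neg_sub P Q, xCoord_neg, sumForm]
      rw [sumForm] at h₁
      linear_combination -b ^ 2 * d ^ 2 * h₁
    · rw [show P.xCoord * b * d - Q.xCoord * d * b = (P.xCoord - Q.xCoord) * (b * d) by ring]
      simp [hb, hd, sub_ne_zero.2 hx]

/-- The generic formulas assume that no multiple vanishes, so torsion points are reached by binary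
induction in projective coordinates. In the odd step the points `kP` and `(k + 1)P` differ by `P ≠
0`, as `isXRep_add` requires. -/
theorem isXRep_nsmul {P : W.Point} (hP : P ≠ 0) {n : ℕ} (hn : 1 ≤ n) :
    (n • P).IsXRep ((W.Φ n).eval P.xCoord) ((W.ΨSq n).eval P.xCoord) := by
  induction n using Nat.strong_induction_on with
  | _ n ih =>
  rcases Nat.even_or_odd' n with ⟨k, rfl | rfl⟩
  · have hk : 1 ≤ k := by omega
    have := isXRep_double (ih k (by omega) hk)
    rw [← two_nsmul, ← mul_nsmul'] at this
    rw [Φ_two_mul _ hk, ΨSq_two_mul _ hk, eval_prodForm]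
    simpa only [eval_add, eval_mul, eval_pow, eval_ofNat, eval_C] using this
  · rcases k.eq_zero_or_pos with rfl | hk
    · refine ⟨fun h ↦ (hP (by simpa using h)).elim, fun _ ↦ by simp⟩
    have := isXRep_add (by rwa [succ_nsmul, add_sub_cancel_left]) (ih k (by omega) hk)
      (ih (k + 1) (by omega) (by omega))
    rw [show (k + 1) • P - k • P = P by rw [succ_nsmul, add_sub_cancel_left], ← add_nsmul,
      show k + (k + 1) = 2 * k + 1 by ring, ← eval_sumForm, ← Φ_two_mul_add_one _ hk] at this
    have h2 := congrArg (eval P.xCoord) (ΨSq_two_mul_add_one W hk)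
    simp only [eval_pow, eval_sub, eval_mul] at h2
    rw [← h2] at this
    simpa only [eval_add, eval_mul, eval_X, add_sub_cancel_right] using this

end Affine.Point
end WeierstrassCurve

/-! ### Separability of `δ` and the fibre of multiplication over `P` -/

namespace WeierstrassCurve

namespace Affine.Point

section Coprime

/-- The Bézout identity is `(2X + b)² - 4(X² + bX + c) = b² - 4c`; it is valid in characteristic two
as well. -/
lemma separable_quadratic {F : Type*} [Field F] {b c : F} (h : b ^ 2 - 4 * c ≠ 0) :
    (C 1 * X ^ 2 + C b * X + C c).Separable := by
  refine (separable_def' _).2 ⟨C (-4 * (b ^ 2 - 4 * c)⁻¹), C ((b ^ 2 - 4 * c)⁻¹) *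
    derivative (C 1 * X ^ 2 + C b * X + C c), ?_⟩
  have h' : C (b ^ 2 - 4 * c)⁻¹ * (C b ^ 2 - 4 * C c) = 1 := by
    rw [← map_ofNat C, ← C_pow, ← C_mul, ← C_sub, ← C_mul, inv_mul_cancel₀ h, C_1]
  simp only [derivative_add, derivative_C_mul, derivative_X_sq, derivative_C, derivative_X,
    C_mul, C_neg, C_1, map_ofNat, one_mul]
  linear_combination h'

variable {F : Type*} [Field F] (W : Affine F) [W.IsElliptic]

omit [W.IsElliptic] in
lemma eval_Ψ₂Sq_eq (x : F) : W.Ψ₂Sq.eval x =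
    (W.a₁ * x + W.a₃) ^ 2 - 4 * -(x ^ 3 + W.a₂ * x ^ 2 + W.a₄ * x + W.a₆) := by
  rw [Ψ₂Sq, b₂, b₄, b₆]
  simp only [eval_add, eval_mul, eval_C, eval_pow, eval_X]
  ring

lemma exists_xCoord_eq [IsAlgClosed F] (x : F) : ∃ P : W.Point, P ≠ 0 ∧ P.xCoord = x := by
  obtain ⟨y, hy⟩ := IsAlgClosed.exists_root (C 1 * X ^ 2 + C (W.a₁ * x + W.a₃) * X +
    C (-(x ^ 3 + W.a₂ * x ^ 2 + W.a₄ * x + W.a₆))) (by rw [degree_quadratic one_ne_zero]; simp)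
  have h : W.Equation x y := by
    rw [equation_iff]
    simp only [IsRoot.def, eval_add, eval_mul, eval_C, eval_pow, eval_X] at hy
    linear_combination hy
  exact ⟨.some x y (W.equation_iff_nonsingular.1 h), some_ne_zero _, rfl⟩

/-- A common root over the algebraic closure would be the `x`-coordinate of a point whose multiple
has projective coordinate `(0 : 0)`. -/
lemma isCoprime_Φ_ΨSq {n : ℕ} (hn : 1 ≤ n) : IsCoprime (W.Φ n) (W.ΨSq n) := by
  classical
  rw [isCoprime_iff_aeval_ne_zero_of_isAlgClosed F (AlgebraicClosure F)]
  intro x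
  obtain ⟨P, hP, rfl⟩ := exists_xCoord_eq (W.map (algebraMap F (AlgebraicClosure F))) x
  rw [← eval_map_algebraMap, ← eval_map_algebraMap, ← map_Φ, ← map_ΨSq]
  by_cases h : n • P = 0
  · exact Or.inl ((isXRep_nsmul hP hn).1 h).2
  · exact Or.inr ((isXRep_nsmul hP hn).2 h).2

variable {W} {P : W.Point} {n : ℕ} (hn : 1 ≤ n)
include hn

lemma isCoprime_delta_ΨSq : IsCoprime (W.Φ n - C P.xCoord * W.ΨSq n) (W.ΨSq n) := by
  rw [sub_eq_add_neg, ← neg_mul]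
  exact (isCoprime_Φ_ΨSq W hn).add_mul_right_left _

-- This is the Wronskian identity modulo `δ`: there `Φ` equals `x(P) ΨSq`, so `ΨSq (2n)` becomes
-- `ψ₂(P)² ΨSq⁴`. At a root of `δ` the derivative `δ'` is therefore nonzero once `n` and `ψ₂(P)`
-- are.
omit [W.IsElliptic] in
lemma wronskian_delta : W.Ψ₂Sq * derivative (W.Φ n - C P.xCoord * W.ΨSq n) ^ 2 * W.ΨSq n ^ 2 =
    C (n ^ 2 * (4 * P.xCoord ^ 3 + W.b₂ * P.xCoord ^ 2 + 2 * W.b₄ * P.xCoord + W.b₆)) *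
      W.ΨSq n ^ 4 + (W.Φ n - C P.xCoord * W.ΨSq n) *
        ((n : F[X]) ^ 2 * (4 * W.ΨSq n * (W.Φ n ^ 2 + C P.xCoord * W.Φ n * W.ΨSq n +
          C P.xCoord ^ 2 * W.ΨSq n ^ 2) + C W.b₂ * W.ΨSq n ^ 2 * (W.Φ n + C P.xCoord * W.ΨSq n) +
          2 * C W.b₄ * W.ΨSq n ^ 3) + W.Ψ₂Sq * (2 * derivative (W.Φ n - C P.xCoord * W.ΨSq n) *
          W.ΨSq n * derivative (W.ΨSq n) - (W.Φ n - C P.xCoord * W.ΨSq n) *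
          derivative (W.ΨSq n) ^ 2)) := by
  have h := W.wronskian hn
  rw [ΨSq_two_mul W hn] at h
  simp only [derivative_sub, derivative_C_mul, C_mul, C_add, C_pow, map_natCast, map_ofNat] at h ⊢
  linear_combination h

lemma separable_delta (hP : P ≠ 0) (hp : P.psiTwo ≠ 0) (hnF : (n : F) ≠ 0) :
    (W.Φ n - C P.xCoord * W.ΨSq n).Separable := by
  rw [separable_def]
  have h := wronskian_delta (P := P) hn
  rw [← psiTwo_sq hP] at h
  have hu : IsUnit (C ((n : F) ^ 2 * P.psiTwo ^ 2)) := by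
    rw [isUnit_C, isUnit_iff_ne_zero]
    simp [hp, hnF]
  have hc : IsCoprime (W.Φ n - C P.xCoord * W.ΨSq n)
      (C ((n : F) ^ 2 * P.psiTwo ^ 2) * W.ΨSq n ^ 4) :=
    (isCoprime_mul_unit_left_right hu _ _).2 (isCoprime_delta_ΨSq hn).pow_right
  rw [← IsCoprime.add_mul_left_right_iff, ← h] at hc
  exact (IsCoprime.pow_right_iff two_pos).1 hc.of_mul_right_left.of_mul_right_right

omit [W.IsElliptic] in
lemma monic_delta_and_natDegree : (W.Φ n - C P.xCoord * W.ΨSq n).Monic ∧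
    (W.Φ n - C P.xCoord * W.ΨSq n).natDegree = n ^ 2 := by
  have h₁ : (W.Φ n).natDegree = n ^ 2 := by simp
  have h₂ : (C P.xCoord * W.ΨSq n).natDegree < (W.Φ n).natDegree := by
    rw [h₁]
    refine ((natDegree_C_mul_le _ _).trans (W.natDegree_ΨSq_le n)).trans_lt ?_
    have : 0 < n ^ 2 := by positivity
    simpa using by omega
  refine ⟨?_, ?_⟩
  · rw [Monic, leadingCoeff_sub_of_degree_lt (degree_lt_degree h₂), leadingCoeff_Φ]
  · rw [natDegree_sub_eq_left_of_natDegree_lt h₂, h₁]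

omit [W.IsElliptic] in
lemma monic_delta : (W.Φ n - C P.xCoord * W.ΨSq n).Monic := (monic_delta_and_natDegree hn).1

omit [W.IsElliptic] in
lemma natDegree_delta : (W.Φ n - C P.xCoord * W.ΨSq n).natDegree = n ^ 2 :=
  (monic_delta_and_natDegree hn).2

end Coprime

section Fibre
variable {F : Type*} [Field F] {W : Affine F} [DecidableEq F] {P : W.Point} {n : ℕ}

lemma ne_zero_of_nsmul_eq (hP : P ≠ 0) {R : W.Point} (hR : n • R = P) : R ≠ 0 := by
  rintro rfl
  exact hP (by rw [← hR, smul_zero])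

lemma eval_delta_of_nsmul_eq (hn : 1 ≤ n) (hP : P ≠ 0) {R : W.Point} (hR : n • R = P) :
    (W.Φ n - C P.xCoord * W.ΨSq n).eval R.xCoord = 0 := by
  have h := (isXRep_nsmul (ne_zero_of_nsmul_eq hP hR) hn).2 (by rwa [hR])
  rw [hR] at h
  rw [eval_sub, eval_mul, eval_C, h.1, sub_self]

lemma xCoord_injOn (hP : P ≠ 0) (hp : P.psiTwo ≠ 0) : Set.InjOn xCoord {R : W.Point | n • R = P} := by
  intro R hR S hS h
  rcases (xCoord_eq_iff (ne_zero_of_nsmul_eq hP hR)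
    (ne_zero_of_nsmul_eq hP hS)).1 h with h | h
  · exact h
  · refine (hp ((psiTwo_eq_zero_iff hP).2 ?_)).elim
    rw [Set.mem_ofPred_eq] at hR hS
    rw [h, smul_neg, hS] at hR
    nth_rw 1 [← hR]
    exact neg_add_cancel P

variable [IsSepClosed F] [W.IsElliptic] (hn : 1 ≤ n) (hP : P ≠ 0) (hp : P.psiTwo ≠ 0)
  (hnF : (n : F) ≠ 0)
include hn hP hp hnF

/-- The equation for `y` over a root `x` of `δ` has discriminant `Ψ₂Sq(x)`, which is nonzero by
`wronskian_delta`. It is thus separable and solvable over a separably closed field, and the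
resulting point or its negative lies over `P`. -/
lemma exists_nsmul_eq {x : F} (hx : (W.Φ n - C P.xCoord * W.ΨSq n).eval x = 0) :
    ∃ R : W.Point, n • R = P ∧ R.xCoord = x := by
  have h := congrArg (eval x) (wronskian_delta (P := P) hn)
  have hS : (W.ΨSq n).eval x ≠ 0 := by
    intro h0
    have := (isCoprime_delta_ΨSq (P := P) hn)
    obtain ⟨a, b, e⟩ := this
    have e' := congrArg (eval x) e
    rw [eval_add, eval_mul, eval_mul, hx, h0] at e'
    simp at e'
  have h2 : W.Ψ₂Sq.eval x ≠ 0 := by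
    intro h0
    rw [← psiTwo_sq hP] at h
    simp only [eval_mul, eval_add, eval_pow, h0, hx, zero_mul, add_zero, eval_C] at h
    have := mul_ne_zero (mul_ne_zero (pow_ne_zero 2 hnF) (pow_ne_zero 2 hp)) (pow_ne_zero 4 hS)
    exact this h.symm
  obtain ⟨y, hy⟩ := IsSepClosed.exists_root (C 1 * X ^ 2 + C (W.a₁ * x + W.a₃) * X +
    C (-(x ^ 3 + W.a₂ * x ^ 2 + W.a₄ * x + W.a₆))) (by rw [degree_quadratic one_ne_zero]; simp)
    (separable_quadratic (by
      rw [eval_Ψ₂Sq_eq] at h2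
      exact h2))
  have he : W.Equation x y := by
    rw [equation_iff]
    simp only [IsRoot.def, eval_add, eval_mul, eval_C, eval_pow, eval_X] at hy
    linear_combination hy
  obtain ⟨R, hR, rfl⟩ : ∃ R : W.Point, R ≠ 0 ∧ R.xCoord = x :=
    ⟨.some x y (W.equation_iff_nonsingular.1 he), some_ne_zero _, rfl⟩
  have h3 : n • R ≠ 0 := fun h0 ↦ hS ((isXRep_nsmul hR hn).1 h0).1
  have h4 := ((isXRep_nsmul hR hn).2 h3).1
  have h5 : (n • R).xCoord = P.xCoord := by
    apply mul_right_cancel₀ hS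
    simp only [eval_sub, eval_mul, eval_C] at hx
    linear_combination hx - h4
  rcases (xCoord_eq_iff h3 hP).1 h5 with h6 | h6
  · exact ⟨R, h6, rfl⟩
  · exact ⟨-R, by rw [smul_neg, h6, neg_neg], xCoord_neg R⟩

lemma ncard_nsmul_eq : {R : W.Point | n • R = P}.ncard = n ^ 2 := by
  rw [← (xCoord_injOn hP hp).ncard_image]
  have : xCoord '' {R : W.Point | n • R = P} =
      (W.Φ n - C P.xCoord * W.ΨSq n).rootSet F := by
    ext x
    rw [mem_rootSet_of_ne (monic_delta hn).ne_zero, coe_aeval_eq_eval]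
    constructor
    · rintro ⟨R, hR, rfl⟩
      exact eval_delta_of_nsmul_eq hn hP hR
    · exact exists_nsmul_eq hn hP hp hnF
  rw [this, ← natDegree_delta (P := P) hn, Set.ncard_eq_toFinset_card', Set.toFinset_card]
  have hsep := separable_delta hn hP hp hnF
  refine card_rootSet_eq_natDegree hsep ?_
  rw [Algebra.algebraMap_self, Polynomial.map_id]
  exact IsSepClosed.splits_of_separable _ hsep

end Fibre

end Affine.Point
end WeierstrassCurve

/-! ### Transvections of a plane -/

namespace Module.End
variable {F V : Type*} [Field F] [AddCommGroup V] [Module F V]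

lemma one_add_pow_of_sq_eq_zero {A : Module.End F V} (hA : A ^ 2 = 0) (n : ℕ) :
    (1 + A) ^ n = 1 + (n : F) • A := by
  induction n with
  | zero => simp
  | succ n ih =>
    rw [pow_succ, ih, add_mul, one_mul, smul_mul_assoc, mul_add, ← sq, hA, Nat.cast_succ, add_smul]
    simp
    abel

variable (hV : Module.finrank F V = 2)
include hV

lemma sq_eq_zero_of_isNilpotent {A : Module.End F V} (hA : IsNilpotent A) : A ^ 2 = 0 := by
  have : FiniteDimensional F V := .of_finrank_eq_succ hV
  have h := LinearMap.aeval_self_charpoly A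
  rwa [IsNilpotent.charpoly_eq_X_pow_finrank hA, hV, map_pow, aeval_X] at h

lemma finrank_ker_of_sq_eq_zero {A : Module.End F V} (hA : A ^ 2 = 0) (h0 : A ≠ 0) :
    Module.finrank F (LinearMap.ker A) = 1 := by
  have : FiniteDimensional F V := .of_finrank_eq_succ hV
  have h₁ := LinearMap.finrank_range_add_finrank_ker A
  have h₂ : LinearMap.range A ≤ LinearMap.ker A := by
    rintro _ ⟨v, rfl⟩
    exact congrArg (fun f ↦ f v) (sq A ▸ hA : A * A = 0)
  have h₃ := Submodule.finrank_mono h₂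
  have h₄ : Module.finrank F (LinearMap.range A) ≠ 0 := by
    rw [Ne, Submodule.finrank_eq_zero, LinearMap.range_eq_bot]
    exact h0
  omega

lemma ker_eq_span {A : Module.End F V} (hA : A ^ 2 = 0) (h0 : A ≠ 0) {u : V} (hu : u ≠ 0)
    (hAu : A u = 0) : LinearMap.ker A = Submodule.span F {u} := by
  have : FiniteDimensional F V := .of_finrank_eq_succ hV
  refine (Submodule.eq_of_le_of_finrank_eq ?_ ?_).symm
  · rw [Submodule.span_singleton_le_iff_mem]
    exact hAu
  · rw [finrank_span_singleton hu, finrank_ker_of_sq_eq_zero hV hA h0]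

/-- In a basis made of the two axes the transvections are upper and lower unitriangular. Suitable
powers `g` and `k` have off-diagonal entries `1` and `-1`, and `gkg` sends `u` to `-v` and `v` to
`u`, so its square is `-1`. -/
lemma exists_sq_eq_neg_one {A B : Module.End F V}
    (hcast : ∀ x : F, ∃ a : ℕ, (a : F) = x)
    (hA : A ^ 2 = 0) (hB : B ^ 2 = 0) (hA0 : A ≠ 0) (hB0 : B ≠ 0)
    (h : LinearMap.ker A ≠ LinearMap.ker B) :
    ∃ a b : ℕ, ((1 + A) ^ a * (1 + B) ^ b * (1 + A) ^ a) ^ 2 = -1 := by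
  have : FiniteDimensional F V := .of_finrank_eq_succ hV
  have hex {A : Module.End F V} (hA : A ^ 2 = 0) (h0 : A ≠ 0) : ∃ u, u ≠ 0 ∧ A u = 0 := by
    obtain ⟨⟨u, hu⟩, h1, -⟩ := finrank_eq_one_iff'.1 (finrank_ker_of_sq_eq_zero hV hA h0)
    exact ⟨u, by simpa using h1, hu⟩
  obtain ⟨u, hu, hAu⟩ := hex hA hA0
  obtain ⟨v, hv, hBv⟩ := hex hB hB0
  have hkA := ker_eq_span hV hA hA0 hu hAu
  have hkB := ker_eq_span hV hB hB0 hv hBv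
  have hAv : A v ≠ 0 := fun h0 ↦ h (by rw [ker_eq_span hV hA hA0 hv h0, hkB])
  have hBu : B u ≠ 0 := fun h0 ↦ h (by rw [ker_eq_span hV hB hB0 hu h0, hkA])
  have h₁ : A v ∈ LinearMap.ker A :=
    congrArg (fun f : Module.End F V ↦ f v) (sq A ▸ hA : A * A = 0)
  have h₂ : B u ∈ LinearMap.ker B :=
    congrArg (fun f : Module.End F V ↦ f u) (sq B ▸ hB : B * B = 0)
  rw [hkA, Submodule.mem_span_singleton] at h₁
  rw [hkB, Submodule.mem_span_singleton] at h₂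
  obtain ⟨α, hα⟩ := h₁
  obtain ⟨β, hβ⟩ := h₂
  have hα0 : α ≠ 0 := by rintro rfl; exact hAv (by rw [← hα, zero_smul])
  have hβ0 : β ≠ 0 := by rintro rfl; exact hBu (by rw [← hβ, zero_smul])
  -- With `A v = α u` and `B u = β v`, these exponents turn the powers of `1 + A` and `1 + B` into
  -- `v ↦ v + u` and `u ↦ u - v`.
  obtain ⟨a, ha⟩ := hcast α⁻¹
  obtain ⟨b, hb⟩ := hcast (-β⁻¹)
  refine ⟨a, b, ?_⟩
  rw [one_add_pow_of_sq_eq_zero hA, one_add_pow_of_sq_eq_zero hB, ha, hb]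
  have hli : LinearIndependent F ![u, v] := by
    rw [LinearIndependent.pair_iff' hu]
    rintro c rfl
    exact hAv (by rw [map_smul, hAu, smul_zero])
  have hspan := hli.span_eq_top_of_card_eq_finrank' (by simp [hV])
  have gu : ((1 : Module.End F V) + α⁻¹ • A) u = u := by simp [hAu]
  have gv : ((1 : Module.End F V) + α⁻¹ • A) v = v + u := by simp [← hα, smul_smul, hα0]
  have hu' : ((1 : Module.End F V) + -β⁻¹ • B) u = u - v := by
    simp [← hβ, smul_smul, hβ0, sub_eq_add_neg]
  have hv' : ((1 : Module.End F V) + -β⁻¹ • B) v = v := by simp [hBv]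
  generalize (1 : Module.End F V) + α⁻¹ • A = g at *
  generalize (1 : Module.End F V) + -β⁻¹ • B = k at *
  refine LinearMap.ext_on_range hspan fun i ↦ ?_
  fin_cases i
  · simp [sq, Module.End.mul_apply, gu, gv, hu', hv']
  · simp [sq, Module.End.mul_apply, gu, gv, hu', hv']

end Module.End

section Representation
variable {G V : Type*} [Group G] [AddCommGroup V] [DistribMulAction G V] {l : ℕ} [Fact l.Prime]
  [Module (ZMod l) V]

/-- If a group acts on a group `V` of order `l²` and exponent `l` and some element acts with order
`l`, then there is a stable line or some element acts as `-1`. -/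
theorem exists_stable_addSubgroup_or_neg (hV : Nat.card V = l ^ 2) {g : G}
    (hg : ∀ v : V, g ^ l • v = v) (hg1 : ∃ v : V, g • v ≠ v) :
    (∃ C : AddSubgroup V, Nat.card C = l ∧ ∀ k : G, ∀ c ∈ C, k • c ∈ C) ∨
      ∃ w : G, ∀ v : V, w • v = -v := by
  classical
  have hl0 := (Fact.out : l.Prime)
  have : Finite V := Nat.finite_of_card_ne_zero (by rw [hV]; exact pow_ne_zero 2 hl0.ne_zero)
  have : FiniteDimensional (ZMod l) V := Module.Finite.of_finite
  have hdim : Module.finrank (ZMod l) V = 2 := by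
    have := Module.natCard_eq_pow_finrank (K := ZMod l) (V := V)
    rw [hV, Nat.card_zmod] at this
    exact (Nat.pow_right_injective hl0.two_le this).symm
  have : Nontrivial V := Module.nontrivial_of_finrank_pos (R := ZMod l) (by omega)
  let ρ : G →* Module.End (ZMod l) V :=
    { toFun := fun k ↦ (DistribSMul.toAddMonoidHom V k).toZModLinearMap l
      map_one' := LinearMap.ext fun v ↦ show (1 : G) • v = v from one_smul G v
      map_mul' := fun a b ↦ LinearMap.ext fun v ↦
        show (a * b) • v = a • b • v from mul_smul a b v }
  have hρ (k : G) (v : V) : ρ k v = k • v := rfl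
  have hchar : CharP (Module.End (ZMod l) V) l :=
    charP_of_injective_algebraMap (FaithfulSMul.algebraMap_injective (ZMod l) _) l
  -- In characteristic `l` the `l`-th power of `ρ k - 1` is `ρ k ^ l - 1 = 0`, and a nilpotent
  -- endomorphism of a plane has square zero.
  have key {k : G} (hk : ρ k ^ l = 1) : (ρ k - 1) ^ 2 = 0 := by
    apply Module.End.sq_eq_zero_of_isNilpotent hdim
    refine ⟨l, ?_⟩
    rw [sub_pow_expChar_of_commute _ (Commute.one_right _), hk, one_pow, sub_self]
  have hg' : ρ g ^ l = 1 := by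
    rw [← map_pow]
    ext v
    exact hg v
  have hg1' : ρ g - 1 ≠ 0 := by
    obtain ⟨v, hv⟩ := hg1
    intro h
    exact hv (sub_eq_zero.1 (congrArg (fun f : Module.End (ZMod l) V ↦ f v) h))
  -- Either every conjugate of `g` has the same axis, which is then a stable line, or two
  -- transvections with different axes produce `-1`.
  by_cases hall : ∀ k : G, LinearMap.ker (ρ (k * g * k⁻¹) - 1) = LinearMap.ker (ρ g - 1)
  · left
    refine ⟨(LinearMap.ker (ρ g - 1)).toAddSubgroup, ?_, fun k c hc ↦ ?_⟩
    · have := Module.natCard_eq_pow_finrank (K := ZMod l) (V := LinearMap.ker (ρ g - 1))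
      rw [Module.End.finrank_ker_of_sq_eq_zero hdim (key hg') hg1', Nat.card_zmod, pow_one] at this
      exact this
    · have hc' : g • c = c := sub_eq_zero.1 hc
      change k • c ∈ LinearMap.ker (ρ g - 1)
      rw [← hall k]
      refine sub_eq_zero.2 ?_
      change (k * g * k⁻¹) • k • c = k • c
      rw [smul_smul, inv_mul_cancel_right, mul_smul, hc']
  · right
    push Not at hall
    obtain ⟨k, hk⟩ := hall
    have hk' : ρ (k * g * k⁻¹) ^ l = 1 := by
      rw [← map_pow, conj_pow, map_mul, map_mul, map_pow, hg', mul_one, ← map_mul, mul_inv_cancel,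
        map_one]
    have hk1 : ρ (k * g * k⁻¹) - 1 ≠ 0 := by
      intro h
      rw [sub_eq_zero] at h
      apply hg1'
      rw [sub_eq_zero]
      have := congrArg (fun z ↦ ρ k⁻¹ * z * ρ k) h
      simpa [← map_mul, mul_assoc] using this
    obtain ⟨a, b, h⟩ := Module.End.exists_sq_eq_neg_one hdim
      (fun x ↦ ⟨x.val, ZMod.natCast_zmod_val x⟩) (key hg') (key hk') hg1' hk1 hk.symm
    rw [add_sub_cancel, add_sub_cancel, ← map_pow, ← map_pow, ← map_mul, ← map_mul, ← map_pow] at h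
    exact ⟨_, fun v ↦ congrArg (fun f : Module.End (ZMod l) V ↦ f v) h⟩

end Representation

/-! ### A group acting on a torsor under the `l`-torsion -/

section Torsor
variable {G A : Type*} [Group G] [AddCommGroup A] [DistribMulAction G A] {l : ℕ} {P : A}

lemma smul_nsmul_comm (g : G) (n : ℕ) (R : A) : g • n • R = n • g • R :=
  map_nsmul (DistribSMul.toAddMonoidHom A g) n R

lemma smul_zsmul_comm (g : G) (n : ℤ) (R : A) : g • n • R = n • g • R :=
  map_zsmul (DistribSMul.toAddMonoidHom A g) n R

lemma nsmul_smul_of_fixed (hP : ∀ g : G, g • P = P) {R : A} (hR : l • R = P) (g : G) :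
    l • g • R = P := by
  rw [← smul_nsmul_comm, hR, hP]

/-- Let `s` be the sum of an orbit of size `N`, so that `l s = N P`. If `uN + vl = 1`, then `u s + v
P` is fixed and lies over `P`. -/
lemma exists_fixed_of_coprime_orbit (hP : ∀ g : G, g • P = P) (hl : l.Prime) {R : A}
    (hR : l • R = P) (hfin : (MulAction.orbit G R).Finite)
    (hc : ¬ l ∣ (MulAction.orbit G R).ncard) : ∃ S : A, l • S = P ∧ ∀ g : G, g • S = S := by
  classical
  obtain ⟨u, v, huv⟩ : ∃ u v : ℤ, u * (MulAction.orbit G R).ncard + v * l = 1 := by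
    obtain ⟨u, v, h⟩ := Nat.isCoprime_iff_coprime.2 ((hl.coprime_iff_not_dvd.2 hc).symm)
    exact ⟨u, v, h⟩
  let s := ∑ S ∈ hfin.toFinset, S
  have hs : l • s = (MulAction.orbit G R).ncard • P := by
    rw [Finset.smul_sum, Finset.sum_congr rfl (g := fun _ ↦ P), Finset.sum_const,
      Set.ncard_eq_toFinset_card _ hfin]
    intro S hS
    obtain ⟨g, rfl⟩ := hfin.mem_toFinset.1 hS
    exact nsmul_smul_of_fixed hP hR g
  have hs' (g : G) : g • s = s := by
    rw [Finset.smul_sum]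
    refine Finset.sum_bij (fun S _ ↦ g • S) ?_ ?_ ?_ ?_
    · intro S hS
      rw [hfin.mem_toFinset] at hS ⊢
      exact MulAction.mem_orbit_of_mem_orbit _ hS
    · intro S _ S' _ h
      exact smul_left_cancel g h
    · intro S hS
      refine ⟨g⁻¹ • S, ?_, smul_inv_smul g S⟩
      rw [hfin.mem_toFinset] at hS ⊢
      exact MulAction.mem_orbit_of_mem_orbit _ hS
    · intro S _
      rfl
  refine ⟨u • s + v • P, ?_, fun g ↦ ?_⟩
  · have : l • (u • s + v • P) = u • (l • s) + (v * l) • P := by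
      rw [smul_add, smul_comm l u s, mul_smul, natCast_zsmul, smul_comm l v P]
    rw [this, hs, ← natCast_zsmul, smul_smul, ← add_smul, huv, one_smul]
  · rw [smul_add, smul_zsmul_comm, smul_zsmul_comm, hs', hP]

/-- The cases are governed by the subgroup `M` of translations of the fibre made by elements acting
trivially on the `l`-torsion `V`. When `M` is trivial, the action on the fibre is determined by the
action on `V`. -/
theorem fixed_or_transitive_or_stable (hP : ∀ g : G, g • P = P) (hl : l.Prime)
    (hT : {R : A | l • R = P}.ncard = l ^ 2) :
    (∃ R : A, l • R = P ∧ ∀ g : G, g • R = R) ∨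
      (∀ R S : A, l • R = P → l • S = P → ∃ g : G, g • R = S) ∨
      ∃ C : AddSubgroup A, Nat.card C = l ∧ ∀ g : G, ∀ c ∈ C, g • c ∈ C := by
  classical
  have : Fact l.Prime := ⟨hl⟩
  have hTfin : {R : A | l • R = P}.Finite :=
    Set.finite_of_ncard_ne_zero (by rw [hT]; exact pow_ne_zero 2 hl.ne_zero)
  obtain ⟨R, hR⟩ : {R : A | l • R = P}.Nonempty :=
    Set.nonempty_of_ncard_ne_zero (by rw [hT]; exact pow_ne_zero 2 hl.ne_zero)
  replace hR : l • R = P := hR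
  have hsub {R : A} (hR : l • R = P) : MulAction.orbit G R ⊆ {R : A | l • R = P} := by
    rintro _ ⟨g, rfl⟩
    exact nsmul_smul_of_fixed hP hR g
  have horb {R : A} (hR : l • R = P) : (MulAction.orbit G R).Finite := hTfin.subset (hsub hR)
  by_cases hc : l ∣ (MulAction.orbit G R).ncard
  swap
  · exact Or.inl (exists_fixed_of_coprime_orbit hP hl hR (horb hR) hc)
  let V : AddSubgroup A := (nsmulAddMonoidHom l : A →+ A).ker
  have hVmem (v : A) : v ∈ V ↔ l • v = 0 := Iff.rfl
  have hVstab (g : G) {v : A} (hv : v ∈ V) : g • v ∈ V := by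
    rw [hVmem] at hv ⊢
    rw [← smul_nsmul_comm, hv, smul_zero]
  have hVcard : Nat.card V = l ^ 2 := by
    rw [← hT, ← Nat.card_coe_set_eq]
    refine Nat.card_congr ⟨fun v ↦ ⟨R + v, ?_⟩, fun S ↦ ⟨S - R, ?_⟩, fun v ↦ ?_, fun S ↦ ?_⟩
    · have := v.2
      rw [hVmem] at this
      rw [Set.mem_ofPred_eq, smul_add, hR, this, add_zero]
    · have := S.2
      rw [Set.mem_ofPred_eq] at this
      rw [hVmem, smul_sub, this, hR, sub_self]
    · ext; simp
    · ext; simp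
  have : Finite V := Nat.finite_of_card_ne_zero (by rw [hVcard]; exact pow_ne_zero 2 hl.ne_zero)
  have hsubV {R S : A} (hR : l • R = P) (hS : l • S = P) : S - R ∈ V := by
    rw [hVmem, smul_sub, hS, hR, sub_self]
  let act : DistribMulAction G V :=
    { smul := fun g v ↦ ⟨g • (v : A), hVstab g v.2⟩
      one_smul := fun v ↦ Subtype.ext (one_smul G (v : A))
      mul_smul := fun a b v ↦ Subtype.ext (mul_smul a b (v : A))
      smul_zero := fun g ↦ Subtype.ext (smul_zero g)
      smul_add := fun g v w ↦ Subtype.ext (smul_add g (v : A) w) }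
  have hact (g : G) (v : V) : ((g • v : V) : A) = g • (v : A) := rfl
  -- An element acting trivially on `V` translates the whole fibre by one vector, independent of the
  -- base point.
  have htriv {g : G} (hg : ∀ v ∈ V, g • v = v) {S : A} (hS : l • S = P) :
      g • S - S = g • R - R := by
    have := hg _ (hsubV hR hS)
    rw [smul_sub] at this
    rw [sub_eq_sub_iff_sub_eq_sub, this]
  let M : AddSubgroup A :=
    { carrier := {t | ∃ g : G, (∀ v ∈ V, g • v = v) ∧ g • R - R = t}
      zero_mem' := ⟨1, fun v _ ↦ one_smul G v, by simp⟩
      add_mem' := by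
        rintro _ _ ⟨a, ha, rfl⟩ ⟨b, hb, rfl⟩
        refine ⟨a * b, fun v hv ↦ by rw [mul_smul, hb v hv, ha v hv], ?_⟩
        have := htriv ha (nsmul_smul_of_fixed hP hR b)
        rw [← this, mul_smul, sub_add_sub_cancel]
      neg_mem' := by
        rintro _ ⟨a, ha, rfl⟩
        have ha' : ∀ v ∈ V, a⁻¹ • v = v := fun v hv ↦ by rw [inv_smul_eq_iff, ha v hv]
        refine ⟨a⁻¹, ha', ?_⟩
        rw [← htriv ha' (nsmul_smul_of_fixed hP hR a), inv_smul_smul, neg_sub] }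
  have hMV : M ≤ V := by
    rintro _ ⟨a, -, rfl⟩
    exact hsubV hR (nsmul_smul_of_fixed hP hR a)
  have hMstab (k : G) {c : A} (hc : c ∈ M) : k • c ∈ M := by
    obtain ⟨a, ha, rfl⟩ := hc
    have ha' : ∀ v ∈ V, (k * a * k⁻¹) • v = v := fun v hv ↦ by
      rw [mul_smul, mul_smul, ha _ (hVstab _ hv), smul_inv_smul]
    refine ⟨k * a * k⁻¹, ha', ?_⟩
    rw [← htriv ha' (nsmul_smul_of_fixed hP hR k), smul_sub, smul_smul, smul_smul,
      inv_mul_cancel_right]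
  have hMcard : Nat.card M ∣ l ^ 2 := hVcard ▸ AddSubgroup.card_dvd_of_le hMV
  obtain ⟨i, hi, hMi⟩ := (Nat.dvd_prime_pow hl).1 hMcard
  have hi3 : i = 0 ∨ i = 1 ∨ i = 2 := by omega
  rcases hi3 with rfl | rfl | rfl
  · have hM : M = ⊥ := AddSubgroup.card_eq_one.1 hMi
    have hfix {g : G} (hg : ∀ v ∈ V, g • v = v) {S : A} (hS : l • S = P) : g • S = S := by
      have : g • R - R ∈ M := ⟨g, hg, rfl⟩
      rw [← htriv hg hS, hM, AddSubgroup.mem_bot, sub_eq_zero] at this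
      exact this
    -- Here `M = 0`. The prime two is treated apart, since the argument with `-1` divides by two
    -- modulo `l`.
    rcases hl.eq_two_or_odd' with rfl | hodd
    · have hle : (MulAction.orbit G R).ncard ≤ 4 := by
        simpa [hT] using Set.ncard_le_ncard (hsub hR) hTfin
      have hpos : 0 < (MulAction.orbit G R).ncard :=
        (Set.ncard_pos (horb hR)).2 (MulAction.nonempty_orbit R)
      -- The orbit size is even, positive and at most four. Two points of an orbit of size two can
      -- only be swapped or fixed, so their difference spans a stable line.
      rcases (by omega : (MulAction.orbit G R).ncard = 4 ∨ (MulAction.orbit G R).ncard = 2)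
        with h4 | h2
      · refine Or.inr (Or.inl fun S S' hS hS' ↦ ?_)
        have := Set.eq_of_subset_of_ncard_le (hsub hR) (by rw [hT, h4]; norm_num) hTfin
        have h₁ : S ∈ MulAction.orbit G R := this ▸ hS
        have h₂ : S' ∈ MulAction.orbit G R := this ▸ hS'
        obtain ⟨a, rfl⟩ := h₁
        obtain ⟨b, rfl⟩ := h₂
        exact ⟨b * a⁻¹, by simp [mul_smul]⟩
      · obtain ⟨a, b, hab, horb⟩ := Set.ncard_eq_two.1 h2
        have ha : a ∈ MulAction.orbit G R := by simp [horb]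
        have hb : b ∈ MulAction.orbit G R := by simp [horb]
        have hu : a - b ∈ V := hsubV (hsub hR hb) (hsub hR ha)
        refine Or.inr (Or.inr ⟨AddSubgroup.zmultiples (a - b), ?_, fun g c hc ↦ ?_⟩)
        · rw [Nat.card_zmultiples]
          exact addOrderOf_eq_prime hu (sub_ne_zero.2 hab)
        · obtain ⟨n, rfl⟩ := hc
          change g • n • (a - b) ∈ _
          rw [smul_zsmul_comm]
          refine AddSubgroup.zsmul_mem _ ?_ n
          have ha' : g • a ∈ MulAction.orbit G R := MulAction.mem_orbit_of_mem_orbit _ ha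
          have hb' : g • b ∈ MulAction.orbit G R := MulAction.mem_orbit_of_mem_orbit _ hb
          have hne : g • a ≠ g • b := fun h ↦ hab (smul_left_cancel g h)
          rw [horb] at ha' hb'
          rw [smul_sub]
          rcases ha' with ha' | ha' <;> rcases hb' with hb' | hb'
          · exact (hne (ha'.trans hb'.symm)).elim
          · rw [ha', hb']
            exact AddSubgroup.mem_zmultiples _
          · rw [ha', hb', ← neg_sub a b]
            exact (AddSubgroup.zmultiples (a - b)).neg_mem (AddSubgroup.mem_zmultiples _)
          · exact (hne (ha'.trans hb'.symm)).elim
    · let σ := MulAction.toPermHom G V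
      have hσ {g : G} (hg : σ g = 1) : ∀ v ∈ V, g • v = v := fun v hv ↦ by
        have := congrArg (fun f : Equiv.Perm V ↦ ((f ⟨v, hv⟩ : V) : A)) hg
        exact this
      -- The kernel of the action on `V` fixes `R`, so the orbit size, which is the index of the
      -- stabilizer, divides the order of the image. Cauchy's theorem then gives an element of order
      -- `l` in the image.
      have hdvd : l ∣ Nat.card σ.range := by
        rw [← Subgroup.index_ker]
        refine dvd_trans ?_ (Subgroup.index_dvd_of_le (K := MulAction.stabilizer G R) ?_)
        · rwa [MulAction.index_stabilizer]
        · intro g hg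
          exact hfix (hσ hg) hR
      obtain ⟨⟨τ, hτ⟩, hg⟩ := exists_prime_orderOf_dvd_card' l hdvd
      rw [Subgroup.orderOf_mk] at hg
      obtain ⟨g, rfl⟩ := hτ
      have hg1 : ∃ v : V, g • v ≠ v := by
        by_contra! h
        have : σ g = 1 := Equiv.ext h
        rw [this, orderOf_one] at hg
        exact hl.one_lt.ne hg
      have hgl (v : V) : g ^ l • v = v := by
        have : σ (g ^ l) = 1 := by rw [map_pow, ← hg, pow_orderOf_eq_one]
        exact Subtype.ext (hσ this v v.2)
      let : Module (ZMod l) V := AddCommGroup.zmodModule fun v ↦ Subtype.ext v.2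
      rcases exists_stable_addSubgroup_or_neg hVcard hgl hg1 with
        ⟨C, hC, hCs⟩ | ⟨w, hw⟩
      · refine Or.inr (Or.inr ⟨C.map V.subtype, ?_, ?_⟩)
        · rw [Nat.card_congr (AddSubgroup.equivMapOfInjective C _ V.subtype_injective).toEquiv.symm,
            hC]
        · rintro k _ ⟨c, hc, rfl⟩
          exact ⟨k • c, hCs k c hc, rfl⟩
      · left
        have hw' {v : A} (hv : v ∈ V) : w • v = -v := congrArg Subtype.val (hw ⟨v, hv⟩)
        obtain ⟨m, hm⟩ := hodd
        have hc : w • R - R ∈ V := hsubV hR (nsmul_smul_of_fixed hP hR w)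
        -- As `l = 2m + 1`, the integer `m + 1` is one half modulo `l`: this is the midpoint of `R`
        -- and `w R`, hence a fixed point of `w`.
        have hS : l • (R + (m + 1) • (w • R - R)) = P := by
          have : (m + 1) • (w • R - R) ∈ V := nsmul_mem hc _
          rw [hVmem] at this
          rw [smul_add, hR, this, add_zero]
        have hwS : w • (R + (m + 1) • (w • R - R)) = R + (m + 1) • (w • R - R) := by
          have h0 : l • (w • R - R) = 0 := hc
          rw [smul_add, hw' (nsmul_mem hc _)]
          have : w • R - R = (2 * (m + 1)) • (w • R - R) := by
            rw [show 2 * (m + 1) = l + 1 by omega, add_smul, h0, zero_add, one_smul]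
          rw [mul_smul, two_smul] at this
          rw [← sub_eq_zero] at this ⊢
          rw [← this]
          abel
        refine ⟨_, hS, fun k ↦ ?_⟩
        generalize R + (m + 1) • (w • R - R) = S at hS hwS ⊢
        have hkS := nsmul_smul_of_fixed hP hS k
        -- Since `-1` is central, `w` and its conjugate by `k` act alike on `V`, hence alike on the
        -- fibre because `M = 0`. So `w` fixes `k S` too.
        have h₁ : (w⁻¹ * (k * w * k⁻¹)) • k • S = k • S := by
          refine hfix (fun v hv ↦ ?_) hkS
          rw [mul_smul, mul_smul, mul_smul, hw' (hVstab _ hv), smul_neg, smul_inv_smul,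
            inv_smul_eq_iff, hw' hv]
        rw [mul_smul, smul_smul _ k, inv_mul_cancel_right, inv_smul_eq_iff, mul_smul, hwS] at h₁
        -- This difference is both fixed and negated by `w`, so it is killed by `2` and by the odd
        -- number `l`.
        have h₂ : k • S - S ∈ V := hsubV hS hkS
        have h₃ := hw' h₂
        rw [smul_sub, ← h₁, hwS, ← add_eq_zero_iff_eq_neg, ← two_nsmul] at h₃
        have h₄ : l • (k • S - S) = 0 := h₂
        rw [hm, add_smul, mul_comm, mul_smul, h₃, smul_zero, zero_add, one_smul] at h₄
        exact sub_eq_zero.1 h₄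
  · exact Or.inr (Or.inr ⟨M, by rw [hMi, pow_one], fun g c hc ↦ hMstab g hc⟩)
  · refine Or.inr (Or.inl fun S S' hS hS' ↦ ?_)
    have hMV' : M = V := AddSubgroup.eq_of_le_of_card_ge hMV (by rw [hMi, hVcard])
    obtain ⟨g, hg, hg'⟩ : S' - S ∈ M := hMV' ▸ hsubV hS hS'
    exact ⟨g, by rw [← htriv hg hS] at hg'; exact sub_left_injective hg'⟩

end Torsor

/-! ### The order of the pole at infinity -/

section
open scoped Polynomial.Bivariate WithZero

namespace WeierstrassCurve.Affine

namespace CoordinateRing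
variable {R : Type*} [CommRing R] [IsDomain R] (W : Affine R)

instance : Module.Finite R[X] W.CoordinateRing := .of_basis (CoordinateRing.basis W)

lemma degree_norm_aeval_add (p q : R[X]) :
    (Algebra.norm R[X] (aeval (x W) p + aeval (x W) q * y W)).degree =
      max (2 • p.degree) (2 • q.degree + 3) := by
  rw [← degree_norm_smul_basis (W' := W), Algebra.smul_def, Algebra.smul_def, mul_one,
    algebraMap_polynomial, algebraMap_polynomial]
  rfl

lemma degree_norm_add_le (a b : W.CoordinateRing) : (Algebra.norm R[X] (a + b)).degree ≤
    max (Algebra.norm R[X] a).degree (Algebra.norm R[X] b).degree := by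
  obtain ⟨p, q, rfl⟩ := exists_eq W a
  obtain ⟨r, s, rfl⟩ := exists_eq W b
  have : aeval (x W) p + aeval (x W) q * y W + (aeval (x W) r + aeval (x W) s * y W) =
      aeval (x W) (p + r) + aeval (x W) (q + s) * y W := by rw [map_add, map_add]; ring
  rw [this, degree_norm_aeval_add, degree_norm_aeval_add, degree_norm_aeval_add]
  have mono (n : WithBot ℕ) {u v : WithBot ℕ} (h : u ≤ v) : 2 • u + n ≤ 2 • v + n := by
    rw [two_nsmul, two_nsmul]
    gcongr
  have mono' {u v w : WithBot ℕ} (n : WithBot ℕ) (h : u ≤ max v w) :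
      2 • u + n ≤ max (2 • v + n) (2 • w + n) := by
    rcases le_max_iff.1 h with h | h
    · exact le_max_of_le_left (mono n h)
    · exact le_max_of_le_right (mono n h)
  have h₁ := mono' 0 (degree_add_le p r)
  have h₂ := mono' 3 (degree_add_le q s)
  simp only [add_zero] at h₁
  refine max_le (h₁.trans ?_) (h₂.trans ?_)
  · exact max_le_max (le_max_left _ _) (le_max_left _ _)
  · exact max_le_max (le_max_right _ _) (le_max_right _ _)

lemma degree_norm_lt_iff (p q : R[X]) (n : ℕ) :
    (Algebra.norm R[X] (aeval (x W) p + aeval (x W) q * y W)).degree < n ↔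
      (∀ i, n ≤ 2 * i → p.coeff i = 0) ∧ ∀ i, n ≤ 2 * i + 3 → q.coeff i = 0 := by
  have key (p : R[X]) (m : ℕ) : 2 • p.degree + m < n ↔ ∀ i, n ≤ 2 * i + m → p.coeff i = 0 := by
    by_cases hp : p = 0
    · simp [hp]
    rw [degree_eq_natDegree hp]
    constructor
    · intro h i hi
      have h' : 2 * p.natDegree + m < n := by
        rw [two_nsmul] at h
        rw [two_mul]
        exact_mod_cast h
      exact coeff_eq_zero_of_natDegree_lt (by omega)
    · intro h
      by_contra h'
      have h'' : n ≤ 2 * p.natDegree + m := by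
        rw [two_nsmul, not_lt] at h'
        rw [two_mul]
        exact_mod_cast h'
      exact hp (leadingCoeff_eq_zero.1 (h _ h''))
  have h₁ := key p 0
  have h₂ := key q 3
  rw [Nat.cast_zero, add_zero] at h₁
  rw [degree_norm_aeval_add, max_lt_iff, h₁, ← h₂]
  rfl

lemma norm_ne_zero {a : W.CoordinateRing} (ha : a ≠ 0) : Algebra.norm R[X] a ≠ 0 := by
  rwa [Ne, Algebra.norm_eq_zero_iff]

open scoped Classical in
/-- The pole order at infinity, as a valuation of the coordinate ring. -/
noncomputable def valInf : Valuation W.CoordinateRing ℤᵐ⁰ where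
  toFun a := if a = 0 then 0 else WithZero.exp ((Algebra.norm R[X] a).natDegree : ℤ)
  map_zero' := by simp
  map_one' := by simp
  map_mul' a b := by
    by_cases ha : a = 0
    · simp [ha]
    by_cases hb : b = 0
    · simp [hb]
    rw [if_neg ha, if_neg hb, if_neg (mul_ne_zero ha hb), map_mul,
      natDegree_mul (norm_ne_zero W ha) (norm_ne_zero W hb), Nat.cast_add, WithZero.exp_add]
  map_add_le_max' a b := by
    by_cases ha : a = 0
    · simp [ha]
    by_cases hb : b = 0
    · simp [hb]
    by_cases hab : a + b = 0
    · simp [hab]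
    rw [if_neg ha, if_neg hb, if_neg hab]
    have := degree_norm_add_le W a b
    rw [degree_eq_natDegree (norm_ne_zero W ha), degree_eq_natDegree (norm_ne_zero W hb),
      degree_eq_natDegree (norm_ne_zero W hab)] at this
    rcases le_max_iff.1 this with h | h
    · exact le_max_of_le_left (WithZero.exp_le_exp.2 (by exact_mod_cast h))
    · exact le_max_of_le_right (WithZero.exp_le_exp.2 (by exact_mod_cast h))

lemma valInf_apply {a : W.CoordinateRing} (ha : a ≠ 0) :
    valInf W a = WithZero.exp ((Algebra.norm R[X] a).natDegree : ℤ) := if_neg ha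

lemma valInf_ne_zero {a : W.CoordinateRing} (ha : a ≠ 0) : valInf W a ≠ 0 := by
  rw [valInf_apply W ha]
  exact WithZero.exp_ne_zero

-- The cofactor is the conjugate of `a` under `y ↦ -y - a₁x - a₃`. It serves to replace a
-- denominator by a polynomial in `x`.
omit [IsDomain R] in
lemma algebraMap_norm_eq_mul (a : W.CoordinateRing) :
    ∃ b, algebraMap R[X] W.CoordinateRing (Algebra.norm R[X] a) = a * b := by
  obtain ⟨p, q, rfl⟩ := exists_smul_basis_eq a
  refine ⟨mk W (C p + C q * (-(Y : R[X][Y]) - C (C W.a₁ * X + C W.a₃))), ?_⟩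
  refine (coe_norm_smul_basis p q).trans ?_
  rw [map_mul]
  congr 1
  simp only [smul, map_add, map_mul, mul_one]

end CoordinateRing

namespace FunctionField

section Lift
variable {R S : Type*} [CommRing R] [IsDomain R] {W : Affine R} [Field S] (f : R →+* S) {s t : S}
  (h : (W.map f).toAffine.Equation s t) (hs : ∀ p : R[X], p ≠ 0 → p.eval₂ f s ≠ 0)

include hs in
lemma _root_.WeierstrassCurve.Affine.CoordinateRing.lift_ne_zero {a : W.CoordinateRing}
    (ha : a ≠ 0) : CoordinateRing.lift f s t h a ≠ 0 := by
  obtain ⟨b, hb⟩ := CoordinateRing.algebraMap_norm_eq_mul W a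
  intro h0
  apply hs _ (CoordinateRing.norm_ne_zero W ha)
  rw [← CoordinateRing.lift_aeval f h, ← CoordinateRing.algebraMap_polynomial, hb, map_mul, h0,
    zero_mul]

/-- The homomorphism from the function field given by a generic point over an extension. -/
noncomputable def lift : W.FunctionField →+* S :=
  IsLocalization.lift (M := nonZeroDivisors W.CoordinateRing) (g := CoordinateRing.lift f s t h)
    fun a ↦ (CoordinateRing.lift_ne_zero f h hs (nonZeroDivisors.ne_zero a.2)).isUnit

lemma lift_coe (a : W.CoordinateRing) : lift f h hs (algebraMap _ W.FunctionField a) =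
    CoordinateRing.lift f s t h a := IsLocalization.lift_eq _ a

@[simp] lemma lift_x : lift f h hs (x W) = s := by rw [x, lift_coe, CoordinateRing.lift_x]

@[simp] lemma lift_y : lift f h hs (y W) = t := by rw [y, lift_coe, CoordinateRing.lift_y]

@[simp] lemma lift_algebraMap (r : R) : lift f h hs (algebraMap R W.FunctionField r) = f r := by
  rw [IsScalarTower.algebraMap_apply R W.CoordinateRing, lift_coe, CoordinateRing.lift_algebraMap]

omit [IsDomain R] in
lemma hom_ext {S : Type*} [CommRing S] {φ ψ : W.FunctionField →+* S}
    (hC : ∀ r, φ (algebraMap R W.FunctionField r) = ψ (algebraMap R W.FunctionField r))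
    (hx : φ (x W) = ψ (x W)) (hy : φ (y W) = ψ (y W)) : φ = ψ := by
  refine IsLocalization.ringHom_ext (nonZeroDivisors W.CoordinateRing) ?_
  refine CoordinateRing.hom_ext (fun r ↦ ?_) hx hy
  simpa [IsScalarTower.algebraMap_apply R W.CoordinateRing W.FunctionField] using hC r

end Lift

variable {k : Type*} [Field k] (W : Affine k)

/-- The pole order at infinity, as a valuation of the function field. -/
noncomputable def valInf : Valuation W.FunctionField ℤᵐ⁰ :=
  (CoordinateRing.valInf W).extendToLocalization (S := nonZeroDivisors W.CoordinateRing)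
    (fun _ ha h ↦ CoordinateRing.valInf_ne_zero W (nonZeroDivisors.ne_zero ha) h) W.FunctionField

lemma valInf_coe (a : W.CoordinateRing) :
    valInf W (algebraMap _ _ a) = CoordinateRing.valInf W a :=
  Valuation.extendToLocalization_apply_map_apply ..

lemma exists_eq_div (f : W.FunctionField) : ∃ a b : W.CoordinateRing, b ≠ 0 ∧
    f = algebraMap _ _ a / algebraMap _ _ b := by
  obtain ⟨a, b, hb, h⟩ := IsFractionRing.div_surjective (A := W.CoordinateRing) f
  exact ⟨a, b, nonZeroDivisors.ne_zero hb, h.symm⟩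

lemma coe_ne_zero {a : W.CoordinateRing} (ha : a ≠ 0) :
    algebraMap W.CoordinateRing W.FunctionField a ≠ 0 := by
  rwa [Ne, FaithfulSMul.algebraMap_eq_zero_iff]

lemma valInf_polynomial {p : k[X]} (hp : p ≠ 0) :
    valInf W (aeval (x W) p) = WithZero.exp (2 * p.natDegree : ℤ) := by
  have h := CoordinateRing.degree_norm_aeval_add W p 0
  rw [map_zero, zero_mul, add_zero] at h
  have h0 : aeval (CoordinateRing.x W) p ≠ 0 := by
    rw [← CoordinateRing.algebraMap_polynomial]
    rwa [Ne, FaithfulSMul.algebraMap_eq_zero_iff]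
  rw [← algebraMap_aeval, valInf_coe, CoordinateRing.valInf_apply W h0]
  have : (Algebra.norm k[X] (aeval (CoordinateRing.x W) p)).natDegree = 2 * p.natDegree := by
    apply natDegree_eq_of_degree_eq_some
    rw [h, degree_eq_natDegree hp]
    simp
  rw [this]
  push_cast
  rfl

@[simp] lemma valInf_x : valInf W (x W) = WithZero.exp 2 := by
  simpa using valInf_polynomial W (p := X) X_ne_zero

lemma valInf_algebraMap {c : k} (hc : c ≠ 0) : valInf W (algebraMap k _ c) = 1 := by
  simpa using valInf_polynomial W (p := C c) (C_ne_zero.2 hc)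

lemma valInf_algebraMap_le (c : k) : valInf W (algebraMap k _ c) ≤ 1 := by
  by_cases hc : c = 0
  · simp [hc]
  · exact (valInf_algebraMap W hc).le

@[simp] lemma valInf_y : valInf W (y W) = WithZero.exp 3 := by
  have h := CoordinateRing.degree_norm_aeval_add W 0 1
  rw [map_zero, zero_add, map_one, one_mul] at h
  have h0 : CoordinateRing.y W ≠ 0 := by
    intro h0
    rw [h0, Algebra.norm_zero] at h
    simp at h
  rw [y, valInf_coe, CoordinateRing.valInf_apply W h0]
  have : (Algebra.norm k[X] (CoordinateRing.y W)).natDegree = 3 := by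
    apply natDegree_eq_of_degree_eq_some
    rw [h]
    simp
  rw [this]
  rfl

/-- A coordinate function with at most a simple pole at infinity is constant. -/
lemma exists_const_of_valInf_coe {a : W.CoordinateRing}
    (h : valInf W (algebraMap _ _ a) ≤ WithZero.exp 1) : ∃ c : k, a = algebraMap k _ c := by
  by_cases ha : a = 0
  · exact ⟨0, by rw [ha, map_zero]⟩
  rw [valInf_coe, CoordinateRing.valInf_apply W ha, WithZero.exp_le_exp] at h
  have h2 : (Algebra.norm k[X] a).degree < (2 : ℕ) := by
    rw [degree_eq_natDegree (CoordinateRing.norm_ne_zero W ha)]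
    have : (Algebra.norm k[X] a).natDegree < 2 := by omega
    exact_mod_cast this
  obtain ⟨p, q, rfl⟩ := CoordinateRing.exists_eq W a
  rw [CoordinateRing.degree_norm_lt_iff] at h2
  refine ⟨p.coeff 0, ?_⟩
  have hq : q = 0 := by
    ext i
    exact h2.2 i (by omega)
  have hp : p = C (p.coeff 0) := by
    ext i
    rcases i with _ | i
    · simp
    · rw [h2.1 _ (by omega), coeff_C_succ]
  rw [hq, map_zero, zero_mul, add_zero]
  nth_rw 1 [hp]
  rw [aeval_C]

/-- The residue field at infinity is the constant field: if numerator and denominator have the same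
pole order, `c` is the quotient of their leading coefficients. -/
lemma exists_valInf_sub_lt_one {f : W.FunctionField} (hf : valInf W f ≤ 1) :
    ∃ c : k, valInf W (f - algebraMap k _ c) < 1 := by
  obtain ⟨a, b, hb, rfl⟩ := exists_eq_div W f
  have hb' : valInf W (algebraMap _ _ b) ≠ 0 := (Valuation.ne_zero_iff _).2 (coe_ne_zero W hb)
  rcases hf.lt_or_eq with hlt | heq
  · exact ⟨0, by rwa [map_zero, sub_zero]⟩
  rw [map_div₀, div_eq_one_iff_eq hb', valInf_coe, valInf_coe] at heq
  have ha : a ≠ 0 := by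
    rintro rfl
    rw [map_zero] at heq
    exact CoordinateRing.valInf_ne_zero W hb heq.symm
  rw [CoordinateRing.valInf_apply W ha, CoordinateRing.valInf_apply W hb] at heq
  have heq' : (Algebra.norm k[X] a).natDegree = (Algebra.norm k[X] b).natDegree := by
    exact_mod_cast WithZero.exp_injective heq
  suffices h : ∃ c : k, (Algebra.norm k[X] (a - algebraMap k _ c * b)).degree <
      (Algebra.norm k[X] b).natDegree by
    obtain ⟨c, hc⟩ := h
    refine ⟨c, ?_⟩
    have e : algebraMap W.CoordinateRing W.FunctionField a / algebraMap _ _ b - algebraMap k _ c =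
        algebraMap _ _ (a - algebraMap k _ c * b) / algebraMap _ _ b := by
      have := coe_ne_zero W hb
      rw [map_sub, map_mul, ← IsScalarTower.algebraMap_apply]
      field_simp
    rw [e, map_div₀, div_lt_one₀ (zero_lt_iff.2 hb'), valInf_coe, valInf_coe]
    by_cases h0 : a - algebraMap k _ c * b = 0
    · rw [h0, map_zero]
      exact zero_lt_iff.2 (CoordinateRing.valInf_ne_zero W hb)
    · rw [CoordinateRing.valInf_apply W h0, CoordinateRing.valInf_apply W hb, WithZero.exp_lt_exp]
      rw [degree_eq_natDegree (CoordinateRing.norm_ne_zero W h0)] at hc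
      exact_mod_cast hc
  have h₁ : (Algebra.norm k[X] a).degree < ((Algebra.norm k[X] b).natDegree + 1 : ℕ) := by
    rw [degree_eq_natDegree (CoordinateRing.norm_ne_zero W ha), heq']
    exact_mod_cast Nat.lt_succ_self _
  have h₂ : (Algebra.norm k[X] b).degree < ((Algebra.norm k[X] b).natDegree + 1 : ℕ) := by
    rw [degree_eq_natDegree (CoordinateRing.norm_ne_zero W hb)]
    exact_mod_cast Nat.lt_succ_self _
  have h₃ : ¬ (Algebra.norm k[X] b).degree < (Algebra.norm k[X] b).natDegree := by
    rw [degree_eq_natDegree (CoordinateRing.norm_ne_zero W hb)]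
    exact lt_irrefl _
  generalize (Algebra.norm k[X] b).natDegree = n at h₁ h₂ h₃
  obtain ⟨p, q, rfl⟩ := CoordinateRing.exists_eq W a
  obtain ⟨r, s, rfl⟩ := CoordinateRing.exists_eq W b
  have e (c : k) : aeval (CoordinateRing.x W) p + aeval (CoordinateRing.x W) q * CoordinateRing.y W -
      algebraMap k _ c * (aeval (CoordinateRing.x W) r + aeval (CoordinateRing.x W) s *
      CoordinateRing.y W) = aeval (CoordinateRing.x W) (p - C c * r) +
        aeval (CoordinateRing.x W) (q - C c * s) * CoordinateRing.y W := by
    simp only [map_sub, map_mul, aeval_C]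
    ring
  simp only [e, CoordinateRing.degree_norm_lt_iff, coeff_sub, coeff_C_mul] at h₁ h₂ h₃ ⊢
  -- The parity of the pole order decides whether the leading term of `r + s y` comes from `r` or
  -- from `s`; the coefficient of the numerator at the same place is compared with it.
  by_cases hr : ∃ i, n ≤ 2 * i ∧ r.coeff i ≠ 0
  · obtain ⟨i, hi, hri⟩ := hr
    have hni : n = 2 * i := by
      by_contra hne
      exact hri (h₂.1 i (by omega))
    refine ⟨p.coeff i / r.coeff i, fun j hj ↦ ?_, fun j hj ↦ ?_⟩
    · rcases eq_or_ne j i with rfl | hji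
      · rw [div_mul_cancel₀ _ hri, sub_self]
      · rw [h₁.1 j (by omega), h₂.1 j (by omega), mul_zero, sub_zero]
    · rw [h₁.2 j (by omega), h₂.2 j (by omega), mul_zero, sub_zero]
  · push Not at hr
    have : ∃ i, n ≤ 2 * i + 3 ∧ s.coeff i ≠ 0 := by
      by_contra! hs
      exact h₃ ⟨hr, hs⟩
    obtain ⟨i, hi, hsi⟩ := this
    have hni : n = 2 * i + 3 := by
      by_contra hne
      exact hsi (h₂.2 i (by omega))
    refine ⟨q.coeff i / s.coeff i, fun j hj ↦ ?_, fun j hj ↦ ?_⟩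
    · rw [h₁.1 j (by omega), h₂.1 j (by omega), mul_zero, sub_zero]
    · rcases eq_or_ne j i with rfl | hji
      · rw [div_mul_cancel₀ _ hsi, sub_self]
      · rw [h₁.2 j (by omega), h₂.2 j (by omega), mul_zero, sub_zero]

lemma exists_valInf_sub_lt {f g : W.FunctionField} (hg : g ≠ 0) (h : valInf W f ≤ valInf W g) :
    ∃ c : k, valInf W (f - algebraMap k _ c * g) < valInf W g := by
  have hg' : valInf W g ≠ 0 := (Valuation.ne_zero_iff _).2 hg
  obtain ⟨c, hc⟩ := exists_valInf_sub_lt_one W (f := f / g) (by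
    rw [map_div₀]
    exact div_le_one_of_le₀ h zero_le)
  refine ⟨c, ?_⟩
  have : f - algebraMap k _ c * g = (f / g - algebraMap k _ c) * g := by
    rw [sub_mul, div_mul_cancel₀ _ hg]
  rw [this, map_mul]
  exact mul_lt_of_lt_one_left (zero_lt_iff.2 hg') hc

end FunctionField
end WeierstrassCurve.Affine

end

/-! ### The generic point and its translates by constant points -/

open scoped WithZero

set_option linter.unusedSectionVars false

namespace WeierstrassCurve

instance baseChange_isElliptic {R A : Type*} [CommRing R] [CommRing A] [Algebra R A]
    (E : WeierstrassCurve R) [E.IsElliptic] : (E⁄A).IsElliptic :=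
  inferInstanceAs (E.map (algebraMap R A)).IsElliptic

namespace Affine

namespace Point
section Chord
variable {F : Type*} [Field F] {W : Affine F} [DecidableEq F] {P Q : W.Point}

/-- The curve equation eliminates the square of `y(P)`, so the right side is affine linear in the
coordinates of `P`. For `P` generic its pole order is at most three, against four for the square on
the left. -/
lemma xCoord_add_sub_mul_sq (hP : P ≠ 0) (hQ : Q ≠ 0) (h : P.xCoord ≠ Q.xCoord) :
    ((P + Q).xCoord - Q.xCoord) * (P.xCoord - Q.xCoord) ^ 2 = -Q.psiTwo * P.yCoord +
      (3 * Q.xCoord ^ 2 + 2 * W.a₂ * Q.xCoord + W.a₄ - W.a₁ * Q.yCoord) * P.xCoord +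
      (W.a₆ + Q.yCoord ^ 2 + W.a₁ * Q.xCoord * Q.yCoord - W.a₂ * Q.xCoord ^ 2 -
        2 * Q.xCoord ^ 3) := by
  have h₁ := (equation_iff ..).mp (equation_coord hP)
  have h₀ := sub_ne_zero.mpr h
  rw [xCoord_add hP hQ h, addX, psiTwo]
  field_simp
  linear_combination h₁

lemma yCoord_add_sub_mul (hP : P ≠ 0) (hQ : Q ≠ 0) (h : P.xCoord ≠ Q.xCoord) :
    ((P + Q).yCoord - (-Q).yCoord) * (P.xCoord - Q.xCoord) =
      -((P.yCoord - Q.yCoord) + W.a₁ * (P.xCoord - Q.xCoord)) * ((P + Q).xCoord - Q.xCoord) := by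
  have h₀ := sub_ne_zero.mpr h
  rw [yCoord_add hP hQ h, xCoord_add hP hQ h, yCoord_neg hQ, addY, negY, negAddY, negY, addX]
  field_simp
  ring

omit [DecidableEq F] in
lemma yCoord_sub_mul_yCoord_sub (hP : P ≠ 0) (hQ : Q ≠ 0) :
    (P.yCoord - Q.yCoord) * (P.yCoord - (-Q).yCoord) = (P.xCoord - Q.xCoord) *
      (P.xCoord ^ 2 + P.xCoord * Q.xCoord + Q.xCoord ^ 2 + W.a₂ * (P.xCoord + Q.xCoord) + W.a₄ -
        W.a₁ * P.yCoord) := by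
  have h₁ := (equation_iff ..).mp (equation_coord hP)
  have h₂ := (equation_iff ..).mp (equation_coord hQ)
  rw [yCoord_neg hQ, negY]
  linear_combination h₁ - h₂

omit [DecidableEq F] in
lemma yCoord_sub_yCoord_neg (hQ : Q ≠ 0) : Q.yCoord - (-Q).yCoord = Q.psiTwo := by
  rw [yCoord_neg hQ, negY, psiTwo]
  ring

end Chord

section Map
variable {K F F' : Type*} [Field K] [Field F] [Field F'] [DecidableEq F] [DecidableEq F']
  [Algebra K F] [Algebra K F'] {S : Type*} [CommRing S] [Algebra K S] [Algebra S F] [Algebra S F']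
  [IsScalarTower K S F] [IsScalarTower K S F'] {E : WeierstrassCurve K} (f : F →ₐ[S] F')

@[simp] lemma xCoord_map (P : (E⁄F).toAffine.Point) : (map f P).xCoord = f P.xCoord := by
  rcases P with _ | _
  · exact (_root_.map_zero f).symm
  · rfl

@[simp] lemma yCoord_map (P : (E⁄F).toAffine.Point) : (map f P).yCoord = f P.yCoord := by
  rcases P with _ | _
  · exact (_root_.map_zero f).symm
  · rfl

lemma map_ne_zero {P : (E⁄F).toAffine.Point} (hP : P ≠ 0) : map f P ≠ 0 := fun h ↦
  hP (map_injective f (h.trans (map_zero f).symm))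

end Map
end Point

/-- The function field of the base change of a curve. -/
abbrev FunctionFieldOver {K : Type*} (k : Type*) [Field K] [Field k] [Algebra K k]
    (E : WeierstrassCurve K) : Type _ := (E⁄k).toAffine.FunctionField

/-- The pole order at infinity on the base change of a curve. -/
noncomputable abbrev valOver {K : Type*} (k : Type*) [Field K] [Field k] [Algebra K k]
    (E : WeierstrassCurve K) : Valuation (FunctionFieldOver k E) ℤᵐ⁰ :=
  FunctionField.valInf (E⁄k).toAffine

section Translation
open scoped Classical
open WeierstrassCurve.Affine.FunctionField WeierstrassCurve.Affine.Point

variable {K : Type*} (k : Type*) [Field K] [Field k] [Algebra K k] (E : WeierstrassCurve K)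
  [E.IsElliptic]

local notation "𝓜" => FunctionFieldOver k E
local notation "𝓿" => valOver k E

lemma equation_generic : (E⁄𝓜).toAffine.Equation (x (E⁄k).toAffine) (y (E⁄k).toAffine) := by
  have h := equation_xy (E⁄k).toAffine
  have e : (E⁄k).map (algebraMap k 𝓜) = E⁄𝓜 := by
    ext <;> simp [← IsScalarTower.algebraMap_apply]
  exact e ▸ h

/-- The generic point of an elliptic curve, over its function field. -/
noncomputable def genericPoint : (E⁄𝓜).toAffine.Point :=
  .some _ _ (equation_iff_nonsingular.1 (equation_generic k E))

@[simp] lemma xCoord_genericPoint : (genericPoint k E).xCoord = x (E⁄k).toAffine := rfl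
@[simp] lemma yCoord_genericPoint : (genericPoint k E).yCoord = y (E⁄k).toAffine := rfl

lemma genericPoint_ne_zero : genericPoint k E ≠ 0 := some_ne_zero _

variable {k E}

/-- A point over the constant field, as a point over the function field. -/
noncomputable def constPoint : (E⁄k).toAffine.Point →+ (E⁄𝓜).toAffine.Point :=
  Point.map (Algebra.ofId k 𝓜)

@[simp] lemma xCoord_constPoint (Q : (E⁄k).toAffine.Point) :
    (constPoint Q).xCoord = algebraMap k 𝓜 Q.xCoord := xCoord_map _ Q

@[simp] lemma yCoord_constPoint (Q : (E⁄k).toAffine.Point) :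
    (constPoint Q).yCoord = algebraMap k 𝓜 Q.yCoord := yCoord_map _ Q

lemma constPoint_ne_zero {Q : (E⁄k).toAffine.Point} (hQ : Q ≠ 0) : constPoint Q ≠ 0 :=
  map_ne_zero _ hQ

lemma x_ne_algebraMap (c : k) : x (E⁄k).toAffine ≠ algebraMap k 𝓜 c := by
  intro h
  have h₁ := valInf_x (E⁄k).toAffine
  have h₂ := valInf_algebraMap_le (E⁄k).toAffine c
  rw [← h, h₁, ← WithZero.exp_zero, WithZero.exp_le_exp] at h₂
  omega

lemma genericPoint_ne_constPoint (Q : (E⁄k).toAffine.Point) : genericPoint k E ≠ constPoint Q := by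
  intro h
  have := congrArg xCoord h
  rw [xCoord_constPoint] at this
  exact x_ne_algebraMap _ this

lemma genericPoint_add_ne_zero (Q : (E⁄k).toAffine.Point) :
    genericPoint k E + constPoint Q ≠ 0 := by
  intro h
  rw [add_eq_zero_iff_eq_neg, ← map_neg] at h
  exact genericPoint_ne_constPoint _ h

lemma valInf_algebraMap_base_le (c : K) : 𝓿 (algebraMap K 𝓜 c) ≤ 1 := by
  rw [IsScalarTower.algebraMap_apply K k]
  exact valInf_algebraMap_le _ _

lemma valInf_x_sub (c : k) : 𝓿 (x (E⁄k).toAffine - algebraMap k 𝓜 c) = WithZero.exp 2 := by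
  rw [Valuation.map_sub_eq_of_lt_left, valInf_x]
  rw [valInf_x]
  refine (valInf_algebraMap_le _ _).trans_lt ?_
  rw [← WithZero.exp_zero, WithZero.exp_lt_exp]
  norm_num

lemma valInf_y_sub (c : k) : 𝓿 (y (E⁄k).toAffine - algebraMap k 𝓜 c) = WithZero.exp 3 := by
  rw [Valuation.map_sub_eq_of_lt_left, valInf_y]
  rw [valInf_y]
  refine (valInf_algebraMap_le _ _).trans_lt ?_
  rw [← WithZero.exp_zero, WithZero.exp_lt_exp]
  norm_num

end Translation
end Affine
end WeierstrassCurve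

namespace WeierstrassCurve.Affine

section TranslationValuation
open scoped Classical
open WeierstrassCurve.Affine.FunctionField WeierstrassCurve.Affine.Point

variable {K k : Type*} [Field K] [Field k] [Algebra K k] {E : WeierstrassCurve K} [E.IsElliptic]

local notation "𝓜" => FunctionFieldOver k E
local notation "𝓿" => valOver k E

lemma valInf_algebraMap_mul_le (c : k) {f : 𝓜} {g : ℤᵐ⁰} (h : 𝓿 f ≤ g) :
    𝓿 (algebraMap k 𝓜 c * f) ≤ g := by
  rw [map_mul]
  exact (mul_le_of_le_one_left' (valInf_algebraMap_le _ c)).trans h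

lemma valInf_algebraMap_base_mul_le (c : K) {f : 𝓜} {g : ℤᵐ⁰} (h : 𝓿 f ≤ g) :
    𝓿 (algebraMap K 𝓜 c * f) ≤ g := by
  rw [map_mul]
  exact (mul_le_of_le_one_left' (valInf_algebraMap_base_le c)).trans h

lemma exp_one_le {n : ℤ} (h : 0 ≤ n) : (1 : ℤᵐ⁰) ≤ WithZero.exp n := by
  rwa [← WithZero.exp_zero, WithZero.exp_le_exp]

variable {Q : (E⁄k).toAffine.Point} (hQ : Q ≠ 0)
include hQ

lemma genericPoint_xCoord_ne : (genericPoint k E).xCoord ≠ (constPoint Q : (E⁄𝓜).toAffine.Point).xCoord := by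
  rw [xCoord_constPoint]
  exact x_ne_algebraMap _

lemma xCoord_translate_sub_ne_zero :
    (genericPoint k E + constPoint Q).xCoord - algebraMap k 𝓜 Q.xCoord ≠ 0 := by
  rw [sub_ne_zero, ← xCoord_constPoint]
  intro h
  rcases (xCoord_eq_iff (genericPoint_add_ne_zero Q) (constPoint_ne_zero hQ)).1 h with h | h
  · exact genericPoint_ne_zero k E (by simpa using h)
  · refine genericPoint_ne_constPoint (k := k) (E := E) (-Q - Q) ?_
    rw [map_sub, map_neg, ← h, add_sub_cancel_right]

lemma psiTwo_constPoint : (constPoint Q : (E⁄𝓜).toAffine.Point).psiTwo =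
    algebraMap k 𝓜 Q.psiTwo := by
  simp [Point.psiTwo, map_ofNat, ← IsScalarTower.algebraMap_apply]

/-- After division by the pole of order four, the function `x - x(Q)` has a simple zero at `Q`,
except at 2-torsion points, where the coefficient `ψ₂(Q)` of `y` vanishes and the order is at least
two. -/
lemma valInf_xCoord_translate_mul :
    𝓿 ((genericPoint k E + constPoint Q).xCoord - algebraMap k 𝓜 Q.xCoord) * WithZero.exp 4 ≤
      (if Q.psiTwo = 0 then WithZero.exp 2 else WithZero.exp 3) ∧ (Q.psiTwo ≠ 0 →
    𝓿 ((genericPoint k E + constPoint Q).xCoord - algebraMap k 𝓜 Q.xCoord) * WithZero.exp 4 =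
      WithZero.exp 3) := by
  have h := xCoord_add_sub_mul_sq (genericPoint_ne_zero k E) (constPoint_ne_zero hQ)
    (genericPoint_xCoord_ne hQ)
  rw [psiTwo_constPoint hQ] at h
  simp only [xCoord_constPoint, yCoord_constPoint, xCoord_genericPoint, yCoord_genericPoint] at h
  have e : 𝓿 ((x (E⁄k).toAffine - algebraMap k 𝓜 Q.xCoord) ^ 2) = WithZero.exp 4 := by
    rw [map_pow, valInf_x_sub, ← WithZero.exp_nsmul]
    rfl
  have hr : 𝓿 ((3 * algebraMap k 𝓜 Q.xCoord ^ 2 + 2 * (E⁄𝓜).a₂ * algebraMap k 𝓜 Q.xCoord +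
      (E⁄𝓜).a₄ - (E⁄𝓜).a₁ * algebraMap k 𝓜 Q.yCoord) * x (E⁄k).toAffine +
      ((E⁄𝓜).a₆ + algebraMap k 𝓜 Q.yCoord ^ 2 + (E⁄𝓜).a₁ * algebraMap k 𝓜 Q.xCoord *
        algebraMap k 𝓜 Q.yCoord - (E⁄𝓜).a₂ * algebraMap k 𝓜 Q.xCoord ^ 2 -
        2 * algebraMap k 𝓜 Q.xCoord ^ 3)) ≤ WithZero.exp 2 := by
    obtain ⟨c, hc⟩ : ∃ c : k, algebraMap k 𝓜 c = (3 * algebraMap k 𝓜 Q.xCoord ^ 2 +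
        2 * (E⁄𝓜).a₂ * algebraMap k 𝓜 Q.xCoord + (E⁄𝓜).a₄ -
          (E⁄𝓜).a₁ * algebraMap k 𝓜 Q.yCoord) :=
      ⟨3 * Q.xCoord ^ 2 + 2 * (E⁄k).a₂ * Q.xCoord + (E⁄k).a₄ - (E⁄k).a₁ * Q.yCoord, by
        simp [map_ofNat, ← IsScalarTower.algebraMap_apply]⟩
    obtain ⟨d, hd⟩ : ∃ d : k, algebraMap k 𝓜 d = ((E⁄𝓜).a₆ + algebraMap k 𝓜 Q.yCoord ^ 2 +
        (E⁄𝓜).a₁ * algebraMap k 𝓜 Q.xCoord * algebraMap k 𝓜 Q.yCoord -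
        (E⁄𝓜).a₂ * algebraMap k 𝓜 Q.xCoord ^ 2 - 2 * algebraMap k 𝓜 Q.xCoord ^ 3) :=
      ⟨(E⁄k).a₆ + Q.yCoord ^ 2 + (E⁄k).a₁ * Q.xCoord * Q.yCoord - (E⁄k).a₂ * Q.xCoord ^ 2 -
        2 * Q.xCoord ^ 3, by simp [map_ofNat, ← IsScalarTower.algebraMap_apply]⟩
    rw [← hc, ← hd]
    refine Valuation.map_add_le _ (valInf_algebraMap_mul_le c (valInf_x _).le) ?_
    exact (valInf_algebraMap_le _ d).trans (exp_one_le (by norm_num))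
  rw [add_assoc] at h
  rw [← e, ← map_mul, h]
  refine ⟨?_, fun hψ ↦ ?_⟩
  · split_ifs with hψ
    · rwa [hψ, _root_.map_zero, _root_.neg_zero, zero_mul, zero_add]
    · refine Valuation.map_add_le _ ?_ (hr.trans (WithZero.exp_le_exp.2 (by norm_num)))
      rw [← map_neg]
      exact valInf_algebraMap_mul_le _ (valInf_y _).le
  · have h3 : 𝓿 (-algebraMap k 𝓜 Q.psiTwo * y (E⁄k).toAffine) = WithZero.exp 3 := by
      rw [← map_neg, map_mul, valInf_algebraMap _ (neg_ne_zero.2 hψ), one_mul, valInf_y]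
    rw [Valuation.map_add_eq_of_lt_left, h3]
    rw [h3]
    exact hr.trans_lt (WithZero.exp_lt_exp.2 (by norm_num))

omit hQ in
lemma le_exp_of_mul_exp_le {a : ℤᵐ⁰} {m n : ℤ} (h : a * WithZero.exp m ≤ WithZero.exp n) :
    a ≤ WithZero.exp (n - m) := by
  rw [WithZero.exp_sub]
  exact (le_div_iff₀ (zero_lt_iff.2 WithZero.exp_ne_zero)).2 h

omit hQ in
lemma eq_exp_of_mul_exp_eq {a : ℤᵐ⁰} {m n : ℤ} (h : a * WithZero.exp m = WithZero.exp n) :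
    a = WithZero.exp (n - m) := by
  rw [WithZero.exp_sub]
  exact (eq_div_iff WithZero.exp_ne_zero).2 h

lemma valInf_xCoord_translate_le :
    𝓿 ((genericPoint k E + constPoint Q).xCoord - algebraMap k 𝓜 Q.xCoord) ≤
      WithZero.exp (-1) := by
  refine le_exp_of_mul_exp_le (n := 3) ((valInf_xCoord_translate_mul hQ).1.trans ?_)
  split_ifs
  · exact WithZero.exp_le_exp.2 (by norm_num)
  · exact le_rfl

lemma valInf_xCoord_translate_le_of_psiTwo_eq_zero (h : Q.psiTwo = 0) :
    𝓿 ((genericPoint k E + constPoint Q).xCoord - algebraMap k 𝓜 Q.xCoord) ≤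
      WithZero.exp (-2) := by
  refine le_exp_of_mul_exp_le (n := 2) ((valInf_xCoord_translate_mul hQ).1.trans ?_)
  rw [if_pos h]

lemma valInf_xCoord_translate (h : Q.psiTwo ≠ 0) :
    𝓿 ((genericPoint k E + constPoint Q).xCoord - algebraMap k 𝓜 Q.xCoord) =
      WithZero.exp (-1) :=
  eq_exp_of_mul_exp_eq ((valInf_xCoord_translate_mul hQ).2 h)

lemma valInf_yCoord_translate_sub_neg :
    𝓿 ((genericPoint k E + constPoint Q).yCoord - algebraMap k 𝓜 (-Q).yCoord) =
      WithZero.exp 1 *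
        𝓿 ((genericPoint k E + constPoint Q).xCoord - algebraMap k 𝓜 Q.xCoord) := by
  have h := congrArg 𝓿 (yCoord_add_sub_mul (genericPoint_ne_zero k E) (constPoint_ne_zero hQ)
    (genericPoint_xCoord_ne hQ))
  rw [← map_neg] at h
  simp only [xCoord_constPoint, yCoord_constPoint, xCoord_genericPoint, yCoord_genericPoint,
    map_mul, valInf_x_sub, Valuation.map_neg] at h
  have h3 : 𝓿 (y (E⁄k).toAffine - algebraMap k 𝓜 Q.yCoord +
      (E⁄𝓜).a₁ * (x (E⁄k).toAffine - algebraMap k 𝓜 Q.xCoord)) = WithZero.exp 3 := by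
    rw [Valuation.map_add_eq_of_lt_left, valInf_y_sub]
    rw [valInf_y_sub]
    refine (valInf_algebraMap_base_mul_le _ (valInf_x_sub _).le).trans_lt ?_
    exact WithZero.exp_lt_exp.2 (by norm_num)
  rw [h3] at h
  apply mul_right_cancel₀ (WithZero.exp_ne_zero (a := (2 : ℤ)))
  rw [h, mul_right_comm, ← WithZero.exp_add]
  norm_num

lemma valInf_yCoord_translate_sub_neg_le :
    𝓿 ((genericPoint k E + constPoint Q).yCoord - algebraMap k 𝓜 (-Q).yCoord) ≤ 1 := by
  rw [valInf_yCoord_translate_sub_neg hQ]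
  refine (mul_le_mul_right (valInf_xCoord_translate_le hQ) _).trans ?_
  rw [← WithZero.exp_add]
  norm_num

lemma valInf_xCoord_translate_le_one : 𝓿 (genericPoint k E + constPoint Q).xCoord ≤ 1 := by
  rw [← sub_add_cancel (genericPoint k E + constPoint Q).xCoord (algebraMap k 𝓜 Q.xCoord)]
  refine Valuation.map_add_le _ ((valInf_xCoord_translate_le hQ).trans ?_)
    (valInf_algebraMap_le _ _)
  rw [← WithZero.exp_zero]
  exact WithZero.exp_le_exp.2 (by norm_num)

lemma valInf_yCoord_translate_le_one : 𝓿 (genericPoint k E + constPoint Q).yCoord ≤ 1 := by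
  rw [← sub_add_cancel (genericPoint k E + constPoint Q).yCoord (algebraMap k 𝓜 (-Q).yCoord)]
  exact Valuation.map_add_le _ (valInf_yCoord_translate_sub_neg_le hQ) (valInf_algebraMap_le _ _)

lemma valInf_yCoord_translate_mul_le :
    𝓿 ((genericPoint k E + constPoint Q).yCoord - algebraMap k 𝓜 Q.yCoord) *
      𝓿 ((genericPoint k E + constPoint Q).yCoord - algebraMap k 𝓜 (-Q).yCoord) ≤
    𝓿 ((genericPoint k E + constPoint Q).xCoord - algebraMap k 𝓜 Q.xCoord) := by
  have h := congrArg 𝓿 (yCoord_sub_mul_yCoord_sub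
    (genericPoint_add_ne_zero (k := k) (E := E) Q) (constPoint_ne_zero hQ))
  rw [← map_neg] at h
  simp only [xCoord_constPoint, yCoord_constPoint, map_mul] at h
  rw [h]
  refine mul_le_of_le_one_right' ?_
  have hx := valInf_xCoord_translate_le_one hQ
  have hy := valInf_yCoord_translate_le_one hQ
  have hc := valInf_algebraMap_le (E⁄k).toAffine Q.xCoord
  refine Valuation.map_sub_le _ (Valuation.map_add_le _ (Valuation.map_add_le _
    (Valuation.map_add_le _ (Valuation.map_add_le _ ?_ ?_) ?_) ?_) ?_) ?_
  · rw [map_pow]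
    exact pow_le_one₀ zero_le hx
  · rw [map_mul]
    exact mul_le_one' hx hc
  · rw [map_pow]
    exact pow_le_one₀ zero_le hc
  · exact valInf_algebraMap_base_mul_le _ (Valuation.map_add_le _ hx hc)
  · exact valInf_algebraMap_base_le _
  · exact valInf_algebraMap_base_mul_le _ hy

/-- If `2Q = O`, then `-Q = Q` and the zero of order at least two of `x - x(Q)` suffices. Otherwise
`y - y(-Q)` is a unit at `Q`, and its product with `y - y(Q)` is divisible by `x - x(Q)`. -/
lemma valInf_yCoord_translate_lt :
    𝓿 ((genericPoint k E + constPoint Q).yCoord - algebraMap k 𝓜 Q.yCoord) < 1 := by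
  by_cases h : Q.psiTwo = 0
  · have e : (-Q).yCoord = Q.yCoord := by
      have := yCoord_sub_yCoord_neg hQ
      rw [h, sub_eq_zero] at this
      exact this.symm
    rw [← e, valInf_yCoord_translate_sub_neg hQ]
    refine (mul_le_mul_right (valInf_xCoord_translate_le_of_psiTwo_eq_zero hQ h) _).trans_lt ?_
    rw [← WithZero.exp_add, ← WithZero.exp_zero, WithZero.exp_lt_exp]
    norm_num
  · have h₁ := valInf_yCoord_translate_mul_le hQ
    rw [valInf_yCoord_translate_sub_neg hQ, valInf_xCoord_translate hQ h, ← WithZero.exp_add,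
      add_neg_cancel, WithZero.exp_zero, mul_one] at h₁
    refine h₁.trans_lt ?_
    rw [← WithZero.exp_zero, WithZero.exp_lt_exp]
    norm_num

end TranslationValuation
end WeierstrassCurve.Affine

/-! ### Translation automorphisms of the function field -/

namespace WeierstrassCurve.Affine

section Transcendental
variable {k F : Type*} [Field k] [Field F] [Algebra k F] (v : Valuation F ℤᵐ⁰)
  (hv : ∀ c : k, v (algebraMap k F c) ≤ 1)
include hv

lemma valuation_aeval_le_one {u : F} (hu : v u ≤ 1) (p : k[X]) : v (aeval u p) ≤ 1 := by
  rw [aeval_eq_sum_range]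
  refine Valuation.map_sum_le _ fun i _ ↦ ?_
  rw [Algebra.smul_def, map_mul, map_pow]
  exact mul_le_one' (hv _) (pow_le_one₀ zero_le hu)

lemma valuation_aeval_sub_lt_one {u : F} {c : k} (hu : v (u - algebraMap k F c) < 1) (p : k[X]) :
    v (aeval u p - algebraMap k F (p.eval c)) < 1 := by
  obtain ⟨q, hq⟩ := X_sub_C_dvd_sub_C_eval (p := p) (a := c)
  have h := congrArg (aeval u) hq
  rw [map_sub, map_mul, aeval_C, map_sub, aeval_X, aeval_C] at h
  rw [h, map_mul]
  have hu' : v u ≤ 1 := by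
    rw [← sub_add_cancel u (algebraMap k F c)]
    exact Valuation.map_add_le _ hu.le (hv c)
  exact mul_lt_one_of_lt_of_le hu (valuation_aeval_le_one v hv hu' q)

/-- Factor out the largest power of the variable: the remaining factor has a nonzero constant term,
so its value is a unit. Hence `u` is transcendental over the constants. -/
lemma aeval_ne_zero_of_valuation_lt_one {u : F} (hu : v u < 1) (hu0 : u ≠ 0) {p : k[X]}
    (hp : p ≠ 0) : aeval u p ≠ 0 := by
  obtain ⟨q, hq, hq'⟩ := exists_eq_pow_rootMultiplicity_mul_and_not_dvd p hp 0
  rw [C_0, sub_zero] at hq hq'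
  rw [hq, map_mul, map_pow, aeval_X]
  refine mul_ne_zero (pow_ne_zero _ hu0) fun h ↦ ?_
  have h₁ := valuation_aeval_sub_lt_one v hv (u := u) (c := (0 : k)) (by simpa using hu) q
  have h₂ : q.eval 0 ≠ 0 := by
    rwa [← coeff_zero_eq_eval_zero, Ne, ← X_dvd_iff]
  have h₃ : v (algebraMap k F (q.eval 0)) * v (algebraMap k F (q.eval 0)⁻¹) = 1 := by
    rw [← map_mul, ← map_mul, mul_inv_cancel₀ h₂, map_one, map_one]
  rw [h, zero_sub, Valuation.map_neg] at h₁
  exact (mul_lt_one_of_lt_of_le h₁ (hv _)).ne h₃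

end Transcendental

section Translate
open scoped Classical
open WeierstrassCurve.Affine.FunctionField WeierstrassCurve.Affine.Point

variable {K k : Type*} [Field K] [Field k] [Algebra K k] {E : WeierstrassCurve K} [E.IsElliptic]

local notation "𝓜" => FunctionFieldOver k E
local notation "𝓿" => valOver k E

lemma aeval_xCoord_translate_ne_zero (Q : (E⁄k).toAffine.Point) {p : k[X]} (hp : p ≠ 0) :
    aeval (genericPoint k E + constPoint Q).xCoord p ≠ 0 := by
  by_cases hQ : Q = 0
  · rw [hQ, _root_.map_zero, add_zero]
    exact aeval_x_ne_zero _ hp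
  · have h := aeval_ne_zero_of_valuation_lt_one 𝓿 (valInf_algebraMap_le _)
      (p := p.comp (X + C Q.xCoord)) ((valInf_xCoord_translate_le hQ).trans_lt (by
        rw [← WithZero.exp_zero, WithZero.exp_lt_exp]
        norm_num)) (xCoord_translate_sub_ne_zero hQ) (comp_X_add_C_ne_zero_iff.2 hp)
    rwa [aeval_comp, map_add, aeval_X, aeval_C, sub_add_cancel] at h

lemma map_algebraMap_functionField :
    (E⁄k).map (algebraMap k 𝓜) = E⁄𝓜 := by
  ext <;> simp [← IsScalarTower.algebraMap_apply]

lemma equation_translate (Q : (E⁄k).toAffine.Point) :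
    ((E⁄k).map (algebraMap k 𝓜)).toAffine.Equation (genericPoint k E + constPoint Q).xCoord
      (genericPoint k E + constPoint Q).yCoord := by
  rw [map_algebraMap_functionField]
  exact equation_coord (genericPoint_add_ne_zero Q)

/-- The automorphism of the function field given by translation by a point. -/
noncomputable def translate (Q : (E⁄k).toAffine.Point) : 𝓜 →ₐ[k] 𝓜 :=
  { FunctionField.lift (algebraMap k 𝓜) (equation_translate Q)
      (fun _ hp ↦ aeval_xCoord_translate_ne_zero Q hp) with
    commutes' := fun r ↦ lift_algebraMap _ _ (fun _ hp ↦ aeval_xCoord_translate_ne_zero Q hp) r }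

@[simp] lemma translate_x (Q : (E⁄k).toAffine.Point) :
    translate Q (x (E⁄k).toAffine) = (genericPoint k E + constPoint Q).xCoord :=
  lift_x _ _ (fun _ hp ↦ aeval_xCoord_translate_ne_zero Q hp)

@[simp] lemma translate_y (Q : (E⁄k).toAffine.Point) :
    translate Q (y (E⁄k).toAffine) = (genericPoint k E + constPoint Q).yCoord :=
  lift_y _ _ (fun _ hp ↦ aeval_xCoord_translate_ne_zero Q hp)

lemma algHom_ext {f g : 𝓜 →ₐ[k] 𝓜} (hx : f (x (E⁄k).toAffine) = g (x (E⁄k).toAffine))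
    (hy : f (y (E⁄k).toAffine) = g (y (E⁄k).toAffine)) : f = g := by
  have : (f : 𝓜 →+* 𝓜) = g := FunctionField.hom_ext (fun _ ↦ by simp) hx hy
  exact AlgHom.coe_ringHom_injective this

lemma map_translate_genericPoint (Q : (E⁄k).toAffine.Point) :
    Point.map (translate Q) (genericPoint k E) = genericPoint k E + constPoint Q := by
  refine ext_coord (map_ne_zero _ (genericPoint_ne_zero k E)) (genericPoint_add_ne_zero Q) ?_ ?_
  · rw [xCoord_map, xCoord_genericPoint, translate_x]
  · rw [yCoord_map, yCoord_genericPoint, translate_y]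

lemma map_constPoint (f : 𝓜 →ₐ[k] 𝓜) (Q : (E⁄k).toAffine.Point) :
    Point.map f (constPoint Q) = constPoint Q := by
  rcases Q with _ | _
  · rfl
  · refine ext_coord (map_ne_zero _ (constPoint_ne_zero (some_ne_zero _)))
      (constPoint_ne_zero (some_ne_zero _)) ?_ ?_
    · rw [xCoord_map, xCoord_constPoint, f.commutes]
    · rw [yCoord_map, yCoord_constPoint, f.commutes]

lemma map_translate (Q R : (E⁄k).toAffine.Point) :
    Point.map (translate Q) (genericPoint k E + constPoint R) =
      genericPoint k E + constPoint (Q + R) := by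
  rw [map_add, map_translate_genericPoint, map_constPoint, map_add, add_assoc]

lemma translate_translate (Q R : (E⁄k).toAffine.Point) (f : 𝓜) :
    translate Q (translate R f) = translate (Q + R) f := by
  have : (translate Q).comp (translate R) = (translate (Q + R) : 𝓜 →ₐ[k] 𝓜) := by
    apply algHom_ext
    · rw [AlgHom.comp_apply, translate_x, translate_x, ← map_translate, xCoord_map]
    · rw [AlgHom.comp_apply, translate_y, translate_y, ← map_translate, yCoord_map]
  exact congrArg (fun g ↦ g f) this

lemma translate_zero (f : 𝓜) : translate 0 f = f := by
  have : (translate 0 : 𝓜 →ₐ[k] 𝓜) = AlgHom.id k 𝓜 := by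
    apply algHom_ext
    · rw [translate_x, _root_.map_zero, add_zero, AlgHom.id_apply, xCoord_genericPoint]
    · rw [translate_y, _root_.map_zero, add_zero, AlgHom.id_apply, yCoord_genericPoint]
  exact congrArg (fun g ↦ g f) this

lemma translate_injective : Function.Injective (translate : (E⁄k).toAffine.Point → 𝓜 →ₐ[k] 𝓜) := by
  intro Q R h
  have h₁ : genericPoint k E + constPoint Q = genericPoint k E + constPoint R := by
    rw [← map_translate_genericPoint, ← map_translate_genericPoint, h]
  exact Point.map_injective _ (add_left_cancel h₁)

section
variable {Q : (E⁄k).toAffine.Point} (hQ : Q ≠ 0)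
include hQ

lemma valInf_translate_x_sub_lt : 𝓿 (translate Q (x (E⁄k).toAffine) - algebraMap k 𝓜 Q.xCoord) < 1 := by
  rw [translate_x]
  refine (valInf_xCoord_translate_le hQ).trans_lt ?_
  rw [← WithZero.exp_zero, WithZero.exp_lt_exp]
  norm_num

lemma valInf_translate_y_sub_lt :
    𝓿 (translate Q (y (E⁄k).toAffine) - algebraMap k 𝓜 Q.yCoord) < 1 := by
  rw [translate_y]
  exact valInf_yCoord_translate_lt hQ

lemma valInf_translate_x_le : 𝓿 (translate Q (x (E⁄k).toAffine)) ≤ 1 := by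
  rw [translate_x]
  exact valInf_xCoord_translate_le_one hQ

lemma valInf_translate_y_le : 𝓿 (translate Q (y (E⁄k).toAffine)) ≤ 1 := by
  rw [translate_y]
  exact valInf_yCoord_translate_le_one hQ

/-- Translation by `Q` carries infinity to `Q`, so `𝓿 (translate Q f)` measures the pole of `f` at
`Q`. Functions in the coordinate ring have none, since `x` and `y` have none. -/
lemma valInf_translate_coe_le (a : (E⁄k).toAffine.CoordinateRing) :
    𝓿 (translate Q (algebraMap _ 𝓜 a)) ≤ 1 := by
  obtain ⟨p, q, rfl⟩ := CoordinateRing.exists_eq _ a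
  rw [map_add, map_mul, algebraMap_aeval, algebraMap_aeval, ← y, map_add, map_mul,
    ← aeval_algHom_apply, ← aeval_algHom_apply]
  have h (p : k[X]) := valuation_aeval_le_one 𝓿 (valInf_algebraMap_le _) (valInf_translate_x_le hQ) p
  refine Valuation.map_add_le _ (h p) ?_
  rw [map_mul]
  exact mul_le_one' (h q) (valInf_translate_y_le hQ)

lemma valInf_translate_sub_lt (p q : k[X]) :
    𝓿 (translate Q (aeval (x (E⁄k).toAffine) p + aeval (x (E⁄k).toAffine) q * y (E⁄k).toAffine) -
      algebraMap k 𝓜 (p.eval Q.xCoord + q.eval Q.xCoord * Q.yCoord)) < 1 := by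
  rw [map_add, map_mul, ← aeval_algHom_apply, ← aeval_algHom_apply, map_add, map_mul]
  have h (p : k[X]) := valuation_aeval_sub_lt_one 𝓿 (valInf_algebraMap_le _)
    (valInf_translate_x_sub_lt hQ) p
  have h' := valuation_aeval_le_one 𝓿 (valInf_algebraMap_le _) (valInf_translate_x_le hQ) q
  have e (a b c d e f : 𝓜) : a + b * c - (d + e * f) = (a - d) + (b * (c - f) + f * (b - e)) := by
    ring
  rw [e]
  refine Valuation.map_add_lt _ (h p) (Valuation.map_add_lt _ ?_ ?_)
  · rw [map_mul, mul_comm]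
    exact mul_lt_one_of_lt_of_le (valInf_translate_y_sub_lt hQ) h'
  · rw [map_mul, mul_comm]
    exact mul_lt_one_of_lt_of_le (h q) (valInf_algebraMap_le _ _)

end

end Translate
end WeierstrassCurve.Affine

/-! ### Functions regular away from infinity -/

namespace WeierstrassCurve.Affine

section Regularity
open scoped Classical
open WeierstrassCurve.Affine.FunctionField WeierstrassCurve.Affine.Point

variable {K k : Type*} [Field K] [Field k] [Algebra K k] {E : WeierstrassCurve K} [E.IsElliptic]

local notation "𝓜" => FunctionFieldOver k E
local notation "𝓿" => valOver k E

lemma eq_zero_of_valInf_algebraMap_lt {c : k} (h : 𝓿 (algebraMap k 𝓜 c) < 1) : c = 0 := by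
  by_contra hc
  exact h.ne (valInf_algebraMap _ hc)

/-- The slope of the line through a point and the negative of a fixed point. -/
noncomputable def chordSlope (Q : (E⁄k).toAffine.Point) : 𝓜 :=
  (y (E⁄k).toAffine - algebraMap k 𝓜 (-Q).yCoord) / (x (E⁄k).toAffine - algebraMap k 𝓜 Q.xCoord)

lemma x_sub_ne_zero (c : k) : x (E⁄k).toAffine - algebraMap k 𝓜 c ≠ 0 :=
  sub_ne_zero.2 (x_ne_algebraMap c)

lemma translate_chordSlope (Q R : (E⁄k).toAffine.Point) : translate R (chordSlope Q) =
    ((genericPoint k E + constPoint R).yCoord - algebraMap k 𝓜 (-Q).yCoord) /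
      ((genericPoint k E + constPoint R).xCoord - algebraMap k 𝓜 Q.xCoord) := by
  simp [chordSlope]

lemma valInf_translate_chordSlope_self {Q : (E⁄k).toAffine.Point} (hQ : Q ≠ 0) :
    𝓿 (translate Q (chordSlope Q)) = WithZero.exp 1 := by
  rw [translate_chordSlope, map_div₀, valInf_yCoord_translate_sub_neg hQ, mul_div_cancel_right₀]
  exact (Valuation.ne_zero_iff _).2 (xCoord_translate_sub_ne_zero hQ)

/-- The chord slope has simple poles at `Q` and at infinity. Translation exposes the pole at `Q`,
with leading coefficient opposite to the one at infinity. -/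
lemma translate_chordSlope_self {Q : (E⁄k).toAffine.Point} (hQ : Q ≠ 0) :
    translate Q (chordSlope Q) = -((y (E⁄k).toAffine - algebraMap k 𝓜 Q.yCoord) /
      (x (E⁄k).toAffine - algebraMap k 𝓜 Q.xCoord)) - algebraMap K 𝓜 E.a₁ := by
  have h := yCoord_add_sub_mul (genericPoint_ne_zero k E) (constPoint_ne_zero hQ)
    (genericPoint_xCoord_ne hQ)
  rw [← map_neg] at h
  simp only [xCoord_constPoint, yCoord_constPoint, xCoord_genericPoint, yCoord_genericPoint] at h
  have h₁ := xCoord_translate_sub_ne_zero hQ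
  have h₂ := x_sub_ne_zero (E := E) Q.xCoord
  have e : (E⁄𝓜).a₁ = algebraMap K 𝓜 E.a₁ := rfl
  rw [e] at h
  rw [translate_chordSlope]
  field_simp
  linear_combination h

/-- The denominator of the slope vanishes only at `Q` and `-Q`, and at `-Q` the numerator vanishes
as well. -/
lemma valInf_translate_chordSlope_le {Q R : (E⁄k).toAffine.Point} (hQ : Q ≠ 0) (hR : R ≠ 0)
    (h : R ≠ Q) : 𝓿 (translate R (chordSlope Q)) ≤ 1 := by
  rw [translate_chordSlope, map_div₀]
  by_cases hx : R.xCoord = Q.xCoord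
  · have hRQ : R = -Q := ((xCoord_eq_iff hR hQ).1 hx).resolve_left h
    have hψ : R.psiTwo ≠ 0 := by
      rw [Ne, psiTwo_eq_zero_iff hR, add_eq_zero_iff_eq_neg, hRQ, neg_neg, ← hRQ]
      exact h
    have h₁ := valInf_yCoord_translate_mul_le hR
    rw [valInf_yCoord_translate_sub_neg hR, valInf_xCoord_translate hR hψ, ← WithZero.exp_add,
      add_neg_cancel, WithZero.exp_zero, mul_one] at h₁
    rw [← hRQ, ← hx, valInf_xCoord_translate hR hψ]
    exact div_le_one_of_le₀ h₁ zero_le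
  · have h₁ : 𝓿 ((genericPoint k E + constPoint R).xCoord - algebraMap k 𝓜 Q.xCoord) = 1 := by
      have e : (genericPoint k E + constPoint R).xCoord - algebraMap k 𝓜 Q.xCoord =
          ((genericPoint k E + constPoint R).xCoord - algebraMap k 𝓜 R.xCoord) +
            algebraMap k 𝓜 (R.xCoord - Q.xCoord) := by
        rw [map_sub, sub_add_sub_cancel]
      have h₂ := valInf_algebraMap (E⁄k).toAffine (sub_ne_zero.2 hx)
      rw [e, Valuation.map_add_eq_of_lt_right, h₂]
      rw [h₂, ← translate_x]
      exact valInf_translate_x_sub_lt hR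
    rw [h₁, div_one]
    exact Valuation.map_sub_le _ (valInf_yCoord_translate_le_one hR) (valInf_algebraMap_le _ _)

/-- Write `g = (p + q y) / (x - c)`. Regularity at `-Q` makes the numerator vanish there, so `g` is
an element of the coordinate ring plus `q(c)` times the chord slope of `Q`. Regularity at `Q` then
forces `q(c) = 0`. -/
lemma mem_coordinateRing_of_mul_mem {c : k} {Q : (E⁄k).toAffine.Point} (hQ : Q ≠ 0)
    (hc : Q.xCoord = c) {g : 𝓜} (h₁ : 𝓿 (translate Q g) ≤ 1) (h₂ : 𝓿 (translate (-Q) g) ≤ 1)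
    (h : ∃ a : (E⁄k).toAffine.CoordinateRing,
      algebraMap _ 𝓜 a = (x (E⁄k).toAffine - algebraMap k 𝓜 c) * g) :
    ∃ a : (E⁄k).toAffine.CoordinateRing, algebraMap _ 𝓜 a = g := by
  obtain ⟨a, ha⟩ := h
  subst hc
  obtain ⟨p, q, rfl⟩ := CoordinateRing.exists_eq _ a
  rw [map_add, map_mul, algebraMap_aeval, algebraMap_aeval, ← y] at ha
  have hQ' : -Q ≠ 0 := neg_ne_zero.2 hQ
  have h0 : p.eval Q.xCoord + q.eval Q.xCoord * (-Q).yCoord = 0 := by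
    apply eq_zero_of_valInf_algebraMap_lt (E := E)
    have h₃ := valInf_translate_sub_lt hQ' p q
    rw [xCoord_neg] at h₃
    rw [← sub_sub_cancel (translate (-Q) (aeval (x (E⁄k).toAffine) p +
      aeval (x (E⁄k).toAffine) q * y (E⁄k).toAffine)) (algebraMap k 𝓜 _)]
    refine Valuation.map_sub_lt _ ?_ h₃
    rw [ha, map_mul, map_mul, map_sub, AlgHom.commutes]
    have h₄ := valInf_translate_x_sub_lt hQ'
    rw [xCoord_neg] at h₄
    exact mul_lt_one_of_lt_of_le h₄ h₂
  obtain ⟨p', hp⟩ := X_sub_C_dvd_sub_C_eval (p := p) (a := Q.xCoord)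
  obtain ⟨q', hq⟩ := X_sub_C_dvd_sub_C_eval (p := q) (a := Q.xCoord)
  have hp' := congrArg (aeval (x (E⁄k).toAffine)) hp
  have hq' := congrArg (aeval (x (E⁄k).toAffine)) hq
  simp only [map_sub, map_mul, aeval_C, aeval_X] at hp' hq'
  have h0' := congrArg (algebraMap k 𝓜) h0
  rw [map_add, map_mul, _root_.map_zero] at h0'
  have hne := x_sub_ne_zero (E := E) Q.xCoord
  have hg : g = algebraMap _ 𝓜 (aeval (CoordinateRing.x (E⁄k).toAffine) p' +
      aeval (CoordinateRing.x (E⁄k).toAffine) q' * CoordinateRing.y (E⁄k).toAffine) +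
        algebraMap k 𝓜 (q.eval Q.xCoord) * chordSlope Q := by
    rw [map_add, map_mul, algebraMap_aeval, algebraMap_aeval, ← y, chordSlope]
    field_simp
    linear_combination -ha + hp' + hq' * y (E⁄k).toAffine + h0'
  generalize aeval (CoordinateRing.x (E⁄k).toAffine) p' +
    aeval (CoordinateRing.x (E⁄k).toAffine) q' * CoordinateRing.y (E⁄k).toAffine = a at hg
  by_cases hqe : q.eval Q.xCoord = 0
  · rw [hqe, _root_.map_zero, zero_mul, add_zero] at hg
    exact ⟨_, hg.symm⟩
  · exfalso
    have h₅ := congrArg (translate Q) hg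
    rw [map_add, map_mul, AlgHom.commutes, ← sub_eq_iff_eq_add'] at h₅
    have h₆ := Valuation.map_sub_le 𝓿 h₁ (valInf_translate_coe_le hQ a)
    rw [h₅, map_mul, valInf_translate_chordSlope_self hQ, valInf_algebraMap _ hqe, one_mul,
      ← WithZero.exp_zero, WithZero.exp_le_exp] at h₆
    norm_num at h₆

/-- A function with no pole away from infinity lies in the coordinate ring. -/
theorem mem_coordinateRing_of_valInf_translate_le [IsAlgClosed k] {g : 𝓜}
    (h : ∀ Q : (E⁄k).toAffine.Point, Q ≠ 0 → 𝓿 (translate Q g) ≤ 1) :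
    ∃ a : (E⁄k).toAffine.CoordinateRing, algebraMap _ 𝓜 a = g := by
  obtain ⟨a, b, hb, rfl⟩ := exists_eq_div (E⁄k).toAffine g
  -- The norm turns the denominator into a polynomial in `x`, whose linear factors are then removed
  -- one at a time.
  obtain ⟨b', hb'⟩ := CoordinateRing.algebraMap_norm_eq_mul (E⁄k).toAffine b
  have hN := CoordinateRing.norm_ne_zero (E⁄k).toAffine hb
  have key (s : Multiset k) {f : 𝓜} (hf : ∀ Q : (E⁄k).toAffine.Point, Q ≠ 0 →
      𝓿 (translate Q f) ≤ 1) (hs : ∃ a : (E⁄k).toAffine.CoordinateRing, algebraMap _ 𝓜 a =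
        aeval (x (E⁄k).toAffine) (s.map fun c ↦ X - C c).prod * f) :
      ∃ a : (E⁄k).toAffine.CoordinateRing, algebraMap _ 𝓜 a = f := by
    induction s using Multiset.induction with
    | empty => simpa using hs
    | cons c s ih =>
      obtain ⟨Q, hQ, hc⟩ := exists_xCoord_eq (E⁄k).toAffine c
      have hreg (R : (E⁄k).toAffine.Point) (hR : R ≠ 0) : 𝓿 (translate R
          (aeval (x (E⁄k).toAffine) (s.map fun c ↦ X - C c).prod * f)) ≤ 1 := by
        rw [map_mul, map_mul, ← algebraMap_aeval]
        exact mul_le_one' (valInf_translate_coe_le hR _) (hf R hR)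
      refine ih (mem_coordinateRing_of_mul_mem hQ hc (hreg Q hQ) (hreg _ (neg_ne_zero.2 hQ)) ?_)
      obtain ⟨a, ha⟩ := hs
      refine ⟨a, ?_⟩
      rw [ha, Multiset.map_cons, Multiset.prod_cons, map_mul, map_sub, aeval_X, aeval_C, mul_assoc]
  refine key (Algebra.norm k[X] b).roots h ⟨algebraMap k _ (Algebra.norm k[X] b).leadingCoeff⁻¹ *
    (a * b'), ?_⟩
  have hN' := (IsAlgClosed.splits (Algebra.norm k[X] b)).eq_prod_roots
  have e : aeval (x (E⁄k).toAffine) (Algebra.norm k[X] b) =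
      algebraMap _ 𝓜 b * algebraMap _ 𝓜 b' := by
    rw [← map_mul, ← hb', CoordinateRing.algebraMap_polynomial, algebraMap_aeval]
  have hl : algebraMap k 𝓜 (Algebra.norm k[X] b).leadingCoeff ≠ 0 := by
    rw [Ne, FaithfulSMul.algebraMap_eq_zero_iff]
    exact leadingCoeff_ne_zero.2 hN
  have hb₀ := coe_ne_zero _ hb
  rw [hN', map_mul, aeval_C] at e
  rw [map_mul, map_mul, ← IsScalarTower.algebraMap_apply, map_inv₀]
  field_simp
  linear_combination -algebraMap _ 𝓜 a * e

end Regularity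
end WeierstrassCurve.Affine

/-! ### Functions invariant under a finite group of translations -/

namespace WeierstrassCurve.Affine

lemma valuation_coeff_prod_X_sub_C_le {F ι : Type*} [Field F] (v : Valuation F ℤᵐ⁰)
    (s : Finset ι) {f : ι → F} (hf : ∀ i ∈ s, v (f i) ≤ 1) (n : ℕ) :
    v ((∏ i ∈ s, (X - C (f i))).coeff n) ≤ 1 := by
  have h : ∏ i ∈ s, (X - C (f i)) ∈ liftsRing v.integer.subtype := by
    refine prod_mem fun i hi ↦ sub_mem ?_ ?_
    · exact (lifts_iff_liftsRing _ _).1 (X_mem_lifts _)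
    · exact (lifts_iff_liftsRing _ _).1 (C_mem_lifts v.integer.subtype (⟨f i, hf i hi⟩ : v.integer))
  obtain ⟨x, hx⟩ := (lifts_iff_coeff_lifts _).1 ((lifts_iff_liftsRing _ _).2 h) n
  rw [← hx]
  exact x.2

section QuotientRing
open scoped Classical
open WeierstrassCurve.Affine.FunctionField WeierstrassCurve.Affine.Point

variable {K k : Type*} [Field K] [Field k] [Algebra K k] {E : WeierstrassCurve K} [E.IsElliptic]

local notation "𝓜" => FunctionFieldOver k E
local notation "𝓿" => valOver k E

/-- The functions on an elliptic curve which are invariant under translation by a group of points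
and have no pole outside that group. -/
noncomputable def invariantRing (G : AddSubgroup (E⁄k).toAffine.Point) : Subalgebra k 𝓜 where
  carrier := {f | (∀ Q ∈ G, translate Q f = f) ∧ ∀ Q ∉ G, 𝓿 (translate Q f) ≤ 1}
  mul_mem' := fun {f g} hf hg ↦
    ⟨fun Q hQ ↦ by rw [map_mul, hf.1 Q hQ, hg.1 Q hQ], fun Q hQ ↦ by
      rw [map_mul, map_mul]
      exact mul_le_one' (hf.2 Q hQ) (hg.2 Q hQ)⟩
  add_mem' := fun {f g} hf hg ↦
    ⟨fun Q hQ ↦ by rw [map_add, hf.1 Q hQ, hg.1 Q hQ], fun Q hQ ↦ by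
      rw [map_add]
      exact Valuation.map_add_le _ (hf.2 Q hQ) (hg.2 Q hQ)⟩
  algebraMap_mem' := fun c ↦ ⟨fun Q _ ↦ AlgHom.commutes _ _, fun Q _ ↦ by
    rw [AlgHom.commutes]
    exact valInf_algebraMap_le _ _⟩

variable {G : AddSubgroup (E⁄k).toAffine.Point}

lemma valInf_chordSlope_sub_le (Q : (E⁄k).toAffine.Point) :
    𝓿 (chordSlope Q - y (E⁄k).toAffine / x (E⁄k).toAffine) ≤ 1 := by
  have h₁ := x_sub_ne_zero (E := E) Q.xCoord
  have h₂ : x (E⁄k).toAffine ≠ 0 := by simpa using x_sub_ne_zero (E := E) (0 : k)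
  have e : chordSlope Q - y (E⁄k).toAffine / x (E⁄k).toAffine =
      (algebraMap k 𝓜 Q.xCoord * y (E⁄k).toAffine - algebraMap k 𝓜 (-Q).yCoord *
        x (E⁄k).toAffine) / ((x (E⁄k).toAffine - algebraMap k 𝓜 Q.xCoord) * x (E⁄k).toAffine) := by
    rw [chordSlope]
    field_simp
    ring
  rw [e, map_div₀, map_mul, valInf_x_sub, valInf_x, ← WithZero.exp_add]
  refine div_le_one_of_le₀ ?_ zero_le
  refine (Valuation.map_sub_le _ (valInf_algebraMap_mul_le _ (valInf_y _).le)
    ((valInf_algebraMap_mul_le _ (valInf_x _).le).trans ?_)).trans ?_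
  · exact WithZero.exp_le_exp.2 (by norm_num)
  · exact WithZero.exp_le_exp.2 (by norm_num)

lemma le_one_of_lt_exp_one {a : ℤᵐ⁰} (h : a < WithZero.exp 1) : a ≤ 1 := by
  rcases eq_or_ne a 0 with rfl | ha
  · exact zero_le
  · rw [← WithZero.exp_log ha, WithZero.exp_lt_exp] at h
    rw [← WithZero.exp_log ha, ← WithZero.exp_zero, WithZero.exp_le_exp]
    omega

/-- An invariant function with at most a simple pole is constant. -/
theorem exists_const_of_mem_invariantRing [IsAlgClosed k] [Finite G] (hn : (Nat.card G : k) ≠ 0)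
    {f : 𝓜} (hf : f ∈ invariantRing G) (h : 𝓿 f ≤ WithZero.exp 1) :
    ∃ c : k, f = algebraMap k 𝓜 c := by
  have : Fintype G := Fintype.ofFinite G
  have hx : x (E⁄k).toAffine ≠ 0 := by simpa using x_sub_ne_zero (E := E) (0 : k)
  have hy : y (E⁄k).toAffine ≠ 0 := by
    rw [← Valuation.ne_zero_iff 𝓿, valInf_y]
    exact WithZero.exp_ne_zero
  have hyx : 𝓿 (y (E⁄k).toAffine / x (E⁄k).toAffine) = WithZero.exp 1 := by
    rw [map_div₀, valInf_y, valInf_x, ← WithZero.exp_sub]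
    rfl
  -- The function `y / x` has a simple pole at infinity; `c` is the leading coefficient of `f`
  -- relative to it, and the aim is `c = 0`.
  obtain ⟨c, hc⟩ := exists_valInf_sub_lt (E⁄k).toAffine (div_ne_zero hy hx) (h.trans hyx.ge)
  rw [hyx] at hc
  replace hc := le_one_of_lt_exp_one hc
  set t := y (E⁄k).toAffine / x (E⁄k).toAffine with ht
  have hc1 (g : 𝓜) (hg : 𝓿 g ≤ 1) : 𝓿 (algebraMap k 𝓜 c * g) ≤ 1 :=
    valInf_algebraMap_mul_le c hg
  -- By invariance `f` has the same leading coefficient `c` at each point of `G`. Adding `c` times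
  -- the chord slopes of the nonzero points cancels all poles except the one at infinity.
  obtain ⟨a, ha⟩ := mem_coordinateRing_of_valInf_translate_le (E := E)
    (g := f + algebraMap k 𝓜 c * ∑ Q ∈ (Finset.univ : Finset G).erase 0, chordSlope Q.1) (by
    intro R hR
    rw [map_add, map_mul, AlgHom.commutes, map_sum]
    by_cases hRG : R ∈ G
    · rw [hf.1 R hRG, ← Finset.add_sum_erase _ _ (Finset.mem_erase.2
        ⟨fun h ↦ hR (congrArg Subtype.val h), Finset.mem_univ (⟨R, hRG⟩ : G)⟩), mul_add,
        ← add_assoc]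
      refine Valuation.map_add_le _ ?_ (hc1 _ (Valuation.map_sum_le _ fun Q hQ ↦ ?_))
      · rw [translate_chordSlope_self hR]
        have e : f + algebraMap k 𝓜 c * (-((y (E⁄k).toAffine - algebraMap k 𝓜 R.yCoord) /
            (x (E⁄k).toAffine - algebraMap k 𝓜 R.xCoord)) - algebraMap K 𝓜 E.a₁) =
            (f - algebraMap k 𝓜 c * t) - (algebraMap k 𝓜 c * (chordSlope (-R) - t) +
              algebraMap k 𝓜 c * algebraMap K 𝓜 E.a₁) := by
          rw [chordSlope, neg_neg, xCoord_neg]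
          ring
        rw [e]
        exact Valuation.map_sub_le _ hc (Valuation.map_add_le _
          (hc1 _ (valInf_chordSlope_sub_le _)) (hc1 _ (valInf_algebraMap_base_le _)))
      · have hQ' := Finset.mem_erase.1 hQ
        have hQ0 := (Finset.mem_erase.1 hQ'.2).1
        exact valInf_translate_chordSlope_le (fun h ↦ hQ0 (Subtype.ext h)) hR
          fun h ↦ hQ'.1 (Subtype.ext h.symm)
    · refine Valuation.map_add_le _ (hf.2 R hRG) (hc1 _ (Valuation.map_sum_le _ fun Q hQ ↦ ?_))
      exact valInf_translate_chordSlope_le (fun h ↦ (Finset.mem_erase.1 hQ).1 (Subtype.ext h)) hR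
        fun h ↦ hRG (h ▸ Q.2))
  have hcard : ((Finset.univ : Finset G).erase 0).card + 1 = Nat.card G := by
    rw [Finset.card_erase_add_one (Finset.mem_univ _), Finset.card_univ, Nat.card_eq_fintype_card]
  -- At infinity every chord slope behaves like `y / x`, so the leading coefficients add up to `|G|
  -- c`.
  have hF : 𝓿 (algebraMap _ 𝓜 a - algebraMap k 𝓜 (Nat.card G * c) * t) ≤ 1 := by
    have e : algebraMap _ 𝓜 a - algebraMap k 𝓜 (Nat.card G * c) * t = (f - algebraMap k 𝓜 c * t) +
        algebraMap k 𝓜 c * ∑ Q ∈ (Finset.univ : Finset G).erase 0, (chordSlope Q.1 - t) := by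
      rw [ha, Finset.sum_sub_distrib, Finset.sum_const, ← hcard]
      simp only [map_add, map_mul, map_natCast, Nat.cast_add, Nat.cast_one, nsmul_eq_mul, add_mul, one_mul]
      ring
    rw [e]
    exact Valuation.map_add_le _ hc (hc1 _ (Valuation.map_sum_le _ fun Q _ ↦
      valInf_chordSlope_sub_le _))
  have ht1 : 𝓿 (algebraMap k 𝓜 (Nat.card G * c) * t) ≤ WithZero.exp 1 :=
    valInf_algebraMap_mul_le _ hyx.le
  obtain ⟨d, hd⟩ := exists_const_of_valInf_coe (E⁄k).toAffine (a := a) (by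
    rw [← sub_add_cancel (algebraMap _ 𝓜 a) (algebraMap k 𝓜 (Nat.card G * c) * t)]
    exact Valuation.map_add_le _ (hF.trans (exp_one_le (by norm_num))) ht1)
  -- A function regular elsewhere with at most a simple pole at infinity is constant, so this
  -- leading coefficient vanishes.
  have hnc : (Nat.card G : k) * c = 0 := by
    by_contra h0
    rw [hd, ← IsScalarTower.algebraMap_apply] at hF
    have h₁ := Valuation.map_sub_le 𝓿 (valInf_algebraMap_le _ d) hF
    rw [sub_sub_cancel, map_mul, valInf_algebraMap _ h0, one_mul, hyx, ← WithZero.exp_zero,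
      WithZero.exp_le_exp] at h₁
    norm_num at h₁
  have hc0 : c = 0 := (mul_eq_zero.1 hnc).resolve_left hn
  refine ⟨d, ?_⟩
  rw [hc0, _root_.map_zero, zero_mul, add_zero] at ha
  rw [← ha, hd, ← IsScalarTower.algebraMap_apply]

section Sum
variable [Fintype G]

lemma sum_translate_mem_invariantRing {f : 𝓜}
    (hf : ∀ Q : (E⁄k).toAffine.Point, Q ≠ 0 → 𝓿 (translate Q f) ≤ 1) :
    ∑ Q : G, translate Q.1 f ∈ invariantRing G := by
  refine ⟨fun R hR ↦ ?_, fun R hR ↦ ?_⟩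
  · rw [map_sum]
    exact Fintype.sum_equiv (Equiv.addLeft (⟨R, hR⟩ : G)) _ _ fun Q ↦ translate_translate ..
  · rw [map_sum]
    refine Valuation.map_sum_le _ fun Q _ ↦ ?_
    rw [translate_translate]
    exact hf _ fun h ↦ hR (by rw [eq_neg_of_add_eq_zero_left h]; exact neg_mem Q.2)

lemma valInf_sum_translate {f : 𝓜}
    (hf : ∀ Q : (E⁄k).toAffine.Point, Q ≠ 0 → 𝓿 (translate Q f) ≤ 1) (h1 : 1 < 𝓿 f) :
    𝓿 (∑ Q : G, translate Q.1 f) = 𝓿 f := by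
  rw [← Finset.add_sum_erase _ _ (Finset.mem_univ 0), ZeroMemClass.coe_zero, translate_zero,
    Valuation.map_add_eq_of_lt_left]
  refine lt_of_le_of_lt (Valuation.map_sum_le _ fun Q hQ ↦ ?_) h1
  exact hf _ fun h ↦ (Finset.mem_erase.1 hQ).1 (Subtype.ext h)

variable (G) in
/-- The monic polynomial whose roots are the translates of `x`. -/
noncomputable def translatePoly : 𝓜[X] := ∏ Q : G, (X - C (translate Q.1 (x (E⁄k).toAffine)))

lemma map_translate_translatePoly {R : (E⁄k).toAffine.Point} (hR : R ∈ G) :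
    (translatePoly G).map (translate R : 𝓜 →+* 𝓜) = translatePoly G := by
  rw [translatePoly, Polynomial.map_prod]
  refine Fintype.prod_equiv (Equiv.addLeft (⟨R, hR⟩ : G)) _ _ fun Q ↦ ?_
  rw [Polynomial.map_sub, map_X, map_C]
  exact congrArg (fun f ↦ X - C f) (translate_translate ..)

lemma coeff_translatePoly_mem (n : ℕ) : (translatePoly G).coeff n ∈ invariantRing G := by
  refine ⟨fun R hR ↦ ?_, fun R hR ↦ ?_⟩
  · conv_rhs => rw [← map_translate_translatePoly hR, coeff_map]
    rfl
  · have e : translate R ((translatePoly G).coeff n) = (∏ Q : G, (X - C (translate R (translate Q.1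
        (x (E⁄k).toAffine))))).coeff n := by
      have := coeff_map (p := translatePoly G) (translate R : 𝓜 →+* 𝓜) n
      rw [translatePoly, Polynomial.map_prod] at this
      simp only [Polynomial.map_sub, map_X, map_C] at this
      exact this.symm
    rw [e]
    refine valuation_coeff_prod_X_sub_C_le _ _ (fun Q _ ↦ ?_) n
    rw [translate_translate]
    exact valInf_translate_x_le fun h ↦ hR (by
      rw [eq_neg_of_add_eq_zero_left h]
      exact neg_mem Q.2)

/-- Only the factor of the zero point has a root with a pole at infinity, and that pole is double.
The bound makes each coefficient affine linear in the new coordinate `X`. -/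
lemma valInf_coeff_translatePoly_le (n : ℕ) :
    𝓿 ((translatePoly G).coeff n) ≤ WithZero.exp 2 := by
  rw [translatePoly, ← Finset.mul_prod_erase _ _ (Finset.mem_univ 0), ZeroMemClass.coe_zero,
    translate_zero, sub_mul, coeff_sub, coeff_C_mul]
  have h := valuation_coeff_prod_X_sub_C_le 𝓿 ((Finset.univ : Finset G).erase 0)
    (f := fun Q ↦ translate Q.1 (x (E⁄k).toAffine)) (fun Q hQ ↦ valInf_translate_x_le
      fun h ↦ (Finset.mem_erase.1 hQ).1 (Subtype.ext h))
  refine Valuation.map_sub_le _ ?_ ?_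
  · cases n with
    | zero => simp
    | succ n =>
      rw [coeff_X_mul]
      exact (h n).trans (exp_one_le (by norm_num))
  · rw [map_mul, valInf_x]
    exact mul_le_of_le_one_right' (h n)

lemma monic_translatePoly : (translatePoly G).Monic := monic_prod_X_sub_C ..

lemma natDegree_translatePoly : (translatePoly G).natDegree = Nat.card G := by
  rw [translatePoly, natDegree_prod_of_monic _ _ fun _ _ ↦ monic_X_sub_C _]
  simp

lemma eval_translatePoly : (translatePoly G).eval (x (E⁄k).toAffine) = 0 := by
  rw [translatePoly, eval_prod]
  refine Finset.prod_eq_zero (Finset.mem_univ 0) ?_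
  rw [ZeroMemClass.coe_zero, translate_zero, eval_sub, eval_X, eval_C, sub_self]

end Sum
end QuotientRing
end WeierstrassCurve.Affine

/-! ### The Weierstrass equation of the quotient -/

namespace WeierstrassCurve.Affine

section WeierstrassRelation
open WeierstrassCurve.Affine.FunctionField

variable {k : Type*} [Field k] (W : Affine k)

lemma exists_valInf_sub_le {f g : W.FunctionField} {m : ℤ} (hg : valInf W g = WithZero.exp m)
    (h : valInf W f ≤ WithZero.exp m) :
    ∃ c : k, valInf W (f - algebraMap k _ c * g) ≤ WithZero.exp (m - 1) := by
  have hg0 : g ≠ 0 := by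
    rw [← Valuation.ne_zero_iff (valInf W), hg]
    exact WithZero.exp_ne_zero
  obtain ⟨c, hc⟩ := exists_valInf_sub_lt W hg0 (h.trans hg.ge)
  refine ⟨c, ?_⟩
  rw [hg] at hc
  generalize valInf W (f - algebraMap k _ c * g) = a at hc
  rcases eq_or_ne a 0 with rfl | ha
  · exact zero_le
  · rw [← WithZero.exp_log ha, WithZero.exp_lt_exp] at hc
    rw [← WithZero.exp_log ha, WithZero.exp_le_exp]
    omega

variable {W} {A : Subalgebra k W.FunctionField}
  (hA : ∀ f ∈ A, valInf W f ≤ WithZero.exp 1 → ∃ c : k, f = algebraMap k _ c)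
include hA

/-- A function in the algebra with at most a double pole is affine linear in a function with a
double pole. -/
lemma exists_eq_of_valInf_le_two {X f : W.FunctionField} (hX : X ∈ A)
    (hvX : valInf W X = WithZero.exp 2) (hf : f ∈ A) (hvf : valInf W f ≤ WithZero.exp 2) :
    ∃ c d : k, f = algebraMap k _ c * X + algebraMap k _ d := by
  obtain ⟨c, hc⟩ := exists_valInf_sub_le W hvX hvf
  obtain ⟨d, hd⟩ := hA _ (A.sub_mem hf (A.mul_mem (A.algebraMap_mem c) hX)) hc
  exact ⟨c, d, by rw [← hd]; ring⟩

/-- Functions with a double and a triple pole and matching leading terms satisfy a Weierstrass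
equation. -/
lemma exists_equation_of_valInf_sub_le {X Y : W.FunctionField} (hX : X ∈ A) (hY : Y ∈ A)
    (hvX : valInf W X = WithZero.exp 2) (hvY : valInf W Y = WithZero.exp 3)
    (h : valInf W (Y ^ 2 - X ^ 3) ≤ WithZero.exp 5) :
    ∃ W' : WeierstrassCurve k, (W'.map (algebraMap k W.FunctionField)).toAffine.Equation X Y := by
  have hvXY : valInf W (X * Y) = WithZero.exp 5 := by
    rw [map_mul, hvX, hvY, ← WithZero.exp_add]
    rfl
  have hvX2 : valInf W (X ^ 2) = WithZero.exp 4 := by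
    rw [map_pow, hvX, ← WithZero.exp_nsmul]
    rfl
  -- The leading terms of orders five, four and three are removed by `XY`, `X²` and `Y`; what
  -- remains has at most a double pole and is affine linear in `X`.
  obtain ⟨c₁, h₁⟩ := exists_valInf_sub_le W hvXY h
  obtain ⟨c₂, h₂⟩ := exists_valInf_sub_le W hvX2 h₁
  obtain ⟨c₃, h₃⟩ := exists_valInf_sub_le W hvY h₂
  obtain ⟨c₄, c₆, h₄⟩ := exists_eq_of_valInf_le_two hA hX hvX
    (A.sub_mem (A.sub_mem (A.sub_mem (A.sub_mem (A.pow_mem hY 2) (A.pow_mem hX 3))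
      (A.mul_mem (A.algebraMap_mem c₁) (A.mul_mem hX hY)))
      (A.mul_mem (A.algebraMap_mem c₂) (A.pow_mem hX 2))) (A.mul_mem (A.algebraMap_mem c₃) hY)) h₃
  refine ⟨⟨-c₁, c₂, -c₃, c₄, c₆⟩, (equation_iff ..).2 ?_⟩
  simp only [map_a₁, map_a₂, map_a₃, map_a₄, map_a₆, map_neg]
  linear_combination h₄

/-- Functions with a double and a triple pole satisfy a Weierstrass equation, after scaling. -/
theorem exists_equation_of_valInf {X Y : W.FunctionField} (hX : X ∈ A) (hY : Y ∈ A)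
    (hvX : valInf W X = WithZero.exp 2) (hvY : valInf W Y = WithZero.exp 3) :
    ∃ W' : WeierstrassCurve k, ∃ X' ∈ A, ∃ Y' ∈ A, valInf W X' = WithZero.exp 2 ∧
      valInf W Y' = WithZero.exp 3 ∧
      (W'.map (algebraMap k W.FunctionField)).toAffine.Equation X' Y' := by
  have hvX3 : valInf W (X ^ 3) = WithZero.exp 6 := by
    rw [map_pow, hvX, ← WithZero.exp_nsmul]
    rfl
  have hvY2 : valInf W (Y ^ 2) = WithZero.exp 6 := by
    rw [map_pow, hvY, ← WithZero.exp_nsmul]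
    rfl
  obtain ⟨c, hc⟩ := exists_valInf_sub_le W hvX3 hvY2.le
  have hc0 : c ≠ 0 := by
    rintro rfl
    rw [map_zero, zero_mul, sub_zero, hvY2, WithZero.exp_le_exp] at hc
    norm_num at hc
  have hcA := A.algebraMap_mem c
  have hvc := valInf_algebraMap W hc0
  -- If `Y²` has the leading term of `c X³`, then `(cY)²` and `(cX)³` have the same leading term.
  have hX' := A.mul_mem hcA hX
  have hY' := A.mul_mem hcA hY
  have hvX' : valInf W (algebraMap k _ c * X) = WithZero.exp 2 := by rw [map_mul, hvc, one_mul, hvX]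
  have hvY' : valInf W (algebraMap k _ c * Y) = WithZero.exp 3 := by rw [map_mul, hvc, one_mul, hvY]
  have h6 : valInf W ((algebraMap k _ c * Y) ^ 2 - (algebraMap k _ c * X) ^ 3) ≤
      WithZero.exp 5 := by
    rw [show (algebraMap k _ c * Y) ^ 2 - (algebraMap k _ c * X) ^ 3 =
      algebraMap k _ c ^ 2 * (Y ^ 2 - algebraMap k _ c * X ^ 3) by ring, map_mul, map_pow, hvc,
      one_pow, one_mul]
    exact hc
  obtain ⟨W', h⟩ := exists_equation_of_valInf_sub_le hA hX' hY' hvX' hvY' h6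
  exact ⟨W', _, hX', _, hY', hvX', hvY', h⟩

end WeierstrassRelation

/-! ### Nonsingularity of the quotient -/

section SingularPoint
variable {k : Type*} [Field k]

/-- The right side is `a₁⁶` times the Weierstrass equation at the only candidate for a singular
point when `a₁ ≠ 0`. -/
lemma Δ_eq_of_two_eq_zero (W : WeierstrassCurve k) (h : (2 : k) = 0) : W.Δ =
    (W.a₃ ^ 2 + W.a₄ * W.a₁ ^ 2) ^ 2 + 2 * W.a₁ ^ 3 * W.a₃ * (W.a₃ ^ 2 + W.a₄ * W.a₁ ^ 2) -
      (W.a₃ ^ 3 * W.a₁ ^ 3 + W.a₂ * W.a₃ ^ 2 * W.a₁ ^ 4 + W.a₄ * W.a₃ * W.a₁ ^ 5 +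
        W.a₆ * W.a₁ ^ 6) := by
  rw [Δ, b₂, b₄, b₆, b₈]
  linear_combination -(
      14 * W.a₃ ^ 4 + 16 * W.a₁ ^ 2 * W.a₃ ^ 2 * W.a₄ + 6 * W.a₁ ^ 4 * W.a₂ * W.a₆ + 24 *
      W.a₁ ^ 2 * W.a₂ ^ 2 * W.a₆ + (-4) * W.a₁ ^ 3 * W.a₂ * W.a₃ * W.a₄ + 4 * W.a₁ ^ 2 *
      W.a₂ ^ 2 * W.a₃ ^ 2 + (-4) * W.a₁ ^ 2 * W.a₂ * W.a₄ ^ 2 + 32 * W.a₂ ^ 3 * W.a₆ + (-8)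
      * W.a₁ * W.a₂ ^ 2 * W.a₃ * W.a₄ + 8 * W.a₂ ^ 3 * W.a₃ ^ 2 + (-8) * W.a₂ ^ 2 * W.a₄ ^ 2
      + 32 * W.a₄ ^ 3 + 48 * W.a₁ * W.a₃ * W.a₄ ^ 2 + 108 * W.a₃ ^ 2 * W.a₆ + 216 * W.a₆ ^ 2
      + (-36) * W.a₁ ^ 2 * W.a₄ * W.a₆ + (-18) * W.a₁ ^ 3 * W.a₃ * W.a₆ + (-36) * W.a₂ *
      W.a₃ ^ 2 * W.a₄ + (-144) * W.a₂ * W.a₄ * W.a₆ + (-18) * W.a₁ * W.a₂ * W.a₃ ^ 3 + (-72)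
      * W.a₁ * W.a₂ * W.a₃ * W.a₆) * h

open scoped Classical in
/-- A Weierstrass curve with zero discriminant has a singular point. -/
theorem exists_singular_of_Δ_eq_zero [IsAlgClosed k] (W : WeierstrassCurve k) (h : W.Δ = 0) : ∃ x y : k, W.toAffine.Equation x y ∧
    2 * y + W.a₁ * x + W.a₃ = 0 ∧ W.a₁ * y = 3 * x ^ 2 + 2 * W.a₂ * x + W.a₄ := by
  by_cases h2 : (2 : k) = 0
  · by_cases h1 : W.a₁ = 0
    · have h3 : W.a₃ = 0 := by
        have : W.a₃ ^ 4 = 0 := by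
          rw [Δ_eq_of_two_eq_zero W h2, h1] at h
          linear_combination h
        exact pow_eq_zero_iff (by norm_num) |>.1 this
      -- In characteristic two with `a₁ = a₃ = 0` the partial derivatives vanish exactly when `x² =
      -- a₄`.
      obtain ⟨x, hx⟩ := IsAlgClosed.exists_pow_nat_eq W.a₄ (n := 2) (by norm_num)
      obtain ⟨y, hy⟩ := IsAlgClosed.exists_pow_nat_eq (x ^ 3 + W.a₂ * x ^ 2 + W.a₄ * x + W.a₆)
        (n := 2) (by norm_num)
      refine ⟨x, y, (equation_iff ..).2 ?_, ?_, ?_⟩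
      · rw [h1, h3]
        linear_combination hy
      · rw [h1, h3]
        linear_combination y * h2
      · rw [h1]
        linear_combination hx - (2 * x ^ 2 + W.a₂ * x) * h2
    -- In characteristic two the partial derivatives vanish when `a₁x = a₃` and `a₁y = x² + a₄`,
    -- which determines the point.
    · refine ⟨W.a₃ / W.a₁, ((W.a₃ / W.a₁) ^ 2 + W.a₄) / W.a₁, (equation_iff ..).2 ?_, ?_, ?_⟩
      · rw [Δ_eq_of_two_eq_zero W h2] at h
        field_simp
        linear_combination h
      · field_simp
        linear_combination  (W.a₃ ^ 2 + W.a₄ * W.a₁ ^ 2 + W.a₁ ^ 3 * W.a₃) * h2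
      · field_simp
        linear_combination -(W.a₃ ^ 2 + W.a₁ * W.a₂ * W.a₃) * h2
  · have hd : W.twoTorsionPolynomial.discr = 0 := by rw [W.twoTorsionPolynomial_discr, h, mul_zero]
    have h4 : (4 : k) ≠ 0 := by
      rw [show (4 : k) = 2 * 2 by norm_num]
      exact mul_ne_zero h2 h2
    -- Away from characteristic two a singular point comes from a repeated root of the 2-torsion
    -- cubic.
    have hnd : ¬ (W.twoTorsionPolynomial.map (RingHom.id k)).roots.Nodup := fun hnd ↦
      (Cubic.discr_ne_zero_iff_roots_nodup (P := W.twoTorsionPolynomial) (φ := RingHom.id k) h4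
        (IsAlgClosed.splits _)).2 hnd hd
    obtain ⟨x, hx⟩ : ∃ x, 1 < W.twoTorsionPolynomial.toPoly.rootMultiplicity x := by
      by_contra! hcon
      refine hnd ?_
      rw [Cubic.map_roots, Polynomial.map_id, Multiset.nodup_iff_count_le_one]
      intro x
      rw [count_roots]
      exact hcon x
    have hp0 : W.twoTorsionPolynomial.toPoly ≠ 0 := Cubic.ne_zero_of_a_ne_zero h4
    rw [one_lt_rootMultiplicity_iff_isRoot hp0] at hx
    simp only [IsRoot, twoTorsionPolynomial, Cubic.toPoly, b₂, b₄, b₆, derivative_add, derivative_mul,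
      derivative_C, derivative_X_pow, derivative_X, eval_add, eval_mul, eval_C, eval_X, eval_pow] at hx
    obtain ⟨hx1, hx2⟩ := hx
    simp at hx1 hx2
    refine ⟨x, -(W.a₁ * x + W.a₃) / 2, (equation_iff ..).2 ?_, ?_, ?_⟩
    · field_simp
      linear_combination -hx1
    · field_simp
      ring
    · have hx3 : 6 * x ^ 2 + (W.a₁ ^ 2 + 4 * W.a₂) * x + 2 * W.a₄ + W.a₁ * W.a₃ = 0 := by
        apply mul_left_cancel₀ h2
        linear_combination hx2
      field_simp
      linear_combination -hx3
end SingularPoint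

section Singular
open scoped Classical
open WeierstrassCurve.Affine.FunctionField WeierstrassCurve.Affine.Point

variable {K k : Type*} [Field K] [Field k] [Algebra K k] {E : WeierstrassCurve K} [E.IsElliptic]

local notation "𝓜" => FunctionFieldOver k E
local notation "𝓿" => valOver k E

lemma valuation_le_one_of_sq_add_mul {F : Type*} [Field F] (v : Valuation F ℤᵐ⁰) {t a b : F}
    (ha : v a ≤ 1) (hb : v b ≤ 1) (h : t ^ 2 + a * t = b) : v t ≤ 1 := by
  by_contra! ht
  have h1 : v (a * t) < v (t ^ 2) := by
    rw [map_mul, map_pow, sq]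
    refine lt_of_le_of_lt (mul_le_of_le_one_left' ha) ?_
    exact lt_mul_of_one_lt_left (zero_lt_one.trans ht) ht
  rw [← h, Valuation.map_add_eq_of_lt_left _ h1, map_pow] at hb
  exact absurd (one_lt_pow₀ ht two_ne_zero) (not_lt.2 hb)

/-- The curve traced by invariant functions with a double and a triple pole is nonsingular. -/
theorem Δ_ne_zero_of_equation [IsAlgClosed k] {G : AddSubgroup (E⁄k).toAffine.Point} [Finite G]
    (hn : (Nat.card G : k) ≠ 0) {W : WeierstrassCurve k} {X Y : 𝓜} (hX : X ∈ invariantRing G)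
    (hY : Y ∈ invariantRing G) (hvX : 𝓿 X = WithZero.exp 2) (hvY : 𝓿 Y = WithZero.exp 3)
    (h : (W.map (algebraMap k 𝓜)).toAffine.Equation X Y) : W.Δ ≠ 0 := by
  intro hΔ
  obtain ⟨a, b, hab, h1, h2⟩ := exists_singular_of_Δ_eq_zero W hΔ
  rw [equation_iff] at h hab
  simp only [map_a₁, map_a₂, map_a₃, map_a₄, map_a₆] at h
  have hu : 𝓿 (X - algebraMap k 𝓜 a) = WithZero.exp 2 := by
    rw [Valuation.map_sub_eq_of_lt_left, hvX]
    rw [hvX]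
    refine (valInf_algebraMap_le _ _).trans_lt ?_
    rw [← WithZero.exp_zero, WithZero.exp_lt_exp]
    norm_num
  have hw : 𝓿 (Y - algebraMap k 𝓜 b) = WithZero.exp 3 := by
    rw [Valuation.map_sub_eq_of_lt_left, hvY]
    rw [hvY]
    refine (valInf_algebraMap_le _ _).trans_lt ?_
    rw [← WithZero.exp_zero, WithZero.exp_lt_exp]
    norm_num
  have hu0 : X - algebraMap k 𝓜 a ≠ 0 := by
    rw [← Valuation.ne_zero_iff 𝓿, hu]
    exact WithZero.exp_ne_zero
  have hab' := congrArg (algebraMap k 𝓜) hab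
  have h1' := congrArg (algebraMap k 𝓜) h1
  have h2' := congrArg (algebraMap k 𝓜) h2
  simp only [map_add, map_mul, map_pow, map_ofNat, _root_.map_zero] at hab' h1' h2'
  -- The slope at the singular point satisfies a monic quadratic equation over the polynomials in
  -- `X`, so it is regular wherever `X` is. It is invariant with a simple pole at infinity, which is
  -- impossible.
  set t := (Y - algebraMap k 𝓜 b) / (X - algebraMap k 𝓜 a) with ht
  have htt : t ^ 2 + algebraMap k 𝓜 W.a₁ * t = X + algebraMap k 𝓜 (2 * a + W.a₂) := by
    rw [ht]
    simp only [map_add, map_mul, map_ofNat]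
    field_simp
    linear_combination h - hab' - (Y - algebraMap k 𝓜 b) * h1' - (X - algebraMap k 𝓜 a) * h2'
  have htv : 𝓿 t = WithZero.exp 1 := by
    rw [ht, map_div₀, hu, hw, ← WithZero.exp_sub]
    rfl
  have htA : t ∈ invariantRing G := by
    refine ⟨fun Q hQ ↦ ?_, fun Q hQ ↦ ?_⟩
    · rw [ht, map_div₀, map_sub, map_sub, hX.1 Q hQ, hY.1 Q hQ, AlgHom.commutes, AlgHom.commutes]
    · have h3 := congrArg (translate Q) htt
      rw [map_add, map_add, map_pow, map_mul, AlgHom.commutes, AlgHom.commutes] at h3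
      exact valuation_le_one_of_sq_add_mul _ (valInf_algebraMap_le _ _)
        (Valuation.map_add_le _ (hX.2 Q hQ) (valInf_algebraMap_le _ _)) h3
  obtain ⟨c, hc⟩ := exists_const_of_mem_invariantRing hn htA htv.le
  have h4 := valInf_algebraMap_le (E⁄k).toAffine c
  rw [← hc, htv, ← WithZero.exp_zero, WithZero.exp_le_exp] at h4
  norm_num at h4

end Singular
end WeierstrassCurve.Affine

/-- The extension is only normal; separability is needed for `z` alone, to ensure that an element
outside the base field has a second conjugate. -/
lemma mem_range_algebraMap_of_forall_fixed {F N : Type*} [Field F] [Field N] [Algebra F N]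
    [Normal F N] {z : N} (hz : IsSeparable F z) (h : ∀ σ : N ≃ₐ[F] N, σ z = z) :
    ∃ c : F, algebraMap F N c = z := by
  by_contra hcon
  obtain ⟨w, hne, hw⟩ := (notMem_iff_exists_ne_and_isConjRoot (K := F) (L := N) hz
    (Normal.splits inferInstance z)).1 (fun hmem ↦ hcon (Algebra.mem_bot.1 hmem))
  obtain ⟨σ, hσ⟩ := hw.symm.exists_algEquiv
  exact hne (hσ.symm.trans (h σ)).symm

/-! ### Base change of the function field and Galois descent -/

namespace WeierstrassCurve.Affine

section Valuation
open WeierstrassCurve.Affine.FunctionField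
variable {k : Type*} [Field k] (W : Affine k)

lemma valInf_aeval_add_mul (p q : k[X]) :
    valInf W (aeval (x W) p + aeval (x W) q * y W) =
      max (valInf W (aeval (x W) p)) (valInf W (aeval (x W) q) * WithZero.exp 3) := by
  rw [← valInf_y W, ← map_mul]
  by_cases hp : p = 0
  · rw [hp, map_zero, zero_add, map_zero, max_eq_right zero_le]
  by_cases hq : q = 0
  · rw [hq, map_zero, zero_mul, add_zero, map_zero, max_eq_left zero_le]
  refine Valuation.map_add_of_distinct_val _ ?_
  rw [map_mul, valInf_polynomial W hp, valInf_polynomial W hq, valInf_y, ← WithZero.exp_add, Ne,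
    WithZero.exp_inj]
  omega

end Valuation

section BaseChange
open scoped Classical
open WeierstrassCurve.Affine.FunctionField WeierstrassCurve.Affine.Point

variable {K : Type*} (k : Type*) [Field K] [Field k] [Algebra K k] (E : WeierstrassCurve K)

local notation "𝓜" => FunctionFieldOver k E
local notation "𝓿" => valOver k E

lemma aeval_x_baseChange (p : K[X]) :
    aeval (x (E⁄k).toAffine) p = aeval (x (E⁄k).toAffine) (p.map (algebraMap K k)) :=
  (aeval_map_algebraMap k _ p).symm

lemma valInf_aeval_x_baseChange (p : K[X]) :
    𝓿 (aeval (x (E⁄k).toAffine) p) = valInf E.toAffine (aeval (x E.toAffine) p) := by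
  by_cases hp : p = 0
  · rw [hp, _root_.map_zero, _root_.map_zero, _root_.map_zero, _root_.map_zero]
  · rw [aeval_x_baseChange, valInf_polynomial _ hp, valInf_polynomial _
      ((Polynomial.map_ne_zero_iff (algebraMap K k).injective).2 hp), natDegree_map]

lemma eval₂_x_baseChange_ne_zero {p : K[X]} (hp : p ≠ 0) :
    p.eval₂ (algebraMap K 𝓜) (x (E⁄k).toAffine) ≠ 0 := by
  have h := aeval_x_ne_zero (E⁄k).toAffine
    ((Polynomial.map_ne_zero_iff (algebraMap K k).injective).2 hp)
  rwa [← aeval_x_baseChange] at h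

lemma equation_baseChange_xy :
    (E.map (algebraMap K 𝓜)).toAffine.Equation (x (E⁄k).toAffine) (y (E⁄k).toAffine) := by
  have h := equation_xy (E⁄k).toAffine
  have e : (E⁄k).map (algebraMap k 𝓜) = E.map (algebraMap K 𝓜) := by
    ext <;> simp [← IsScalarTower.algebraMap_apply]
  exact e ▸ h

/-- The inclusion of function fields given by a base change. -/
noncomputable def functionFieldBaseChange : E.toAffine.FunctionField →ₐ[K] 𝓜 :=
  { FunctionField.lift (algebraMap K 𝓜) (equation_baseChange_xy k E)
      (fun _ hp ↦ eval₂_x_baseChange_ne_zero k E hp) with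
    commutes' := fun r ↦ lift_algebraMap _ _ (fun _ hp ↦ eval₂_x_baseChange_ne_zero k E hp) r }

@[simp] lemma functionFieldBaseChange_x :
    functionFieldBaseChange k E (x E.toAffine) = x (E⁄k).toAffine :=
  lift_x _ _ (fun _ hp ↦ eval₂_x_baseChange_ne_zero k E hp)

@[simp] lemma functionFieldBaseChange_y :
    functionFieldBaseChange k E (y E.toAffine) = y (E⁄k).toAffine :=
  lift_y _ _ (fun _ hp ↦ eval₂_x_baseChange_ne_zero k E hp)

@[simp] lemma valInf_functionFieldBaseChange (f : E.toAffine.FunctionField) :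
    𝓿 (functionFieldBaseChange k E f) = valInf E.toAffine f := by
  have key (a : E.toAffine.CoordinateRing) :
      𝓿 (functionFieldBaseChange k E (algebraMap _ _ a)) = valInf E.toAffine (algebraMap _ _ a) := by
    obtain ⟨p, q, rfl⟩ := CoordinateRing.exists_eq _ a
    rw [map_add (algebraMap _ _), map_mul (algebraMap _ _), algebraMap_aeval, algebraMap_aeval, ← y, map_add,
      map_mul, ← aeval_algHom_apply, ← aeval_algHom_apply, functionFieldBaseChange_x,
      functionFieldBaseChange_y, valInf_aeval_add_mul, ← valInf_aeval_x_baseChange k E,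
      ← valInf_aeval_x_baseChange k E, aeval_x_baseChange k E, aeval_x_baseChange k E,
      valInf_aeval_add_mul]
  obtain ⟨a, b, -, rfl⟩ := exists_eq_div _ f
  rw [map_div₀, map_div₀, map_div₀, key, key]

end BaseChange

section Compare
open scoped Classical
open WeierstrassCurve.Affine.FunctionField WeierstrassCurve.Affine.Point

variable {K k : Type*} [Field K] [Field k] [Algebra K k] (E : WeierstrassCurve K) [E.IsElliptic]
  [Algebra.IsAlgebraic K k]
  (N : Type*) [Field N] [Algebra E.toAffine.FunctionField N] [Algebra k N] [Algebra K N]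
  [IsScalarTower K E.toAffine.FunctionField N] [IsScalarTower K k N]

local notation "𝓜" => FunctionFieldOver k E
local notation "𝓿" => valOver k E
local notation "𝓕" => FunctionField (toAffine E)

omit [E.IsElliptic] in
-- As `k` is algebraic over `K`, an algebraic relation over `k` would give one over `K`.
lemma transcendental_x : Transcendental k (algebraMap 𝓕 N (x E.toAffine)) := by
  intro h
  have h' : IsAlgebraic K (algebraMap 𝓕 N (x E.toAffine)) := h.restrictScalars K
  rw [isAlgebraic_algebraMap_iff (algebraMap 𝓕 N).injective] at h'
  obtain ⟨p, hp, hp'⟩ := h'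
  exact aeval_x_ne_zero E.toAffine hp hp'

lemma eval₂_algebraMap_x_ne_zero {p : k[X]} (hp : p ≠ 0) :
    p.eval₂ (algebraMap k N) (algebraMap 𝓕 N (x E.toAffine)) ≠ 0 :=
  fun h ↦ transcendental_x (k := k) E N ⟨p, hp, h⟩

lemma equation_algebraMap_xy : ((E⁄k).map (algebraMap k N)).toAffine.Equation
    (algebraMap 𝓕 N (x E.toAffine)) (algebraMap 𝓕 N (y E.toAffine)) := by
  have h := (equation_xy E.toAffine).map (algebraMap 𝓕 N)
  have e : ((E.map (algebraMap K 𝓕)).map (algebraMap 𝓕 N)) = (E⁄k).map (algebraMap k N) := by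
    ext <;> simp [← IsScalarTower.algebraMap_apply]
  exact e ▸ h

/-- The embedding of the function field of a base change in a field containing both the function
field and the larger field of constants. -/
noncomputable def compositum : 𝓜 →ₐ[k] N :=
  { FunctionField.lift (algebraMap k N) (equation_algebraMap_xy E N)
      (fun _ hp ↦ eval₂_algebraMap_x_ne_zero E N hp) with
    commutes' := fun r ↦ lift_algebraMap _ _ (fun _ hp ↦ eval₂_algebraMap_x_ne_zero E N hp) r }

@[simp] lemma compositum_x :
    compositum E N (x (E⁄k).toAffine) = algebraMap 𝓕 N (x E.toAffine) :=
  lift_x _ _ (fun _ hp ↦ eval₂_algebraMap_x_ne_zero E N hp)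

@[simp] lemma compositum_y :
    compositum E N (y (E⁄k).toAffine) = algebraMap 𝓕 N (y E.toAffine) :=
  lift_y _ _ (fun _ hp ↦ eval₂_algebraMap_x_ne_zero E N hp)

lemma compositum_baseChange (f : 𝓕) :
    compositum (k := k) E N (functionFieldBaseChange k E f) = algebraMap 𝓕 N f := by
  have : ((compositum E N : 𝓜 →ₐ[k] N) : 𝓜 →+* N).comp (functionFieldBaseChange k E : 𝓕 →+* 𝓜) =
      algebraMap 𝓕 N := by
    refine FunctionField.hom_ext (fun r ↦ ?_) ?_ ?_
    · rw [RingHom.comp_apply, RingHom.coe_coe, RingHom.coe_coe, AlgHom.commutes, IsScalarTower.algebraMap_apply K k 𝓜,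
        AlgHom.commutes, ← IsScalarTower.algebraMap_apply, ← IsScalarTower.algebraMap_apply]
    · simp
    · simp
  exact congrArg (fun g ↦ g f) this

end Compare
end WeierstrassCurve.Affine

namespace WeierstrassCurve.Affine

lemma Point.coord_add_mem {F : Type*} [Field F] [DecidableEq F] {W : Affine F} (S : Subfield F)
    (ha₁ : W.a₁ ∈ S) (ha₂ : W.a₂ ∈ S) (ha₃ : W.a₃ ∈ S) {P Q : W.Point} (hP : P ≠ 0) (hQ : Q ≠ 0)
    (hne : P.xCoord ≠ Q.xCoord) (hxP : P.xCoord ∈ S) (hyP : P.yCoord ∈ S) (hxQ : Q.xCoord ∈ S)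
    (hyQ : Q.yCoord ∈ S) : (P + Q).xCoord ∈ S ∧ (P + Q).yCoord ∈ S := by
  rw [xCoord_add hP hQ hne, yCoord_add hP hQ hne]
  have hs := S.div_mem (S.sub_mem hyP hyQ) (S.sub_mem hxP hxQ)
  generalize (P.yCoord - Q.yCoord) / (P.xCoord - Q.xCoord) = s at hs
  have hX : W.addX P.xCoord Q.xCoord s ∈ S := S.sub_mem (S.sub_mem (S.sub_mem
      (S.add_mem (S.pow_mem hs 2) (S.mul_mem ha₁ hs)) ha₂) hxP) hxQ
  refine ⟨hX, ?_⟩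
  rw [addY, negAddY, negY]
  exact S.sub_mem (S.sub_mem (S.neg_mem (S.add_mem (S.mul_mem hs (S.sub_mem hX hxP)) hyP))
    (S.mul_mem ha₁ hX)) ha₃

section Descent
open scoped Classical
open WeierstrassCurve.Affine.FunctionField WeierstrassCurve.Affine.Point

variable {K k : Type*} [Field K] [Field k] [Algebra K k] (E : WeierstrassCurve K) [E.IsElliptic]
  [Normal K k]
  (N : Type*) [Field N] [Algebra E.toAffine.FunctionField N] [Algebra k N] [Algebra K N]
  [IsScalarTower K E.toAffine.FunctionField N] [IsScalarTower K k N]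

local notation "𝓜" => FunctionFieldOver k E
local notation "𝓿" => valOver k E
local notation "𝓕" => FunctionField (toAffine E)

lemma map_compositum_constPoint (Q : (E⁄k).toAffine.Point) :
    Point.map (compositum E N : 𝓜 →ₐ[k] N) (constPoint Q) = Point.map (Algebra.ofId k N) Q := by
  by_cases hQ : Q = 0
  · rw [hQ, _root_.map_zero, _root_.map_zero, _root_.map_zero]
  refine ext_coord (map_ne_zero _ (constPoint_ne_zero hQ)) (map_ne_zero _ hQ) ?_ ?_
  · rw [xCoord_map, xCoord_constPoint, AlgHom.commutes, xCoord_map, Algebra.ofId_apply]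
  · rw [yCoord_map, yCoord_constPoint, AlgHom.commutes, yCoord_map, Algebra.ofId_apply]

lemma compositum_translate_x (Q : (E⁄k).toAffine.Point) :
    compositum E N (translate Q (x (E⁄k).toAffine)) =
      (Point.map (compositum E N : 𝓜 →ₐ[k] N) (genericPoint k E) +
        Point.map (Algebra.ofId k N) Q).xCoord := by
  rw [translate_x, ← map_compositum_constPoint, ← map_add, xCoord_map]

lemma compositum_translate_y (Q : (E⁄k).toAffine.Point) :
    compositum E N (translate Q (y (E⁄k).toAffine)) =
      (Point.map (compositum E N : 𝓜 →ₐ[k] N) (genericPoint k E) +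
        Point.map (Algebra.ofId k N) Q).yCoord := by
  rw [translate_y, ← map_compositum_constPoint, ← map_add, yCoord_map]

lemma xCoord_map_compositum_genericPoint :
    (Point.map (compositum E N : 𝓜 →ₐ[k] N) (genericPoint k E)).xCoord =
      algebraMap 𝓕 N (x E.toAffine) := by
  rw [xCoord_map, xCoord_genericPoint, compositum_x]

lemma yCoord_map_compositum_genericPoint :
    (Point.map (compositum E N : 𝓜 →ₐ[k] N) (genericPoint k E)).yCoord =
      algebraMap 𝓕 N (y E.toAffine) := by
  rw [yCoord_map, yCoord_genericPoint, compositum_y]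

section Galois
variable {N} (σ : N ≃ₐ[E.toAffine.FunctionField] N)

lemma map_genericPoint_of_algEquiv :
    Point.map (σ.restrictScalars K : N →ₐ[K] N)
        (Point.map (compositum E N : 𝓜 →ₐ[k] N) (genericPoint k E)) =
      Point.map (compositum E N : 𝓜 →ₐ[k] N) (genericPoint k E) := by
  have h := map_ne_zero (compositum E N : 𝓜 →ₐ[k] N) (genericPoint_ne_zero k E)
  refine ext_coord (map_ne_zero _ h) h ?_ ?_
  · rw [xCoord_map, xCoord_map_compositum_genericPoint]
    exact σ.commutes _
  · rw [yCoord_map, yCoord_map_compositum_genericPoint]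
    exact σ.commutes _

lemma map_ofId_of_algEquiv (Q : (E⁄k).toAffine.Point) :
    Point.map (σ.restrictScalars K : N →ₐ[K] N) (Point.map (Algebra.ofId k N) Q) =
      Point.map (Algebra.ofId k N)
        (Point.map ((σ.restrictScalars K).restrictNormal k : k →ₐ[K] k) Q) := by
  by_cases hQ : Q = 0
  · simp only [hQ, _root_.map_zero]
  refine ext_coord (map_ne_zero _ (map_ne_zero _ hQ)) (map_ne_zero _ (map_ne_zero _ hQ)) ?_ ?_
  · simp only [xCoord_map, Algebra.ofId_apply]
    exact ((σ.restrictScalars K).restrictNormal_commutes k _).symm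
  · simp only [yCoord_map, Algebra.ofId_apply]
    exact ((σ.restrictScalars K).restrictNormal_commutes k _).symm

/-- The automorphism fixes the generic point and acts on constant points through its restriction to
`k`. Hence it permutes the translates by a Galois stable group. -/
lemma algEquiv_compositum_translate (Q : (E⁄k).toAffine.Point) (f : 𝓕) :
    σ (compositum E N (translate Q (functionFieldBaseChange k E f))) =
      compositum E N (translate
        (Point.map ((σ.restrictScalars K).restrictNormal k : k →ₐ[K] k) Q)
        (functionFieldBaseChange k E f)) := by
  have key (R : (E⁄k).toAffine.Point) (r : K) : compositum E N (translate R
      (functionFieldBaseChange k E (algebraMap K 𝓕 r))) =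
        algebraMap 𝓕 N (algebraMap K 𝓕 r) := by
    rw [AlgHom.commutes, IsScalarTower.algebraMap_apply K k 𝓜, AlgHom.commutes, AlgHom.commutes,
      ← IsScalarTower.algebraMap_apply, ← IsScalarTower.algebraMap_apply]
  have : ((σ : N →+* N).comp ((compositum E N : 𝓜 →ₐ[k] N) : 𝓜 →+* N)).comp
      ((translate Q : 𝓜 →+* 𝓜).comp (functionFieldBaseChange k E : 𝓕 →+* 𝓜)) =
      (((compositum E N : 𝓜 →ₐ[k] N) : 𝓜 →+* N)).comp
      ((translate (Point.map ((σ.restrictScalars K).restrictNormal k : k →ₐ[K] k) Q) :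
        𝓜 →+* 𝓜).comp (functionFieldBaseChange k E : 𝓕 →+* 𝓜)) := by
    refine FunctionField.hom_ext (fun r ↦ ?_) ?_ ?_
    · simp only [RingHom.comp_apply, RingHom.coe_coe]
      rw [key, key]
      exact σ.commutes _
    · simp only [RingHom.comp_apply, RingHom.coe_coe, functionFieldBaseChange_x]
      rw [compositum_translate_x, compositum_translate_x, ← map_ofId_of_algEquiv]
      conv_rhs => rw [← map_genericPoint_of_algEquiv E σ, ← map_add, xCoord_map]
      rfl
    · simp only [RingHom.comp_apply, RingHom.coe_coe, functionFieldBaseChange_y]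
      rw [compositum_translate_y, compositum_translate_y, ← map_ofId_of_algEquiv]
      conv_rhs => rw [← map_genericPoint_of_algEquiv E σ, ← map_add, yCoord_map]
      rfl
  exact congrArg (fun g ↦ g f) this

end Galois

section Separable
variable {Q : (E⁄k).toAffine.Point} (hx : IsSeparable K Q.xCoord) (hy : IsSeparable K Q.yCoord)
include hx hy

/-- The addition formulas stay inside the separable closure of the function field of `E`. This is
needed because `k` may be inseparable over `K`. -/
lemma isSeparable_compositum_translate :
    IsSeparable 𝓕 (compositum E N (translate Q (x (E⁄k).toAffine))) ∧
      IsSeparable 𝓕 (compositum E N (translate Q (y (E⁄k).toAffine))) := by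
  by_cases hQ : Q = 0
  · rw [hQ, translate_zero, translate_zero, compositum_x, compositum_y]
    exact ⟨isSeparable_algebraMap _, isSeparable_algebraMap _⟩
  have hη := map_ne_zero (compositum E N : 𝓜 →ₐ[k] N) (genericPoint_ne_zero k E)
  have hQ' := map_ne_zero (Algebra.ofId k N) hQ
  have hne : (Point.map (compositum E N : 𝓜 →ₐ[k] N) (genericPoint k E)).xCoord ≠
      (Point.map (Algebra.ofId k N) Q).xCoord := by
    rw [← map_compositum_constPoint E N, xCoord_map, xCoord_map]
    exact fun h ↦ genericPoint_xCoord_ne hQ ((compositum E N : 𝓜 →ₐ[k] N).injective h)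
  rw [compositum_translate_x, compositum_translate_y]
  obtain ⟨S, hS⟩ : ∃ S : Subfield N, ∀ z, z ∈ S ↔ IsSeparable 𝓕 z :=
    ⟨(separableClosure 𝓕 N).toSubfield, fun _ ↦ mem_separableClosure_iff⟩
  have hF (z : 𝓕) : algebraMap 𝓕 N z ∈ S := (hS _).2 (isSeparable_algebraMap z)
  have hK (c : K) : algebraMap K N c ∈ S := by
    rw [IsScalarTower.algebraMap_apply K 𝓕 N]
    exact hF _
  have hk {c : k} (hc : IsSeparable K c) : algebraMap k N c ∈ S := (hS _).2
    ((hc.map (IsScalarTower.toAlgHom K k N) (algebraMap k N).injective).tower_top 𝓕)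
  have ha₁ : (E⁄N).a₁ ∈ S := hK _
  have ha₂ : (E⁄N).a₂ ∈ S := hK _
  have ha₃ : (E⁄N).a₃ ∈ S := hK _
  rw [← hS, ← hS]
  refine Point.coord_add_mem S ha₁ ha₂ ha₃ hη hQ' hne ?_ ?_ ?_ ?_
  · rw [xCoord_map_compositum_genericPoint]
    exact hF _
  · rw [yCoord_map_compositum_genericPoint]
    exact hF _
  · rw [xCoord_map, Algebra.ofId_apply]
    exact hk hx
  · rw [yCoord_map, Algebra.ofId_apply]
    exact hk hy

end Separable

section Descent
variable [Normal E.toAffine.FunctionField N] {G : AddSubgroup (E⁄k).toAffine.Point} [Fintype G]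
  (hG : ∀ σ : k ≃ₐ[K] k, ∀ Q ∈ G, Point.map (σ : k →ₐ[K] k) Q ∈ G)
  (hsep : ∀ Q ∈ G, IsSeparable K Q.xCoord ∧ IsSeparable K Q.yCoord)

/-- The permutation of a stable group of points given by an automorphism. -/
noncomputable def permOfStable (σ : k ≃ₐ[K] k) : G ≃ G :=
  Equiv.ofBijective (fun Q ↦ ⟨Point.map (σ : k →ₐ[K] k) Q.1, hG σ Q.1 Q.2⟩)
    (Finite.injective_iff_bijective.1 fun _ _ h ↦
      Subtype.ext (Point.map_injective _ (congrArg Subtype.val h)))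

include hG hsep N

/-- Automorphisms over the function field of `E` permute the summands, and each summand is
separable, so the trace descends. -/
lemma exists_baseChange_eq_sum {f : 𝓕} (hf : f = x E.toAffine ∨ f = y E.toAffine) :
    ∃ g : 𝓕, functionFieldBaseChange k E g =
      ∑ Q : G, translate Q.1 (functionFieldBaseChange k E f) := by
  obtain ⟨g, hg⟩ := mem_range_algebraMap_of_forall_fixed (F := 𝓕) (N := N)
    (z := compositum E N (∑ Q : G, translate Q.1 (functionFieldBaseChange k E f)))
    (by
      rw [map_sum, ← mem_separableClosure_iff]
      refine sum_mem fun Q _ ↦ ?_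
      have h := isSeparable_compositum_translate E N (hsep Q.1 Q.2).1 (hsep Q.1 Q.2).2
      rw [mem_separableClosure_iff]
      rcases hf with rfl | rfl
      · rw [functionFieldBaseChange_x]
        exact h.1
      · rw [functionFieldBaseChange_y]
        exact h.2)
    (fun σ ↦ by
      rw [map_sum, map_sum]
      refine Fintype.sum_equiv (permOfStable E hG ((σ.restrictScalars K).restrictNormal k)) _ _
        fun Q ↦ ?_
      exact algEquiv_compositum_translate E σ Q.1 f)
  exact ⟨g, (compositum E N : 𝓜 →ₐ[k] N).injective ((compositum_baseChange E N g).trans hg)⟩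

lemma exists_baseChange_eq_translatePoly :
    ∃ p : 𝓕[X], p.map (functionFieldBaseChange k E : 𝓕 →+* 𝓜) =
    translatePoly G := by
  suffices ∀ n, ∃ g : 𝓕, functionFieldBaseChange k E g = (translatePoly G).coeff n by
    have h : translatePoly G ∈ lifts (functionFieldBaseChange k E : 𝓕 →+* 𝓜) :=
      (lifts_iff_coeff_lifts _).2 this
    exact h
  intro n
  have hmap (σ : N →+* N) : σ (compositum E N ((translatePoly G).coeff n)) =
      (∏ Q : G, (X - C (σ (compositum E N (translate Q.1 (x (E⁄k).toAffine)))))).coeff n := by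
    have := coeff_map (p := translatePoly G)
      (σ.comp ((compositum E N : 𝓜 →ₐ[k] N) : 𝓜 →+* N)) n
    rw [translatePoly, Polynomial.map_prod] at this
    simp only [Polynomial.map_sub, map_X, map_C] at this
    exact this.symm
  obtain ⟨g, hg⟩ := mem_range_algebraMap_of_forall_fixed (F := 𝓕) (N := N)
    (z := compositum E N ((translatePoly G).coeff n))
    (by
      have h : ∏ Q : G, (X - C (compositum E N (translate Q.1 (x (E⁄k).toAffine)))) ∈
          liftsRing (separableClosure 𝓕 N).toSubfield.subtype := by
        refine prod_mem fun Q _ ↦ sub_mem ?_ ?_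
        · exact (lifts_iff_liftsRing _ _).1 (X_mem_lifts _)
        · have h := isSeparable_compositum_translate E N (hsep Q.1 Q.2).1 (hsep Q.1 Q.2).2
          exact (lifts_iff_liftsRing _ _).1 (C_mem_lifts (separableClosure 𝓕 N).toSubfield.subtype
            (⟨_, h.1⟩ : (separableClosure 𝓕 N).toSubfield))
      obtain ⟨w, hw⟩ := (lifts_iff_coeff_lifts _).1 ((lifts_iff_liftsRing _ _).2 h) n
      have e := hmap (RingHom.id N)
      simp only [RingHom.id_apply] at e
      rw [e, ← hw]
      exact w.2)
    (fun σ ↦ by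
      have e₁ := hmap (σ : N →+* N)
      have e₂ := hmap (RingHom.id N)
      simp only [RingHom.id_apply] at e₂
      refine e₁.trans (Eq.trans ?_ e₂.symm)
      congr 1
      refine Fintype.prod_equiv (permOfStable E hG ((σ.restrictScalars K).restrictNormal k)) _ _
        fun Q ↦ ?_
      have := algEquiv_compositum_translate E σ Q.1 (x E.toAffine)
      rw [functionFieldBaseChange_x] at this
      exact congrArg (fun z ↦ X - C z) this)
  exact ⟨g, (compositum E N : 𝓜 →ₐ[k] N).injective ((compositum_baseChange E N g).trans hg)⟩

end Descent
end Descent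
end WeierstrassCurve.Affine

/-- The generator is a root of a polynomial of degree `|ι|`, which bounds the degree above; the
distinct embeddings agreeing on `S` bound it below. -/
lemma finrank_eq_card_of_adjoin_eq_top {S F M ι : Type*} [Field S] [Field F] [Field M] [Algebra S F]
    [Fintype ι] [Nonempty ι] (f : ι → F →+* M) (hf : Function.Injective f)
    (h : ∀ i j s, f i (algebraMap S F s) = f j (algebraMap S F s)) {x : F}
    (hx : IntermediateField.adjoin S {x} = ⊤) {p : S[X]} (hp : p.Monic)
    (hpn : p.natDegree = Fintype.card ι) (hpx : aeval x p = 0) :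
    Module.finrank S F = Fintype.card ι := by
  obtain ⟨i₀⟩ := ‹Nonempty ι›
  have hint : IsIntegral S x := ⟨p, hp, hpx⟩
  have hfin : FiniteDimensional S F := by
    have h₁ := IntermediateField.adjoin.finiteDimensional hint
    rw [hx] at h₁
    exact (IntermediateField.topEquiv (F := S) (E := F)).toLinearEquiv.finiteDimensional
  have hle : Module.finrank S F ≤ Fintype.card ι := by
    rw [← IntermediateField.finrank_top', ← hx, IntermediateField.adjoin.finrank hint, ← hpn]
    exact natDegree_le_of_dvd (minpoly.dvd S x hpx) hp.ne_zero
  refine le_antisymm hle ?_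
  let _ : Algebra S M := ((f i₀).comp (algebraMap S F)).toAlgebra
  let g (i : ι) : F →ₐ[S] M := { f i with commutes' := fun s ↦ h i i₀ s }
  have hg : Function.Injective g := fun i j hij ↦
    hf (RingHom.ext fun z ↦ congrArg (fun φ ↦ φ z) hij)
  rw [← Nat.card_eq_fintype_card]
  exact (Nat.card_le_card_of_injective g hg).trans (card_algHom_le_finrank S F M)

namespace WeierstrassCurve.Affine

section FunctionField
open WeierstrassCurve.Affine.FunctionField
variable {k : Type*} [Field k] (W : Affine k)

lemma hasPoleAtInfinity_of_one_lt {W : WeierstrassCurve k} {f : W.toAffine.FunctionField}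
    (h : 1 < valInf W.toAffine f) : EllipticPreimage.HasPoleAtInfinity W f := by
  obtain ⟨a, b, hb, rfl⟩ := exists_eq_div _ f
  have ha : a ≠ 0 := by
    rintro rfl
    rw [map_zero, zero_div, map_zero] at h
    exact absurd h (not_lt.2 zero_le)
  refine ⟨a, b, hb, rfl, ?_⟩
  rw [map_div₀, valInf_coe, valInf_coe, CoordinateRing.valInf_apply _ ha,
    CoordinateRing.valInf_apply _ hb, ← WithZero.exp_sub, ← WithZero.exp_zero,
    WithZero.exp_lt_exp] at h
  omega

variable {W}

/-- The inverse of `f` has a zero at infinity, so the argument for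
`aeval_ne_zero_of_valuation_lt_one` applies to it and the reversed polynomial. -/
lemma aeval_ne_zero_of_one_lt_valInf {f : W.FunctionField} (h : 1 < valInf W f) {p : k[X]}
    (hp : p ≠ 0) : aeval f p ≠ 0 := by
  have hf : f ≠ 0 := by
    rintro rfl
    rw [map_zero] at h
    exact absurd h (not_lt.2 zero_le)
  intro h0
  have : Invertible f := invertibleOfNonzero hf
  have h₁ := (eval₂_reverse_eq_zero_iff (algebraMap k W.FunctionField) f p).2 h0
  refine aeval_ne_zero_of_valuation_lt_one (valInf W) (valInf_algebraMap_le W) (u := ⅟f) ?_ ?_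
    (p := p.reverse) ?_ h₁
  · rw [invOf_eq_inv, map_inv₀]
    exact inv_lt_one_of_one_lt₀ h
  · rw [invOf_eq_inv]
    exact inv_ne_zero hf
  · rwa [Ne, reverse_eq_zero]

/-- A function with a triple pole generates the function field together with `x`. -/
lemma eq_top_of_mem {T : IntermediateField k W.FunctionField} {f : W.FunctionField}
    (hx : x W ∈ T) (hf : f ∈ T) (hv : valInf W f = WithZero.exp 3) : T = ⊤ := by
  have hpoly (p : k[X]) : aeval (x W) p ∈ T := by
    have := (aeval (⟨x W, hx⟩ : T) p).2
    rwa [← IntermediateField.aeval_coe] at this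
  have hy : y W ∈ T := by
    obtain ⟨a, b, hb, hab⟩ := exists_eq_div W f
    obtain ⟨b', hb'⟩ := CoordinateRing.algebraMap_norm_eq_mul W b
    have hN := CoordinateRing.norm_ne_zero W hb
    have hN' := aeval_x_ne_zero W hN
    rw [CoordinateRing.algebraMap_polynomial] at hb'
    replace hb' := congrArg (algebraMap _ W.FunctionField) hb'
    rw [algebraMap_aeval, map_mul] at hb'
    obtain ⟨p, q, hpq⟩ := CoordinateRing.exists_eq W (a * b')
    have h : f * aeval (x W) (Algebra.norm k[X] b) = aeval (x W) p + aeval (x W) q * y W := by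
      rw [hab, hb', ← mul_assoc, div_mul_cancel₀ _ (coe_ne_zero W hb), ← map_mul, hpq, map_add,
        map_mul, algebraMap_aeval, algebraMap_aeval, ← y]
    -- A rational function of `x` alone has even order at infinity, whereas the order of `f` is
    -- three.
    have hq : q ≠ 0 := by
      rintro rfl
      rw [map_zero, zero_mul, add_zero] at h
      have hp : p ≠ 0 := by
        rintro rfl
        rw [map_zero] at h
        refine mul_ne_zero ?_ hN' h
        rw [← Valuation.ne_zero_iff (valInf W), hv]
        exact WithZero.exp_ne_zero
      have h' := congrArg (valInf W) h
      rw [map_mul, hv, valInf_polynomial W hN, valInf_polynomial W hp, ← WithZero.exp_add,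
        WithZero.exp_inj] at h'
      omega
    have e : y W = (f * aeval (x W) (Algebra.norm k[X] b) - aeval (x W) p) / aeval (x W) q := by
      rw [h, add_sub_cancel_left, mul_div_cancel_left₀ _ (aeval_x_ne_zero W hq)]
    rw [e]
    exact T.div_mem (T.sub_mem (T.mul_mem hf (hpoly _)) (hpoly _)) (hpoly _)
  rw [eq_top_iff]
  intro g _
  obtain ⟨a, b, -, rfl⟩ := exists_eq_div W g
  have key (a : W.CoordinateRing) : algebraMap _ W.FunctionField a ∈ T := by
    obtain ⟨p, q, rfl⟩ := CoordinateRing.exists_eq W a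
    rw [map_add, map_mul, algebraMap_aeval, algebraMap_aeval, ← y]
    exact T.add_mem (hpoly _) (T.mul_mem (hpoly _) hy)
  exact T.div_mem (key a) (key b)

end FunctionField
end WeierstrassCurve.Affine

/-! ### The quotient isogeny over the base field -/

namespace WeierstrassCurve.Affine

section Isogeny
open scoped Classical
open WeierstrassCurve.Affine.FunctionField WeierstrassCurve.Affine.Point

variable {K k : Type*} [Field K] [Field k] [Algebra K k] (E : WeierstrassCurve K) [E.IsElliptic]

local notation "𝓜" => FunctionFieldOver k E
local notation "𝓿" => valOver k E
local notation "𝓕" => FunctionField (toAffine E)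

variable {E} in
/-- The functions over the base field whose base change lies in the invariant ring. -/
noncomputable def invariantRingBase (G : AddSubgroup (E⁄k).toAffine.Point) :
    Subalgebra K E.toAffine.FunctionField :=
  ((invariantRing G).restrictScalars K).comap (functionFieldBaseChange k E)

variable [IsAlgClosed k] {G : AddSubgroup (E⁄k).toAffine.Point}

lemma mem_invariantRingBase {f : 𝓕} :
    f ∈ invariantRingBase G ↔ functionFieldBaseChange k E f ∈ invariantRing G := Iff.rfl

/-- The function is a constant `d` of `k` after base change. Its value at infinity is a constant of
`K`, and the two agree because their difference is a constant vanishing at infinity. -/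
lemma exists_const_of_mem_invariantRingBase [Finite G] (hn : (Nat.card G : K) ≠ 0) {f : 𝓕}
    (hf : f ∈ invariantRingBase G) (h : valInf E.toAffine f ≤ WithZero.exp 1) :
    ∃ c : K, f = algebraMap K 𝓕 c := by
  have hn' : (Nat.card G : k) ≠ 0 := by
    rw [← map_natCast (algebraMap K k)]
    exact (_root_.map_ne_zero _).2 hn
  obtain ⟨d, hd⟩ := exists_const_of_mem_invariantRing hn' ((mem_invariantRingBase E).1 hf) (by
    rwa [valInf_functionFieldBaseChange])
  have hv : valInf E.toAffine f ≤ 1 := by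
    rw [← valInf_functionFieldBaseChange k, hd]
    exact valInf_algebraMap_le _ _
  obtain ⟨c, hc⟩ := exists_valInf_sub_lt_one E.toAffine hv
  have e : functionFieldBaseChange k E (f - algebraMap K 𝓕 c) =
      algebraMap k 𝓜 (d - algebraMap K k c) := by
    rw [map_sub, map_sub, hd, AlgHom.commutes, ← IsScalarTower.algebraMap_apply]
  rw [← valInf_functionFieldBaseChange k, e] at hc
  have h0 := eq_zero_of_valInf_algebraMap_lt hc
  rw [h0, _root_.map_zero] at e
  exact ⟨c, sub_eq_zero.1 ((_root_.map_eq_zero (functionFieldBaseChange k E)).1 e)⟩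

lemma Δ_ne_zero_of_equation_base [Finite G] (hn : (Nat.card G : K) ≠ 0) {W : WeierstrassCurve K}
    {X Y : 𝓕} (hX : X ∈ invariantRingBase G) (hY : Y ∈ invariantRingBase G)
    (hvX : valInf E.toAffine X = WithZero.exp 2) (hvY : valInf E.toAffine Y = WithZero.exp 3)
    (h : (W.map (algebraMap K 𝓕)).toAffine.Equation X Y) : W.Δ ≠ 0 := by
  have hn' : (Nat.card G : k) ≠ 0 := by
    rw [← map_natCast (algebraMap K k)]
    exact (_root_.map_ne_zero _).2 hn
  have h' : ((W.map (algebraMap K k)).map (algebraMap k 𝓜)).toAffine.Equation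
      (functionFieldBaseChange k E X) (functionFieldBaseChange k E Y) := by
    have h₁ := h.map (functionFieldBaseChange k E : 𝓕 →+* 𝓜)
    have e : (W.map (algebraMap K 𝓕)).map (functionFieldBaseChange k E : 𝓕 →+* 𝓜) =
        (W.map (algebraMap K k)).map (algebraMap k 𝓜) := by
      ext <;> simp [← IsScalarTower.algebraMap_apply]
    exact e ▸ h₁
  have := Δ_ne_zero_of_equation hn' ((mem_invariantRingBase E).1 hX)
    ((mem_invariantRingBase E).1 hY) (by rwa [valInf_functionFieldBaseChange])
    (by rwa [valInf_functionFieldBaseChange]) h'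
  rw [map_Δ] at this
  exact fun h0 ↦ this (by rw [h0, _root_.map_zero])

variable {E} {W : WeierstrassCurve K} {X Y : E.toAffine.FunctionField}

/-- The homomorphism of function fields with given values at the coordinate functions. -/
noncomputable def pullbackOfEquation
    (h : (W.map (algebraMap K E.toAffine.FunctionField)).toAffine.Equation X Y)
    (hX : 1 < valInf E.toAffine X) :
    W.toAffine.FunctionField →ₐ[K] E.toAffine.FunctionField :=
  { FunctionField.lift (algebraMap K E.toAffine.FunctionField) h
      (fun _ hp ↦ aeval_ne_zero_of_one_lt_valInf hX hp) with
    commutes' := fun r ↦ lift_algebraMap _ _ (fun _ hp ↦ aeval_ne_zero_of_one_lt_valInf hX hp) r }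

lemma pullbackOfEquation_x
    (h : (W.map (algebraMap K E.toAffine.FunctionField)).toAffine.Equation X Y)
    (hX : 1 < valInf E.toAffine X) : pullbackOfEquation h hX (x W.toAffine) = X :=
  lift_x _ _ (fun _ hp ↦ aeval_ne_zero_of_one_lt_valInf hX hp)

lemma pullbackOfEquation_y
    (h : (W.map (algebraMap K E.toAffine.FunctionField)).toAffine.Equation X Y)
    (hX : 1 < valInf E.toAffine X) : pullbackOfEquation h hX (y W.toAffine) = Y :=
  lift_y _ _ (fun _ hp ↦ aeval_ne_zero_of_one_lt_valInf hX hp)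

variable (E) [Normal K k] in
lemma exists_mem_invariantRingBase [Fintype G]
    (hG : ∀ σ : k ≃ₐ[K] k, ∀ Q ∈ G, Point.map (σ : k →ₐ[K] k) Q ∈ G)
    (hsep : ∀ Q ∈ G, IsSeparable K Q.xCoord ∧ IsSeparable K Q.yCoord) :
    ∃ X ∈ invariantRingBase G, ∃ Y ∈ invariantRingBase G,
      valInf E.toAffine X = WithZero.exp 2 ∧ valInf E.toAffine Y = WithZero.exp 3 ∧
      ∃ p : E.toAffine.FunctionField[X], p.map (functionFieldBaseChange k E : 𝓕 →+* 𝓜) =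
        translatePoly G := by
  -- This field contains both the function field of `E` and a copy of `k`, so automorphisms act on
  -- the two at once.
  let N := AlgebraicClosure E.toAffine.FunctionField
  let _ : Algebra k N := (IsAlgClosed.lift (R := K) (S := k) (M := N)).toRingHom.toAlgebra
  have : IsScalarTower K k N := IsScalarTower.of_algebraMap_eq fun r ↦
    ((IsAlgClosed.lift (R := K) (S := k) (M := N)).commutes r).symm
  obtain ⟨X, hX⟩ := exists_baseChange_eq_sum E N hG hsep (Or.inl rfl)
  obtain ⟨Y, hY⟩ := exists_baseChange_eq_sum E N hG hsep (Or.inr rfl)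
  rw [functionFieldBaseChange_x] at hX
  rw [functionFieldBaseChange_y] at hY
  refine ⟨X, ?_, Y, ?_, ?_, ?_, exists_baseChange_eq_translatePoly E N hG hsep⟩
  · rw [mem_invariantRingBase, hX]
    exact sum_translate_mem_invariantRing fun Q hQ ↦ valInf_translate_x_le hQ
  · rw [mem_invariantRingBase, hY]
    exact sum_translate_mem_invariantRing fun Q hQ ↦ valInf_translate_y_le hQ
  · rw [← valInf_functionFieldBaseChange k, hX, valInf_sum_translate
      (fun Q hQ ↦ valInf_translate_x_le hQ), valInf_x]
    rw [valInf_x, ← WithZero.exp_zero, WithZero.exp_lt_exp]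
    norm_num
  · rw [← valInf_functionFieldBaseChange k, hY, valInf_sum_translate
      (fun Q hQ ↦ valInf_translate_y_le hQ), valInf_y]
    rw [valInf_y, ← WithZero.exp_zero, WithZero.exp_lt_exp]
    norm_num

lemma translate_pullback (h : (W.map (algebraMap K E.toAffine.FunctionField)).toAffine.Equation X Y)
    (hvX : 1 < valInf E.toAffine X) (hX : X ∈ invariantRingBase G) (hY : Y ∈ invariantRingBase G)
    {Q : (E⁄k).toAffine.Point} (hQ : Q ∈ G) (g : W.toAffine.FunctionField) :
    translate Q (functionFieldBaseChange k E (pullbackOfEquation h hvX g)) =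
      functionFieldBaseChange k E (pullbackOfEquation h hvX g) := by
  have : ((translate Q : 𝓜 →+* 𝓜).comp (functionFieldBaseChange k E : 𝓕 →+* 𝓜)).comp
      (pullbackOfEquation h hvX : W.toAffine.FunctionField →+* 𝓕) =
      (functionFieldBaseChange k E : 𝓕 →+* 𝓜).comp
        (pullbackOfEquation h hvX : W.toAffine.FunctionField →+* 𝓕) := by
    refine FunctionField.hom_ext (fun r ↦ ?_) ?_ ?_
    · simp only [RingHom.comp_apply, RingHom.coe_coe]
      rw [AlgHom.commutes, AlgHom.commutes, IsScalarTower.algebraMap_apply K k 𝓜, AlgHom.commutes]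
    · simp only [RingHom.comp_apply, RingHom.coe_coe, pullbackOfEquation_x]
      exact hX.1 Q hQ
    · simp only [RingHom.comp_apply, RingHom.coe_coe, pullbackOfEquation_y]
      exact hY.1 Q hQ
  exact congrArg (fun φ ↦ φ g) this

/-- The quotient of an elliptic curve by a Galois stable group of separable points, whose order is
invertible in the field, is an elliptic curve over the base field. -/
theorem hasRationalIsogeny_of_stable [Normal K k] [Finite G] (hn : (Nat.card G : K) ≠ 0)
    (hG : ∀ σ : k ≃ₐ[K] k, ∀ Q ∈ G, Point.map (σ : k →ₐ[K] k) Q ∈ G)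
    (hsep : ∀ Q ∈ G, IsSeparable K Q.xCoord ∧ IsSeparable K Q.yCoord) :
    EllipticPreimage.HasRationalIsogeny E (Nat.card G) := by
  have : Fintype G := Fintype.ofFinite G
  obtain ⟨X₀, hX₀, Y₀, hY₀, hvX₀, hvY₀, p, hp⟩ := exists_mem_invariantRingBase E hG hsep
  have hconst (f : E.toAffine.FunctionField) (hf : f ∈ invariantRingBase G)
      (h : valInf E.toAffine f ≤ WithZero.exp 1) := exists_const_of_mem_invariantRingBase E hn hf h
  obtain ⟨W, X, hX, Y, hY, hvX, hvY, h⟩ :=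
    exists_equation_of_valInf hconst hX₀ hY₀ hvX₀ hvY₀
  have hW : W.IsElliptic := ⟨(Δ_ne_zero_of_equation_base E hn hX hY hvX hvY h).isUnit⟩
  have hX1 : 1 < valInf E.toAffine X := by
    rw [hvX, ← WithZero.exp_zero, WithZero.exp_lt_exp]
    norm_num
  refine ⟨W, hW, ⟨pullbackOfEquation h hX1, hasPoleAtInfinity_of_one_lt ?_⟩, ?_⟩
  · change 1 < valInf E.toAffine (pullbackOfEquation h hX1 (x W.toAffine))
    rwa [pullbackOfEquation_x]
  change Module.finrank (pullbackOfEquation h hX1).fieldRange E.toAffine.FunctionField = _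
  set S := (pullbackOfEquation h hX1).fieldRange with hS
  have hXS : X ∈ S := ⟨x W.toAffine, pullbackOfEquation_x h hX1⟩
  have hYS : Y ∈ S := ⟨y W.toAffine, pullbackOfEquation_y h hX1⟩
  have hmonic : p.Monic := by
    refine Polynomial.monic_of_injective
      (f := (functionFieldBaseChange k E : 𝓕 →+* 𝓜)) (RingHom.injective _) ?_
    rw [hp]
    exact monic_translatePoly
  have hcoeff (n : ℕ) : p.coeff n ∈ S := by
    have e : functionFieldBaseChange k E (p.coeff n) = (translatePoly G).coeff n := by
      rw [← hp, coeff_map]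
      rfl
    -- The coefficients are invariant with at most a double pole, hence affine linear in `X`; so the
    -- polynomial with the translates of `x` as roots is defined over the image of the pullback.
    obtain ⟨c, d, hcd⟩ := exists_eq_of_valInf_le_two hconst hX hvX (f := p.coeff n)
      (by rw [mem_invariantRingBase, e]; exact coeff_translatePoly_mem n)
      (by rw [← valInf_functionFieldBaseChange k, e]; exact valInf_coeff_translatePoly_le n)
    rw [hcd]
    exact S.add_mem (S.mul_mem (S.algebraMap_mem c) hXS) (S.algebraMap_mem d)
  obtain ⟨q, hq⟩ : ∃ q : S[X], q.map (algebraMap S E.toAffine.FunctionField) = p :=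
    (lifts_iff_coeff_lifts p).2 fun n ↦ ⟨⟨_, hcoeff n⟩, rfl⟩
  have hcard : Nat.card G = Fintype.card G := Nat.card_eq_fintype_card
  rw [hcard]
  -- The embeddings are the translations by `G`, which agree on the image of the pullback; the
  -- generator is `x`, because `x` together with the triple-pole function `Y` generates the function
  -- field.
  refine finrank_eq_card_of_adjoin_eq_top (x := x E.toAffine) (p := q)
    (fun Q : G ↦ (translate Q.1 : 𝓜 →+* 𝓜).comp (functionFieldBaseChange k E : 𝓕 →+* 𝓜))
    (fun Q R hQR ↦ Subtype.ext (translate_injective (algHom_ext ?_ ?_))) ?_ ?_ ?_ ?_ ?_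
  · have := congrArg (fun φ ↦ φ (x E.toAffine)) hQR
    simpa only [RingHom.comp_apply, RingHom.coe_coe, functionFieldBaseChange_x] using this
  · have := congrArg (fun φ ↦ φ (y E.toAffine)) hQR
    simpa only [RingHom.comp_apply, RingHom.coe_coe, functionFieldBaseChange_y] using this
  · rintro Q R ⟨_, g, rfl⟩
    exact (translate_pullback h hX1 hX hY Q.2 g).trans (translate_pullback h hX1 hX hY R.2 g).symm
  · have hT := eq_top_of_mem (T := (IntermediateField.adjoin S {x E.toAffine}).restrictScalars K)
      (f := Y) (IntermediateField.mem_adjoin_simple_self S (x E.toAffine))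
      ((IntermediateField.adjoin S {x E.toAffine}).algebraMap_mem (⟨Y, hYS⟩ : S)) hvY
    rw [← IntermediateField.restrictScalars_eq_top_iff (K := K)]
    exact hT
  · exact Polynomial.monic_of_injective (algebraMap S E.toAffine.FunctionField).injective
      (by rwa [hq])
  · rw [← hcard, ← natDegree_translatePoly (G := G), ← hp, ← hq, natDegree_map, natDegree_map]
  · apply (functionFieldBaseChange k E).injective
    rw [_root_.map_zero, aeval_def, ← eval_map, hq]
    have := eval_translatePoly (G := G)
    rw [← hp, ← functionFieldBaseChange_x, eval_map] at this
    rw [← this]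
    exact (eval₂_at_apply (functionFieldBaseChange k E : 𝓕 →+* 𝓜) _).symm

end Isogeny
end WeierstrassCurve.Affine

/-! ### The Galois action on the fibre over `P` and the conclusion -/

namespace WeierstrassCurve.Affine

section GaloisStable
open WeierstrassCurve.Affine.Point
variable {K L : Type*} [Field K] [DecidableEq K] [Field L] [DecidableEq L] [Algebra K L]
  (E : WeierstrassCurve K) [E.IsElliptic]

/-- The action of field automorphisms on the points of a curve defined over the base field. -/
@[reducible] noncomputable def galoisAction :
    DistribMulAction (L ≃ₐ[K] L) (E⁄L).toAffine.Point where
  smul σ Q := Point.map (σ : L →ₐ[K] L) Q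
  one_smul Q := by cases Q <;> rfl
  mul_smul σ τ Q := by cases Q <;> rfl
  smul_zero σ := _root_.map_zero _
  smul_add σ := map_add _

variable {E}

lemma hasRationalIsogeny_of_stable_of_isGalois [IsGalois K L]
    {G : AddSubgroup (E⁄L).toAffine.Point} [Finite G] (hn : (Nat.card G : K) ≠ 0)
    (hG : ∀ σ : L ≃ₐ[K] L, ∀ Q ∈ G, Point.map (σ : L →ₐ[K] L) Q ∈ G) :
    EllipticPreimage.HasRationalIsogeny E (Nat.card G) := by
  classical
  let k := AlgebraicClosure L
  have : IsAlgClosure K k := ⟨inferInstance, Algebra.IsAlgebraic.trans K L k⟩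
  have : Normal K k := IsAlgClosure.normal K k
  have hinj := Point.map_injective (W' := E) (Algebra.ofId L k)
  let G' : AddSubgroup (E⁄k).toAffine.Point := G.map (Point.map (Algebra.ofId L k))
  let e : G ≃+ G' := G.equivMapOfInjective _ hinj
  have : Finite G' := Finite.of_equiv G e.toEquiv
  have hcard : Nat.card G' = Nat.card G := (Nat.card_congr e.toEquiv).symm
  have key := hasRationalIsogeny_of_stable (E := E) (G := G') (by rwa [hcard]) ?_ ?_
  · rwa [hcard] at key
  · rintro σ _ ⟨Q, hQ, rfl⟩
    refine ⟨_, hG (σ.restrictNormal L) Q hQ, ?_⟩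
    by_cases hQ0 : Q = 0
    · simp only [hQ0, _root_.map_zero]
    refine ext_coord (map_ne_zero _ (map_ne_zero _ hQ0)) (map_ne_zero _ (map_ne_zero _ hQ0)) ?_ ?_
    · simp only [xCoord_map, Algebra.ofId_apply]
      exact σ.restrictNormal_commutes L _
    · simp only [yCoord_map, Algebra.ofId_apply]
      exact σ.restrictNormal_commutes L _
  · rintro _ ⟨Q, -, rfl⟩
    have h (c : L) : IsSeparable K (algebraMap L k c) :=
      (Algebra.IsSeparable.isSeparable K c).map (IsScalarTower.toAlgHom K L k)
        (algebraMap L k).injective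
    rw [xCoord_map, yCoord_map]
    exact ⟨h _, h _⟩

lemma exists_map_eq_of_forall_fixed [IsGalois K L] {R : (E⁄L).toAffine.Point}
    (h : ∀ σ : L ≃ₐ[K] L, Point.map (σ : L →ₐ[K] L) R = R) :
    ∃ R' : (E⁄K).toAffine.Point, Point.map (Algebra.ofId K L) R' = R := by
  by_cases hR : R = 0
  · exact ⟨0, by rw [_root_.map_zero, hR]⟩
  obtain ⟨a, ha⟩ := mem_range_algebraMap_of_forall_fixed
    (Algebra.IsSeparable.isSeparable K R.xCoord) fun σ ↦ by
      conv_rhs => rw [← h σ, xCoord_map]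
      rfl
  obtain ⟨b, hb⟩ := mem_range_algebraMap_of_forall_fixed
    (Algebra.IsSeparable.isSeparable K R.yCoord) fun σ ↦ by
      conv_rhs => rw [← h σ, yCoord_map]
      rfl
  have hns := nonsingular_coord hR
  rw [← ha, ← hb] at hns
  have hns' := (WeierstrassCurve.Affine.baseChange_nonsingular (W := E)
    (f := Algebra.ofId K L) (algebraMap K L).injective a b).mp hns
  refine ⟨.some a b hns', ?_⟩
  exact ext_coord (map_ne_zero _ (some_ne_zero _)) hR ha hb

variable {l : ℕ} {P : (E⁄K).toAffine.Point}

lemma map_delta :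
    ((E⁄K).Φ l - C P.xCoord * (E⁄K).ΨSq l).map (algebraMap K L) =
      (E⁄L).Φ l - C (Point.map (Algebra.ofId K L) P).xCoord * (E⁄L).ΨSq l := by
  have e : WeierstrassCurve.map (E⁄K) (algebraMap K L) = E⁄L := by ext <;> rfl
  rw [Polynomial.map_sub, Polynomial.map_mul, map_C, ← map_Φ, ← map_ΨSq, e, xCoord_map]
  rfl

/-- The minimal polynomial of one `x(R)` vanishes at all its conjugates, which are the `l²` distinct
values of `x` on the fibre. It divides the monic polynomial `δ` of the same degree. -/
lemma irreducible_delta_of_transitive [IsGalois K L] [IsSepClosed L] (hl : 1 ≤ l)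
    (hlK : (l : K) ≠ 0) (hP : P ≠ 0) (hψ : (Point.map (Algebra.ofId K L) P).psiTwo ≠ 0)
    (h : ∀ R S : (E⁄L).toAffine.Point, l • R = Point.map (Algebra.ofId K L) P →
      l • S = Point.map (Algebra.ofId K L) P → ∃ σ : L ≃ₐ[K] L, Point.map (σ : L →ₐ[K] L) R = S) :
    Irreducible ((E⁄K).Φ l - C P.xCoord * (E⁄K).ΨSq l) := by
  set P' := Point.map (Algebra.ofId K L) P with hP'
  have hP0 : P' ≠ 0 := map_ne_zero _ hP
  have hlL : (l : L) ≠ 0 := by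
    rw [← map_natCast (algebraMap K L)]
    exact (_root_.map_ne_zero _).2 hlK
  have hT := ncard_nsmul_eq hl hP0 hψ hlL
  obtain ⟨R, hR⟩ : {R : (E⁄L).toAffine.Point | l • R = P'}.Nonempty :=
    Set.nonempty_of_ncard_ne_zero (by rw [hT]; exact pow_ne_zero 2 (by omega))
  replace hR : l • R = P' := hR
  have hint : _root_.IsIntegral K R.xCoord := Algebra.IsIntegral.isIntegral _
  have hroot : aeval R.xCoord ((E⁄K).Φ l - C P.xCoord * (E⁄K).ΨSq l) = 0 := by
    rw [← eval_map_algebraMap, map_delta]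
    exact eval_delta_of_nsmul_eq hl hP0 hR
  have hdeg : l ^ 2 ≤ (minpoly K R.xCoord).natDegree := by
    rw [← hT, ← (xCoord_injOn hP0 hψ).ncard_image]
    have hsub : xCoord '' {R : (E⁄L).toAffine.Point | l • R = P'} ⊆
        (minpoly K R.xCoord).rootSet L := by
      rintro _ ⟨S, hS, rfl⟩
      obtain ⟨σ, rfl⟩ := h R S hR hS
      rw [mem_rootSet_of_ne (minpoly.ne_zero hint), xCoord_map, aeval_algHom_apply, minpoly.aeval,
        _root_.map_zero]
    refine (Set.ncard_le_ncard hsub (rootSet_finite _ _)).trans ?_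
    exact ncard_rootSet_le _ _
  have heq := eq_of_monic_of_dvd_of_natDegree_le (minpoly.monic hint) (monic_delta hl)
    (minpoly.dvd K _ hroot) (by rwa [natDegree_delta hl])
  rw [heq]
  exact minpoly.irreducible hint

lemma delta_of_ne_zero {W : WeierstrassCurve K} {P : W.toAffine.Point} (hP : P ≠ 0) (m : ℤ) :
    EllipticPreimage.delta W m P = W.Φ m - C P.xCoord * W.ΨSq m := by
  rcases P with _ | _
  · exact (hP rfl).elim
  · rfl

theorem irreducible_delta_or_isogeny_or_exists (hl : l.Prime) (hlK : (l : K) ≠ 0) :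
    Irreducible (EllipticPreimage.delta (E⁄K) l P) ∨
      EllipticPreimage.HasRationalIsogeny E l ∨ ∃ R : (E⁄K).toAffine.Point, l • R = P := by
  classical
  by_cases hP : P = 0
  · exact Or.inr (Or.inr ⟨0, by rw [hP, smul_zero]⟩)
  -- At a 2-torsion point the fibre is stable under negation, so `x` need not be injective on it.
  -- For `l = 2` the point generates a rational kernel; for `l` odd it is its own preimage.
  by_cases h2 : P + P = 0
  · rcases hl.eq_two_or_odd' with rfl | ⟨m, rfl⟩
    · refine Or.inr (Or.inl ?_)
      have : Fact (Nat.Prime 2) := ⟨hl⟩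
      have hcard : Nat.card (AddSubgroup.zmultiples P) = 2 := by
        rw [Nat.card_zmultiples]
        exact addOrderOf_eq_prime (by rwa [two_nsmul]) hP
      have : Finite (AddSubgroup.zmultiples P) := Nat.finite_of_card_ne_zero (by omega)
      have key := hasRationalIsogeny_of_stable_of_isGalois (L := K)
        (G := AddSubgroup.zmultiples P) (by rwa [hcard]) ?_
      · rwa [hcard] at key
      · intro σ Q hQ
        have : Point.map (σ : K →ₐ[K] K) Q = Q := by
          have : (σ : K →ₐ[K] K) = Algebra.ofId K K := Subsingleton.elim _ _
          rw [this, Point.map_id]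
        rwa [this]
    · refine Or.inr (Or.inr ⟨P, ?_⟩)
      rw [add_smul, mul_comm, mul_smul, two_nsmul, h2, smul_zero, zero_add, one_smul]
  let L := SeparableClosure K
  let _ := galoisAction (L := L) E
  set P' := Point.map (Algebra.ofId K L) P with hP'
  have hP0 : P' ≠ 0 := map_ne_zero _ hP
  have hψ : P'.psiTwo ≠ 0 := by
    rw [Ne, psiTwo_eq_zero_iff hP0, hP', ← map_add]
    exact map_ne_zero _ h2
  have hlL : (l : L) ≠ 0 := by
    rw [← map_natCast (algebraMap K L)]
    exact (_root_.map_ne_zero _).2 hlK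
  have hfix (σ : L ≃ₐ[K] L) : σ • P' = P' := by
    change Point.map (σ : L →ₐ[K] L) P' = P'
    rw [hP', Point.map_map]
    exact congrArg (fun f ↦ Point.map f P) (Subsingleton.elim _ _)
  rcases fixed_or_transitive_or_stable hfix hl (ncard_nsmul_eq hl.one_le hP0 hψ hlL) with
    ⟨R, hR, hRfix⟩ | htrans | ⟨C, hC, hCstable⟩
  · obtain ⟨R', rfl⟩ := exists_map_eq_of_forall_fixed hRfix
    refine Or.inr (Or.inr ⟨R', Point.map_injective (Algebra.ofId K L) ?_⟩)
    rw [map_nsmul, hR]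
  · refine Or.inl ?_
    rw [delta_of_ne_zero hP]
    exact irreducible_delta_of_transitive hl.one_le hlK hP hψ htrans
  · refine Or.inr (Or.inl ?_)
    have : Finite C := Nat.finite_of_card_ne_zero (by rw [hC]; exact hl.ne_zero)
    rw [← hC]
    exact hasRationalIsogeny_of_stable_of_isGalois (by rwa [hC]) hCstable

end GaloisStable
end WeierstrassCurve.Affine

theorem theorem1p2 {K : Type*} [Field K] [DecidableEq K] (l : ℕ) (hl : l.Prime)
    (hK : ¬ ringChar K ∣ l) (E : WeierstrassCurve K) [E.IsElliptic] (P : E.toAffine.Point) :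
    Irreducible (EllipticPreimage.delta E l P) ∨
      EllipticPreimage.HasRationalIsogeny E l ∨
      ∃ R : E.toAffine.Point, l • R = P := by
  have hlK : (l : K) ≠ 0 := fun h ↦ hK ((ringChar.spec K l).1 h)
  -- The base change of `E` to `K` itself equals `E` only propositionally, so the equality is
  -- generalized before substitution.
  have key (W : WeierstrassCurve K) (hW : E.map (algebraMap K K) = W) (P : W.toAffine.Point) :
      Irreducible (EllipticPreimage.delta W l P) ∨
        EllipticPreimage.HasRationalIsogeny E l ∨ ∃ R : W.toAffine.Point, l • R = P := by
    subst hW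
    exact WeierstrassCurve.Affine.irreducible_delta_or_isogeny_or_exists hl hlK
  exact key E E.map_id P
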